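/- **Setting.** A structured matrix has entries in $\{0,*,\times\}$. A realization of it is a complex matrix that is zero at the $0$ entries and nonzero at the $\times$ entries (arbitrary at the $*$ entries). Let $\bar A\in\{0,*,\times\}^{n\times n}$, $\bar b\in\{0,*,\times\}^{n\times 1}$, and let $\mathcal N_\times$ be the set of positions $(i,j)$, $1\le i\le n$, $1\le j\le n+1$, of the $\times$ entries of $[\bar A,\bar b]$. A pair $(A,b)$ is controllable if $[b,Ab,\dots,A^{n-1}b]$ has full row rank. The pair $(\bar A,\bar b)$ is *structurally controllable* if, after all $\times$ entries are replaced by $*$, it has a controllable realization. It is *PSSC* (partially strongly structurally controllable) if for all values of the $*$ entries outside a set of Lebesgue measure zero in $\mathbb C^{n_*}$ ($n_*$ is the number of $*$ entries), the realization is controllable for all nonzero complex values of the $\times$ entries. For $\pi\in\mathcal N_\times$, $(\bar A^\pi,\bar b^\pi)$ is obtained from $(\bar A,\bar b)$ by keeping the $\times$ entry at $\pi$ and replacing all other indeterminate entries (those that are $*$ or $\times$) by $*$. *Bipartite graphs.* $\mathcal B([\bar A,\bar b])$ has row vertices $v_1^+,\dots,v_n^+$, column vertices $v_1^-,\dots,v_{n+1}^-$,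 and an edge $(v_k^+,v_l^-)$ for each nonzero entry $(k,l)$ of $[\bar A,\bar b]$. $\mathcal B(H_\lambda)$ has the same vertices and, in addition to these edges, the edges $(v_k^+,v_k^-)$, $k=1,\dots,n$. The latter are called $\lambda$-edges; a self-loop is a $\lambda$-edge that is also an edge of $\mathcal B([\bar A,\bar b])$. $\mathcal B(H_\lambda^{j_c})=\mathcal B(H_\lambda)-\{v_j^-\}$. $\mathcal N(\mathcal G,v)$ is the set of neighbours of $v$ in $\mathcal G$, and $\mathrm{mt}(\mathcal G)$ is the size of a maximum matching of $\mathcal G$. A matching $\mathcal M$ covers a subgraph $\mathcal K$ with edge set $E_{\mathcal K}$ if $\mathcal M\cap E_{\mathcal K}$ is a maximum matching of $\mathcal K$. Let $\mathcal G_1^{j_c},\dots,\mathcal G_d^{j_c}$ be the components of the Dulmage–Mendelsohn decomposition of $\mathcal B(H_\lambda^{j_c})$, other than the horizontal and the vertical tail (both tails are empty if the system is structurally controllable). $\Omega_j$ is the set of $k\in\{1,\dots,d\}$ such that $\mathcal G_k^{j_c}$ contains a self-loop or has two maximum matchings with different numbers of $\lambda$-edges. $\Omega_j^l$ is the set of $k\in\Omega_j$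 such that some maximum matching of $\mathcal B(H_\lambda^{j_c})-\{v_l^+\}$ does not cover $\mathcal G_k^{j_c}$. **Theorem.** $(\bar A,\bar b)$ is PSSC if and only if $(\bar A,\bar b)$ is structurally controllable and for each $\pi=(i,j)\in\mathcal N_\times$ the following two conditions hold, where all graphs and sets are those of the system $(\bar A^\pi,\bar b^\pi)$: 1) at least one of the following holds: - b1) $\mathcal B([\bar A^\pi,\bar b^\pi])$ has a maximum matching that does not match $v_j^-$; - b2) $\mathcal N(\mathcal B([\bar A^\pi,\bar b^\pi]),v_j^-)=\{v_i^+\}$, or $\mathrm{mt}(\mathcal B([\bar A^\pi,\bar b^\pi])-\{v_k^+,v_j^-\})=n-2$ for each $v_k^+\in\mathcal N(\mathcal B([\bar A^\pi,\bar b^\pi]),v_j^-)\setminus\{v_i^+\}$; - b3) $\mathrm{mt}(\mathcal B([\bar A^\pi,\bar b^\pi])-\{v_i^+,v_j^-\})=n-2$; 2) at least one of the following holds: - c1) $\Omega_j^i=\emptyset$; - c2) $\Omega_j^i\neq\emptyset$, $i\ne j$, and for each $v_l^+\in\mathcal N(\mathcal B(H_\lambda),v_j^-)\setminus\{v_i^+\}$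 every maximum matching of $\mathcal B(H_\lambda^{j_c})-\{v_l^+\}$ covers $\bigcup_{k\in\Omega_j^i}\mathcal G_k^{j_c}$. -/

import Mathlib

open MeasureTheory

/-! ## Structured matrices -/

/-- The three kinds of entries of a structured matrix: the fixed zero `0`, the generic entry `*`,
and the unspecified (nonzero) entry `×`. -/
inductive Entry : Type
  | zero : Entry
  | star : Entry
  | cross : Entry
  deriving DecidableEq

namespace Structured

variable {R C : Type*}

/-- The set `S_M` of complex realizations of a structured matrix `M`: a `0` entry is zero, a `×`
entry is nonzero, a `*` entry is arbitrary. -/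
def realizations (M : Matrix R C Entry) : Set (Matrix R C ℂ) :=
  {X | ∀ r c, (M r c = Entry.cross → X r c ≠ 0) ∧ (M r c = Entry.zero → X r c = 0)}

/-- `M` with every indeterminate entry replaced by `*`. -/
def toStar (M : Matrix R C Entry) : Matrix R C Entry :=
  Matrix.of fun r c => if M r c = Entry.cross then Entry.star else M r c

/-- The `×` part of `M`: the `*` entries are replaced by `0`. -/
def crossPart (M : Matrix R C Entry) : Matrix R C Entry :=
  Matrix.of fun r c => if M r c = Entry.cross then Entry.cross else Entry.zero

/-- The `*` part of `M`: the `×` entries are replaced by `0`. -/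
def starPart (M : Matrix R C Entry) : Matrix R C Entry :=
  Matrix.of fun r c => if M r c = Entry.star then Entry.star else Entry.zero

/-- The positions of the `*` entries of `M`. -/
abbrev StarPos (M : Matrix R C Entry) : Type _ := {x : R × C // M x.1 x.2 = Entry.star}

/-- The realization of the `*` part of `M` with parameter vector `p`. -/
def starMatrix (M : Matrix R C Entry) (p : StarPos M → ℂ) : Matrix R C ℂ :=
  Matrix.of fun r c => if h : M r c = Entry.star then p ⟨(r, c), h⟩ else 0

/-- `starMatrix M` identifies the parameter space `ℂ^{n_*}` with the set of realizations of the
`*` part of `M`. -/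
theorem starMatrix_bijOn (M : Matrix R C Entry) :
    Set.BijOn (starMatrix M) Set.univ (realizations (starPart M)) := by
  refine ⟨?_, ?_, ?_⟩
  · intro p _ r c
    by_cases h : M r c = Entry.star <;> simp [starMatrix, starPart, h]
  · intro p _ q _ hpq
    funext x
    have := congrFun (congrFun hpq x.1.1) x.1.2
    simpa [starMatrix, x.2] using this
  · intro X hX
    refine ⟨fun x => X x.1.1 x.1.2, trivial, ?_⟩
    ext r c
    by_cases h : M r c = Entry.star
    · simp [starMatrix, h]
    · have := (hX r c).2 (by simp [starPart, h])
      simp [starMatrix, h, this]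

/-- `M^π`: keep the entry at position `π` and replace all other indeterminate entries by `*`. -/
def keepOnly [DecidableEq R] [DecidableEq C] (M : Matrix R C Entry) (π : R × C) :
    Matrix R C Entry :=
  Matrix.of fun r c => if (r, c) ≠ π ∧ M r c ≠ Entry.zero then Entry.star else M r c

/-! ## Controllability notions -/

variable {n m : ℕ}

/-- The controllability matrix `[B, A B, …, A^{n-1} B]`; the column `(k, c)` is column `c` of
`A^k B`. -/
def ctrbMatrix (A : Matrix (Fin n) (Fin n) ℂ) (B : Matrix (Fin n) (Fin m) ℂ) :
    Matrix (Fin n) (Fin n × Fin m) ℂ :=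
  Matrix.of fun r kc => (A ^ (kc.1 : ℕ) * B) r kc.2

/-- `(A, B)` is controllable: the controllability matrix has full row rank. -/
def Controllable (A : Matrix (Fin n) (Fin n) ℂ) (B : Matrix (Fin n) (Fin m) ℂ) : Prop :=
  (ctrbMatrix A B).rank = n

/-- Structural controllability: some realization of the pattern, with all indeterminate entries
regarded as `*`, is controllable. -/
def StructurallyControllable (A' : Matrix (Fin n) (Fin n) Entry)
    (B' : Matrix (Fin n) (Fin m) Entry) : Prop :=
  ∃ (A : Matrix (Fin n) (Fin n) ℂ) (B : Matrix (Fin n) (Fin m) ℂ),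
    Matrix.fromCols A B ∈ realizations (toStar (Matrix.fromCols A' B')) ∧ Controllable A B

/-- Partial strong structural controllability: for Lebesgue-almost all values of the `*` entries,
the realization is controllable for all nonzero values of the `×` entries. -/
def PSSC (A' : Matrix (Fin n) (Fin n) Entry) (B' : Matrix (Fin n) (Fin m) Entry) : Prop :=
  ∀ᵐ p : StarPos (Matrix.fromCols A' B') → ℂ ∂volume,
    ∀ X ∈ realizations (crossPart (Matrix.fromCols A' B')),
      Controllable (starMatrix (Matrix.fromCols A' B') p + X).toCols₁
        (starMatrix (Matrix.fromCols A' B') p + X).toCols₂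

end Structured

/-! ## Bipartite graphs and matchings -/

/-- A finite bipartite graph with row vertices `V⁺ ⊆ R`, column vertices `V⁻ ⊆ C` and edges
between them. -/
structure BipGraph (R C : Type*) where
  rows : Finset R
  cols : Finset C
  edges : Finset (R × C)
  incident : ∀ e ∈ edges, e.1 ∈ rows ∧ e.2 ∈ cols

namespace BipGraph

variable {R C : Type*}

/-- A matching: a set of edges no two of which share an end vertex. -/
def IsMatching (G : BipGraph R C) (M : Finset (R × C)) : Prop :=
  M ⊆ G.edges ∧ ∀ e ∈ M, ∀ f ∈ M, e ≠ f → e.1 ≠ f.1 ∧ e.2 ≠ f.2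

/-- A maximum matching: a matching of the largest size. -/
def IsMaxMatching (G : BipGraph R C) (M : Finset (R × C)) : Prop :=
  G.IsMatching M ∧ ∀ N, G.IsMatching N → N.card ≤ M.card

open Classical in
/-- `mt(G)`, the size of the maximum matchings of `G`. -/
noncomputable def mt (G : BipGraph R C) : ℕ :=
  (G.edges.powerset.filter G.IsMatching).sup Finset.card

/-- The neighbours of a column vertex. -/
def colNbrs (G : BipGraph R C) (c : C) : Set R := {r | (r, c) ∈ G.edges}

variable [DecidableEq R] [DecidableEq C]

/-- The subgraph induced by the vertices of `G` in `S` and `T`. -/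
def induce (G : BipGraph R C) (S : Finset R) (T : Finset C) : BipGraph R C where
  rows := G.rows ∩ S
  cols := G.cols ∩ T
  edges := G.edges.filter fun e => e.1 ∈ S ∧ e.2 ∈ T
  incident := by
    intro e he
    simp only [Finset.mem_filter] at he
    simp [G.incident e he.1, he.2]

/-- Delete a row vertex. -/
def deleteRow (G : BipGraph R C) (r : R) : BipGraph R C := G.induce (G.rows.erase r) G.cols

/-- Delete a column vertex. -/
def deleteCol (G : BipGraph R C) (c : C) : BipGraph R C := G.induce G.rows (G.cols.erase c)

/-- The set of edges `N` covers `K`: its edges in `K` form a maximum matching of `K`. -/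
def Covers (N : Finset (R × C)) (K : BipGraph R C) : Prop := K.IsMaxMatching (N ∩ K.edges)

open Classical in
/-- The union of a family of bipartite graphs on finite vertex types. -/
noncomputable def union [Fintype R] [Fintype C] (S : Set (BipGraph R C)) : BipGraph R C where
  rows := Finset.univ.filter fun r => ∃ K ∈ S, r ∈ K.rows
  cols := Finset.univ.filter fun c => ∃ K ∈ S, c ∈ K.cols
  edges := Finset.univ.filter fun e => ∃ K ∈ S, e ∈ K.edges
  incident := by
    intro e he
    simp only [Finset.mem_filter, Finset.mem_univ, true_and] at he ⊢
    obtain ⟨K, hK, hKe⟩ := he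
    exact ⟨⟨K, hK, (K.incident e hKe).1⟩, ⟨K, hK, (K.incident e hKe).2⟩⟩

/-! ## The Dulmage–Mendelsohn decomposition -/

/-- A partition of the vertices into classes `0, 1, …, d, ∞`, given by labels in `Fin (d + 2)`;
the last label `d + 1` plays the role of `∞`. Labels of elements outside the vertex sets of the
graph under consideration are irrelevant. -/
structure Labelling (R C : Type*) where
  d : ℕ
  row : R → Fin (d + 2)
  col : C → Fin (d + 2)

/-- The class `G_k` of a labelling: the subgraph of `G` induced by the vertices of label `k`. -/
def part (G : BipGraph R C) (D : Labelling R C) (k : Fin (D.d + 2)) : BipGraph R C :=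
  G.induce (G.rows.filter fun r => D.row r = k) (G.cols.filter fun c => D.col c = k)

/-- The defining properties of a Dulmage–Mendelsohn decomposition, except its maximality. -/
structure IsBlockDecomposition (G : BipGraph R C) (D : Labelling R C) : Prop where
  /-- The classes `1, …, d` are nonempty and have perfect matchings. -/
  square : ∀ k, k ≠ 0 → k ≠ Fin.last _ → (G.part D k).rows.Nonempty ∧
    (G.part D k).mt = (G.part D k).rows.card ∧ (G.part D k).rows.card = (G.part D k).cols.card
  /-- The class `0` is a horizontal tail. -/
  horizontal : (G.part D 0).rows.Nonempty →
    (G.part D 0).mt = (G.part D 0).rows.card ∧ (G.part D 0).rows.card < (G.part D 0).cols.card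
  /-- The class `∞` is a vertical tail. -/
  vertical : (G.part D (Fin.last _)).cols.Nonempty →
    (G.part D (Fin.last _)).mt = (G.part D (Fin.last _)).cols.card ∧
      (G.part D (Fin.last _)).cols.card < (G.part D (Fin.last _)).rows.card
  /-- Each edge within a class is admissible in it. -/
  admissible : ∀ k, ∀ e ∈ (G.part D k).edges, ∃ M, (G.part D k).IsMaxMatching M ∧ e ∈ M
  /-- The block structure is upper triangular. -/
  triangular : ∀ e ∈ G.edges, D.row e.1 ≤ D.col e.2
  /-- The maximum matchings are the unions of maximum matchings of the classes. -/
  maxMatching_iff : ∀ M, M ⊆ G.edges → (G.IsMaxMatching M ↔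
    (∀ e ∈ M, ∃ k, e ∈ (G.part D k).edges) ∧
      ∀ k, (G.part D k).IsMaxMatching (M ∩ (G.part D k).edges))

/-- A Dulmage–Mendelsohn decomposition: one that cannot be refined into more components. (The
tails that are nonempty are the same for all decompositions, so that counting components amounts
to comparing `d`.) -/
def IsDMDecomposition (G : BipGraph R C) (D : Labelling R C) : Prop :=
  G.IsBlockDecomposition D ∧ ∀ D', G.IsBlockDecomposition D' → D'.d ≤ D.d

/-- The set of the DM-components `G_1, …, G_d` of `G` other than the tails. The decomposition is
unique up to the order of its components, so this set does not depend on the choice of `D`. -/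
def dmComponents (G : BipGraph R C) : Set (BipGraph R C) :=
  {K | ∃ D, G.IsDMDecomposition D ∧ ∃ k, k ≠ 0 ∧ k ≠ Fin.last _ ∧ K = G.part D k}

/-- The largest number of edges in `L` that a maximum matching of `K` contains. -/
noncomputable def gammaMax (L : Finset (R × C)) (K : BipGraph R C) : ℕ :=
  sSup {k | ∃ M, K.IsMaxMatching M ∧ (M ∩ L).card = k}

/-- The smallest number of edges in `L` that a maximum matching of `K` contains. -/
noncomputable def gammaMin (L : Finset (R × C)) (K : BipGraph R C) : ℕ :=
  sInf {k | ∃ M, K.IsMaxMatching M ∧ (M ∩ L).card = k}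

end BipGraph

/-! ## The bipartite graphs of a structured system and the matching conditions -/

namespace Structured

/-- The bipartite graph `B(M)` of a structured matrix `M`. -/
def bip {R C : Type*} [Fintype R] [Fintype C] (M : Matrix R C Entry) : BipGraph R C where
  rows := Finset.univ
  cols := Finset.univ
  edges := Finset.univ.filter fun e => M e.1 e.2 ≠ Entry.zero
  incident := by simp

variable {n m : ℕ}

/-- The `λ`-edges `(v_k⁺, v_k⁻)`, `k = 1, …, n`. -/
def lambdaEdges (n m : ℕ) : Finset (Fin n × (Fin n ⊕ Fin m)) :=
  Finset.univ.image fun k => (k, Sum.inl k)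

/-- The bipartite graph `B(H_λ)` of the pencil `H_λ = [A - λ I, B]` for a generic realization
`[A, B]` of `M`. -/
def bipPencil (M : Matrix (Fin n) (Fin n ⊕ Fin m) Entry) : BipGraph (Fin n) (Fin n ⊕ Fin m) where
  rows := Finset.univ
  cols := Finset.univ
  edges := lambdaEdges n m ∪ (bip M).edges
  incident := by simp

/-- The bipartite graph `B(H_λ^{j_c})`: the column `j` is deleted. -/
def bipPencilMinor (M : Matrix (Fin n) (Fin n ⊕ Fin m) Entry) (j : Fin n ⊕ Fin m) :
    BipGraph (Fin n) (Fin n ⊕ Fin m) :=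
  (bipPencil M).deleteCol j

/-- `γ_nz(K) = 1`: the number of `λ`-edges varies over the maximum matchings of `K`, or `K`
contains a self-loop (a `λ`-edge that is also an edge of `B(M)`). -/
def GammaNZ (M : Matrix (Fin n) (Fin n ⊕ Fin m) Entry)
    (K : BipGraph (Fin n) (Fin n ⊕ Fin m)) : Prop :=
  K.gammaMin (lambdaEdges n m) < K.gammaMax (lambdaEdges n m) ∨
    ∃ e ∈ K.edges, e ∈ lambdaEdges n m ∧ e ∈ (bip M).edges

/-- `Ω_j`, as a set of DM-components of `B(H_λ^{j_c})` instead of their indices. -/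
def Omega (M : Matrix (Fin n) (Fin n ⊕ Fin m) Entry) (j : Fin n ⊕ Fin m) :
    Set (BipGraph (Fin n) (Fin n ⊕ Fin m)) :=
  {K | K ∈ (bipPencilMinor M j).dmComponents ∧ GammaNZ M K}

/-- `Ω_j^l`: the members of `Ω_j` that some maximum matching of `B(H_λ^{j_c}) - {v_l⁺}` does not
cover. -/
def OmegaAt (M : Matrix (Fin n) (Fin n ⊕ Fin m) Entry) (j : Fin n ⊕ Fin m) (l : Fin n) :
    Set (BipGraph (Fin n) (Fin n ⊕ Fin m)) :=
  {K | K ∈ Omega M j ∧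
    ∃ N, ((bipPencilMinor M j).deleteRow l).IsMaxMatching N ∧ ¬ BipGraph.Covers N K}

/-- b1): some maximum matching of `B(M)` does not match `v_j⁻`. -/
def CondB1 (M : Matrix (Fin n) (Fin n ⊕ Fin m) Entry) (j : Fin n ⊕ Fin m) : Prop :=
  ∃ N, (bip M).IsMaxMatching N ∧ ∀ e ∈ N, e.2 ≠ j

/-- b2): `v_i⁺` is the only neighbour of `v_j⁻`, or `mt(B(M) - {v_k⁺, v_j⁻}) = n - 2` for each
neighbour `v_k⁺ ≠ v_i⁺` of `v_j⁻`. -/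
def CondB2 (M : Matrix (Fin n) (Fin n ⊕ Fin m) Entry) (i : Fin n) (j : Fin n ⊕ Fin m) : Prop :=
  (bip M).colNbrs j = {i} ∨
    ∀ k ∈ (bip M).colNbrs j \ {i}, ((((bip M).deleteRow k).deleteCol j).mt : ℤ) = (n : ℤ) - 2

/-- b3): `mt(B(M) - {v_i⁺, v_j⁻}) = n - 2`. -/
def CondB3 (M : Matrix (Fin n) (Fin n ⊕ Fin m) Entry) (i : Fin n) (j : Fin n ⊕ Fin m) : Prop :=
  ((((bip M).deleteRow i).deleteCol j).mt : ℤ) = (n : ℤ) - 2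

/-- c1): `Ω_j^i` is empty. -/
def CondC1 (M : Matrix (Fin n) (Fin n ⊕ Fin m) Entry) (i : Fin n) (j : Fin n ⊕ Fin m) : Prop :=
  OmegaAt M j i = ∅

/-- c2): `Ω_j^i` is nonempty, `i ≠ j`, and for each neighbour `v_l⁺ ≠ v_i⁺` of `v_j⁻` in `B(H_λ)`,
every maximum matching of `B(H_λ^{j_c}) - {v_l⁺}` covers the union of the members of `Ω_j^i`. -/
def CondC2 (M : Matrix (Fin n) (Fin n ⊕ Fin m) Entry) (i : Fin n) (j : Fin n ⊕ Fin m) : Prop :=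
  (OmegaAt M j i).Nonempty ∧ j ≠ Sum.inl i ∧
    ∀ l ∈ (bipPencil M).colNbrs j \ {i}, ∀ N,
      ((bipPencilMinor M j).deleteRow l).IsMaxMatching N →
        BipGraph.Covers N (BipGraph.union (OmegaAt M j i))

end Structured

/-! With a single input, controllability means that a polynomial `f` with rational coefficients in
the indeterminate entries, the determinant of the controllability matrix, does not vanish. Almost
every point `z` has algebraically independent coordinates, and structural controllability says that
`f` is nonzero at such a `z`. A complex polynomial without nonzero roots is a monomial. So if `f`
stays nonzero at `z` while one `×` entry runs through the nonzero numbers, then that variable has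
the same exponent in all monomials of `f`. If this holds for each `×` entry separately, then on
realizations `f` is a monomial in the `×` entries times a polynomial in the `*` entries, which gives
PSSC (`pssc_of_generic`); the converse is `PSSC.exists_generic`. It remains to move one `×` entry
`(i, j)` at a generic point.

By the Popov–Belevitch–Hautus test, a value `t` of this entry destroys controllability if some `μ`
and some `u ≠ 0` satisfy `u [A - μ I, b] = 0`. Only column `j` depends on `t`. Hence `u` annihilates
the other columns at `z` itself, and if `u i ≠ 0`, then some `t` makes `u` annihilate column `j` as
well. The question is whether `t ≠ 0` can be achieved, that is, whether column `j` contains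
something else to balance against. Such questions are settled by counting transcendental parameters
(`card_columns_add_card_le`): each annihilated column with a generic entry in the support of `u`
expresses one independent parameter by the others, so there are at most as many such columns as free
entries of the normalised `u`, plus one if `μ` is not rational.

For `μ = 0` the count turns kernel vectors into violations of Hall's condition, and these are what
b1)-b3) measure (`condB_iff`).

For `μ ≠ 0`, let `σ` be a perfect matching of the graph without column `j`. Identifying matched
vertices gives a digraph on the rows. Its strongly connected components are the Dulmage–Mendelsohn
components (`IsPerfect.mem_dmComponents_iff`), and a component fails to be covered by some maximum
matching after the deletion of row `l` exactly if it reaches `l`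
(`IsPerfect.exists_not_covers_scc_iff`). The components with `γ_nz = 1` are those whose determinant
has a nonzero root `μ` at a generic point (`exists_det_block_eq_zero`,
`det_block_ne_zero_of_not_gammaNZ`). Such a root yields a vector whose support contains all rows
reached from the component (`exists_kills_extension`, `stepClosed_supp`), and conversely the support
of such a vector is reached from a single component with `γ_nz = 1`, because disjoint blocks share
no nonzero eigenvalue (`exists_gammaNZ_reach`). This turns c1)-c2) into the absence of nonzero
uncontrollable eigenvalues (`condC_iff`). -/

set_option linter.unusedSectionVars false

/-! ## Counting transcendental parameters -/

section Counting

open AlgebraicIndependent in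
/-- An algebraically independent family whose members lie in the field generated by `s` has at
most as many members as `s`. -/
theorem AlgebraicIndependent.card_le_of_forall_mem_adjoin {ι : Type*} [Fintype ι] {z : ι → ℂ}
    (hz : AlgebraicIndependent ℚ z) (s : Finset ℂ)
    (h : ∀ i, z i ∈ IntermediateField.adjoin ℚ (s : Set ℂ)) : Fintype.card ι ≤ s.card := by
  -- In the algebraic matroid the family is independent and contained in the closure of `s`, whose
  -- rank is at most `#s`.
  have hI : (matroid ℚ ℂ).Indep (Set.range z) := by
    rw [matroid_indep_iff]
    exact hz.to_subtype_range
  have hsub : Set.range z ⊆ (matroid ℚ ℂ).closure (s : Set ℂ) := by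
    rintro _ ⟨i, rfl⟩
    rw [matroid_closure_eq]
    obtain ⟨a, ha, b, hb, hab⟩ := IntermediateField.mem_adjoin_iff_div.1 (h i)
    rw [SetLike.mem_coe, Subalgebra.mem_algebraicClosure, hab, div_eq_mul_inv]
    have ha' := isAlgebraic_algebraMap (A := ℂ) (⟨a, ha⟩ : Algebra.adjoin ℚ (s : Set ℂ))
    have hb' := isAlgebraic_algebraMap (A := ℂ) (⟨b, hb⟩ : Algebra.adjoin ℚ (s : Set ℂ))
    exact ha'.mul hb'.inv
  have h1 := hI.encard_le_eRk_of_subset hsub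
  rw [Matroid.eRk_closure_eq] at h1
  have h2 := h1.trans ((matroid ℚ ℂ).eRk_le_encard _)
  rw [← Set.image_univ, hz.injective.encard_image, Set.encard_univ, Set.encard_coe_eq_coe_finsetCard,
    ENat.card_eq_coe_fintype_card] at h2
  exact_mod_cast h2

/-- If each column `c ∈ C₀` of a matrix satisfies a linear relation with coefficients `u` in
`ℚ(W)` that involves a generic entry of that column, then there are at most `#W` such columns. -/
theorem card_columns_le {ρ γ : Type*} [Fintype ρ] [Fintype γ] [DecidableEq ρ] [DecidableEq γ]
    {z : ρ × γ → ℂ} (hz : AlgebraicIndependent ℚ z) (W : Finset ℂ) (A : ρ → γ → ℂ) (u : ρ → ℂ)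
    (C₀ : Finset γ) (R : γ → Finset ρ) (p : γ → ρ)
    (hu : ∀ c ∈ C₀, ∀ r ∈ R c, u r ∈ IntermediateField.adjoin ℚ (W : Set ℂ))
    (hA : ∀ c ∈ C₀, ∀ r ∈ R c, A r c ∈ IntermediateField.adjoin ℚ (W : Set ℂ) ∨
      A r c - z (r, c) ∈ IntermediateField.adjoin ℚ (W : Set ℂ))
    (hp : ∀ c ∈ C₀, p c ∈ R c) (hup : ∀ c ∈ C₀, u (p c) ≠ 0)
    (hAp : ∀ c ∈ C₀, A (p c) c - z (p c, c) ∈ IntermediateField.adjoin ℚ (W : Set ℂ))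
    (heq : ∀ c ∈ C₀, ∑ r ∈ R c, u r * A r c = 0) : C₀.card ≤ W.card := by
  classical
  -- `P` contains one position per column of `C₀`. The relation of column `c` can be solved for its
  -- pivot entry, since the other entries of that column involve only parameters outside `P`. Thus
  -- `W` and the parameters outside `P` generate all parameters, and comparing cardinalities gives
  -- `#P ≤ #W`.
  set P : Finset (ρ × γ) := C₀.image fun c => (p c, c) with hP
  have hPcard : P.card = C₀.card :=
    Finset.card_image_of_injective _ fun a b h => (Prod.ext_iff.1 h).2
  set s : Finset ℂ := W ∪ Pᶜ.image z with hs
  have hWs : IntermediateField.adjoin ℚ (W : Set ℂ) ≤ IntermediateField.adjoin ℚ (s : Set ℂ) :=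
    IntermediateField.adjoin.mono _ _ _ (by simp [hs])
  have hnot : ∀ x, x ∉ P → z x ∈ IntermediateField.adjoin ℚ (s : Set ℂ) := by
    intro x hx
    apply IntermediateField.subset_adjoin
    rw [hs, Finset.coe_union]
    right
    exact Finset.mem_image_of_mem z (by simpa using hx)
  have hall : ∀ x, z x ∈ IntermediateField.adjoin ℚ (s : Set ℂ) := by
    intro x
    by_cases hx : x ∈ P
    · obtain ⟨c, hc, rfl⟩ := Finset.mem_image.1 hx
      have h1 := heq c hc
      rw [← Finset.add_sum_erase _ _ (hp c hc)] at h1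
      have h2 : A (p c) c = -(∑ r ∈ (R c).erase (p c), u r * A r c) * (u (p c))⁻¹ := by
        rw [eq_mul_inv_iff_mul_eq₀ (hup c hc)]
        linear_combination h1
      have h3 : A (p c) c ∈ IntermediateField.adjoin ℚ (s : Set ℂ) := by
        rw [h2]
        refine mul_mem (neg_mem (sum_mem fun r hr => ?_)) (inv_mem (hWs (hu c hc _ (hp c hc))))
        obtain ⟨hr1, hr2⟩ := Finset.mem_erase.1 hr
        refine mul_mem (hWs (hu c hc r hr2)) ?_
        rcases hA c hc r hr2 with h | h
        · exact hWs h
        · have : (r, c) ∉ P := by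
            intro hmem
            obtain ⟨c', _, hc'⟩ := Finset.mem_image.1 hmem
            obtain ⟨h1, rfl⟩ := Prod.ext_iff.1 hc'
            exact hr1 h1.symm
          have := add_mem (hWs h) (hnot _ this)
          simpa using this
      have := sub_mem h3 (hWs (hAp c hc))
      simpa using this
    · exact hnot x hx
  have hcard := hz.card_le_of_forall_mem_adjoin s hall
  have h1 : s.card ≤ W.card + Pᶜ.card :=
    (Finset.card_union_le _ _).trans (Nat.add_le_add_left Finset.card_image_le _)
  have h2 := Finset.card_add_card_compl P
  omega

/-- The parameter count for a matrix relation `uᵀ A = 0` on the columns in `C₀` when the entries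
of `u` on the row set `S` are the parameters, those in `Z` being normalised to `1`. -/
theorem card_columns_add_card_le {ρ γ : Type*} [Fintype ρ] [Fintype γ] [DecidableEq ρ]
    [DecidableEq γ] {z : ρ × γ → ℂ} (hz : AlgebraicIndependent ℚ z) (L : Finset ℂ)
    (A : ρ → γ → ℂ) (u : ρ → ℂ) (S Z : Finset ρ) (hZS : Z ⊆ S) (hZ : ∀ r ∈ Z, u r = 1)
    (C₀ : Finset γ) (R : γ → Finset ρ) (hRS : ∀ c ∈ C₀, R c ⊆ S)
    (hA : ∀ c ∈ C₀, ∀ r ∈ R c, A r c ∈ IntermediateField.adjoin ℚ (L : Set ℂ) ∨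
      A r c - z (r, c) ∈ IntermediateField.adjoin ℚ (L : Set ℂ))
    (hp : ∀ c ∈ C₀, ∃ r ∈ R c, u r ≠ 0 ∧
      A r c - z (r, c) ∈ IntermediateField.adjoin ℚ (L : Set ℂ))
    (heq : ∀ c ∈ C₀, ∑ r ∈ R c, u r * A r c = 0) : C₀.card + Z.card ≤ S.card + L.card := by
  classical
  rcases C₀.eq_empty_or_nonempty with rfl | ⟨c₀, hc₀⟩
  · simpa using (Finset.card_le_card hZS).trans (Nat.le_add_right _ _)
  have : Nonempty ρ := ⟨(hp c₀ hc₀).choose⟩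
  choose! p hp using hp
  -- Each entry of `u` on `S` costs one parameter, except those normalised to `1`.
  set W : Finset ℂ := L ∪ (S \ Z).image u with hW
  have hLW : IntermediateField.adjoin ℚ (L : Set ℂ) ≤ IntermediateField.adjoin ℚ (W : Set ℂ) :=
    IntermediateField.adjoin.mono _ _ _ (by simp [hW])
  have hu : ∀ r ∈ S, u r ∈ IntermediateField.adjoin ℚ (W : Set ℂ) := by
    intro r hr
    by_cases hrZ : r ∈ Z
    · rw [hZ r hrZ]
      exact one_mem _
    · apply IntermediateField.subset_adjoin
      rw [hW, Finset.coe_union]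
      right
      exact Finset.mem_image_of_mem u (by simp [hr, hrZ])
  have h := card_columns_le hz W A u C₀ R p (fun c hc r hr => hu r (hRS c hc hr))
    (fun c hc r hr => (hA c hc r hr).imp (fun h => hLW h) fun h => hLW h)
    (fun c hc => (hp c hc).1) (fun c hc => (hp c hc).2.1) (fun c hc => hLW (hp c hc).2.2) heq
  have h1 : W.card ≤ L.card + (S \ Z).card :=
    (Finset.card_union_le _ _).trans (Nat.add_le_add_left Finset.card_image_le _)
  have h2 := Finset.card_sdiff_add_card_eq_card hZS
  omega

end Counting

/-! ## Zero sets of polynomials -/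

section NullSets

/-- Fubini and induction on the number of variables: fixing the first coordinate leaves a nonzero
polynomial in the others except for finitely many values, which are the constant roots of `P` viewed
as a polynomial in its first variable. -/
theorem MvPolynomial.volume_zeros_fin {k : ℕ} (P : MvPolynomial (Fin k) ℂ) (hP : P ≠ 0) :
    volume {x : Fin k → ℂ | MvPolynomial.eval x P = 0} = 0 := by
  induction k with
  | zero =>
    have : {x : Fin 0 → ℂ | MvPolynomial.eval x P = 0} = ∅ := by
      rw [Set.eq_empty_iff_forall_notMem]
      intro x hx
      apply hP
      apply MvPolynomial.funext
      intro y
      rw [Subsingleton.elim y x, map_zero]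
      exact hx
    rw [this, measure_empty]
  | succ k ih =>
    set p := MvPolynomial.finSuccEquiv ℂ k P with hp
    have hp0 : p ≠ 0 := by simpa [hp] using hP
    have hmp := volume_preserving_piFinSuccAbove (fun _ : Fin (k + 1) => ℂ) 0
    have hmeas : MeasurableSet {y : ℂ × (Fin k → ℂ) | MvPolynomial.eval (Fin.cons y.1 y.2) P = 0} := by
      apply IsClosed.measurableSet
      refine isClosed_eq ?_ continuous_const
      refine (MvPolynomial.continuous_eval P).comp ?_
      refine continuous_pi fun i => ?_
      refine Fin.cases ?_ (fun i => ?_) i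
      · simpa using continuous_fst
      · exact (continuous_apply i).comp (continuous_snd (X := ℂ) (Y := Fin k → ℂ))
    have hpre : {x : Fin (k + 1) → ℂ | MvPolynomial.eval x P = 0} =
        MeasurableEquiv.piFinSuccAbove (fun _ : Fin (k + 1) => ℂ) 0 ⁻¹'
          {y : ℂ × (Fin k → ℂ) | MvPolynomial.eval (Fin.cons y.1 y.2) P = 0} := by
      ext x
      simp only [Set.mem_ofPred_eq, Set.mem_preimage]
      have : (Fin.cons ((MeasurableEquiv.piFinSuccAbove (fun _ : Fin (k + 1) => ℂ) 0) x).1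
          ((MeasurableEquiv.piFinSuccAbove (fun _ : Fin (k + 1) => ℂ) 0) x).2 : Fin (k+1) → ℂ) = x :=
        Fin.cons_self_tail x
      rw [this]
    rw [hpre, hmp.measure_preimage hmeas.nullMeasurableSet, Measure.volume_eq_prod,
      Measure.measure_prod_null hmeas]
    have hfin : Set.Finite {y : ℂ | Polynomial.eval (MvPolynomial.C y) p = 0} := by
      have := (p.roots.toFinset.finite_toSet).preimage
        (MvPolynomial.C_injective (Fin k) ℂ).injOn
      refine this.subset fun y hy => ?_
      simpa [hp0] using hy
    have hae : ∀ᵐ y : ℂ, Polynomial.eval (MvPolynomial.C y) p ≠ 0 :=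
      measure_eq_zero_iff_ae_notMem.1 (hfin.measure_zero volume)
    filter_upwards [hae] with y hy
    have := ih _ hy
    refine Eq.trans (congrArg _ ?_) this
    ext s
    simp only [Set.mem_preimage, Set.mem_ofPred_eq]
    have hev : MvPolynomial.eval s (Polynomial.eval (MvPolynomial.C y) p) =
        Polynomial.eval y (p.map (MvPolynomial.eval s)) := by
      rw [Polynomial.eval_map, ← Polynomial.eval₂_at_apply, MvPolynomial.eval_C]
    rw [hev, MvPolynomial.eval_eq_eval_mv_eval', ← hp]

/-- A nonzero polynomial does not vanish almost everywhere. -/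
theorem MvPolynomial.ae_eval_ne_zero {ι : Type*} [Fintype ι] (P : MvPolynomial ι ℂ) (hP : P ≠ 0) :
    ∀ᵐ x : ι → ℂ, MvPolynomial.eval x P ≠ 0 := by
  set e := Fintype.equivFin ι
  have h := volume_measurePreserving_piCongrLeft (fun _ : ι => ℂ) e.symm
  have hinj := MvPolynomial.rename_injective (R := ℂ) e e.injective
  have h1 := MvPolynomial.volume_zeros_fin (MvPolynomial.rename e P)
    (fun h0 => hP (hinj (by rw [h0, map_zero])))
  have hmeas : MeasurableSet {x : ι → ℂ | MvPolynomial.eval x P = 0} :=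
    (isClosed_eq (MvPolynomial.continuous_eval P) continuous_const).measurableSet
  rw [ae_iff]
  simp only [not_not]
  rw [← h.measure_preimage hmeas.nullMeasurableSet, ← h1]
  congr 1
  ext x
  simp only [Set.mem_preimage, Set.mem_ofPred_eq, MvPolynomial.eval_rename]
  have : (MeasurableEquiv.piCongrLeft (fun _ : ι => ℂ) e.symm) x = x ∘ e := by
    funext i
    have := Equiv.piCongrLeft_apply_apply (fun _ : ι => ℂ) e.symm x (e i)
    rwa [Equiv.symm_apply_apply] at this
  rw [this]

/-- There are only countably many rational polynomials, and each nonzero one vanishes on a null set.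
-/
theorem ae_algebraicIndependent (ι : Type*) [Fintype ι] :
    ∀ᵐ z : ι → ℂ, AlgebraicIndependent ℚ z := by
  have : Countable (MvPolynomial ι ℚ) := by
    rw [← Cardinal.mk_le_aleph0_iff]
    refine MvPolynomial.cardinalMk_le_max_lift.trans ?_
    simp
  have h : ∀ᵐ z : ι → ℂ, ∀ P : MvPolynomial ι ℚ, P ≠ 0 → MvPolynomial.aeval z P ≠ 0 := by
    rw [ae_all_iff]
    intro P
    by_cases hP : P = 0
    · simp [hP]
    · have h0 : MvPolynomial.map (algebraMap ℚ ℂ) P ≠ 0 := fun h0 =>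
        hP (MvPolynomial.map_injective _ (algebraMap ℚ ℂ).injective (by rw [h0, map_zero]))
      filter_upwards [MvPolynomial.ae_eval_ne_zero _ h0] with z hz _
      rwa [MvPolynomial.eval_map, ← MvPolynomial.aeval_def] at hz
  filter_upwards [h] with z hz
  rw [algebraicIndependent_iff]
  intro P hP
  by_contra h0
  exact hz P h0 hP

end NullSets

/-! ## Polynomials without zeros in a punctured line -/

section Monomials

/-- A complex polynomial without nonzero roots is a monomial. -/
theorem Polynomial.exists_eq_C_mul_X_pow (f : Polynomial ℂ)
    (h : ∀ t, t ≠ 0 → f.eval t ≠ 0) : ∃ c k, f = Polynomial.C c * Polynomial.X ^ k := by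
  refine ⟨f.leadingCoeff, Multiset.card f.roots, ?_⟩
  conv_lhs => rw [(IsAlgClosed.splits f).eq_prod_roots]
  have : f.roots = Multiset.replicate (Multiset.card f.roots) 0 := by
    rw [Multiset.eq_replicate]
    refine ⟨rfl, fun t ht => ?_⟩
    by_contra h0
    exact h t h0 (Polynomial.isRoot_of_mem_roots ht)
  rw [this]
  simp

/-- If a rational polynomial `f` at a generic point has no zero when the coordinate `i` is moved
in `ℂˣ`, then all monomials of `f` have the same exponent at `i`. -/
theorem MvPolynomial.exponent_eq_of_forall_ne_zero {ι : Type*} [DecidableEq ι]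
    {z : ι → ℂ} (hz : AlgebraicIndependent ℚ z) (f : MvPolynomial ι ℚ) (i : ι)
    (h : ∀ t : ℂ, t ≠ 0 → MvPolynomial.aeval (Function.update z i t) f ≠ 0) :
    ∃ k, ∀ m ∈ f.support, m i = k := by
  set φ : Polynomial ℂ := MvPolynomial.aeval
    (Function.update (fun l => Polynomial.C (z l)) i Polynomial.X) f with hφ
  have hev : ∀ t, φ.eval t = MvPolynomial.aeval (Function.update z i t) f := by
    intro t
    rw [hφ, ← Polynomial.coe_aeval_eq_eval, ← AlgHom.restrictScalars_apply ℚ,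
      MvPolynomial.comp_aeval_apply]
    congr 2
    funext l
    by_cases hl : l = i
    · subst hl
      simp
    · simp [hl]
  obtain ⟨c, k, hck⟩ := φ.exists_eq_C_mul_X_pow fun t ht => by
    rw [hev]
    exact h t ht
  -- At `z`, doubling the coordinate `i` multiplies the monomial `φ` by `2 ^ k`. Algebraic
  -- independence lifts this to an identity of polynomials, and comparing the coefficients of `m`
  -- gives `2 ^ k = 2 ^ (m i)`.
  have hscale : MvPolynomial.aeval (Function.update (MvPolynomial.X (R := ℚ)) i
      (MvPolynomial.C 2 * MvPolynomial.X i)) f = MvPolynomial.C (2 ^ k) * f := by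
    apply hz
    rw [MvPolynomial.comp_aeval_apply, map_mul]
    have h1 : (fun l => (MvPolynomial.aeval z) (Function.update (MvPolynomial.X (R := ℚ)) i
        (MvPolynomial.C 2 * MvPolynomial.X i) l)) = Function.update z i (2 * z i) := by
      funext l
      by_cases hl : l = i
      · subst hl
        simp
      · simp [hl]
    have h2 : MvPolynomial.aeval z f = φ.eval (z i) := by
      rw [hev, Function.update_eq_self]
    rw [h1, ← hev, h2, hck]
    simp
    ring
  refine ⟨k, fun m hm => ?_⟩
  have hcoeff : MvPolynomial.coeff m (MvPolynomial.aeval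
      (Function.update (MvPolynomial.X (R := ℚ)) i (MvPolynomial.C 2 * MvPolynomial.X i)) f) =
      2 ^ (m i) * MvPolynomial.coeff m f := by
    clear hm hscale hck hev hφ φ h
    induction f using MvPolynomial.induction_on' with
    | monomial s a =>
      rw [MvPolynomial.aeval_monomial, MvPolynomial.coeff_monomial]
      have : (s.prod fun l e => Function.update (MvPolynomial.X (R := ℚ)) i
          (MvPolynomial.C 2 * MvPolynomial.X i) l ^ e) =
          MvPolynomial.C (2 ^ s i) * s.prod fun l e => (MvPolynomial.X l : MvPolynomial ι ℚ) ^ e := by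
        have h1 : ∀ l, Function.update (MvPolynomial.X (R := ℚ)) i
            (MvPolynomial.C 2 * MvPolynomial.X i) l =
            (if l = i then MvPolynomial.C 2 else 1) * MvPolynomial.X l := by
          intro l
          by_cases hl : l = i
          · subst hl
            simp
          · simp [hl]
        simp_rw [h1, mul_pow, Finsupp.prod_mul]
        congr 1
        rw [Finsupp.prod, Finset.prod_congr rfl (g := fun l => if l = i then
          MvPolynomial.C (2 ^ s i) else 1) (fun l _ => by split_ifs with hl <;> simp [hl]),
          Finset.prod_ite_eq']
        split_ifs with hl
        · rfl
        · rw [Finsupp.notMem_support_iff.1 hl]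
          simp
      rw [this, ← mul_assoc, mul_comm (algebraMap _ _ _), mul_assoc, ← MvPolynomial.algebraMap_eq,
        MvPolynomial.algebraMap_eq, ← MvPolynomial.monomial_eq, MvPolynomial.coeff_C_mul,
        MvPolynomial.coeff_monomial]
      split_ifs with hs
      · rw [hs]
      · simp
    | add p q hp hq => rw [map_add, MvPolynomial.coeff_add, hp, hq, MvPolynomial.coeff_add, mul_add]
  rw [hscale, MvPolynomial.coeff_C_mul] at hcoeff
  have h3 := mul_right_cancel₀ (MvPolynomial.mem_support_iff.1 hm) hcoeff
  exact (pow_right_injective₀ (by norm_num) (by norm_num) h3).symm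

end Monomials

/-! ## Matchings -/

namespace BipGraph

section Matchings

variable {R C : Type*} {G : BipGraph R C} {M : Finset (R × C)}

theorem IsMatching.injOn_fst (h : G.IsMatching M) : Set.InjOn Prod.fst (M : Set (R × C)) := by
  intro e he f hf hef
  by_contra hne
  exact (h.2 e he f hf hne).1 hef

theorem IsMatching.injOn_snd (h : G.IsMatching M) : Set.InjOn Prod.snd (M : Set (R × C)) := by
  intro e he f hf hef
  by_contra hne
  exact (h.2 e he f hf hne).2 hef

theorem IsMatching.card_le_rows (h : G.IsMatching M) : M.card ≤ G.rows.card :=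
  Finset.card_le_card_of_injOn Prod.fst (fun e he => (G.incident e (h.1 he)).1) h.injOn_fst

theorem IsMatching.exists_of_card_rows_le (h : G.IsMatching M) (hM : G.rows.card ≤ M.card)
    {r : R} (hr : r ∈ G.rows) : ∃ c, (r, c) ∈ M := by
  obtain ⟨e, he, rfl⟩ := Finset.surjOn_of_injOn_of_card_le Prod.fst
    (fun e he => (G.incident e (h.1 he)).1) h.injOn_fst hM hr
  exact ⟨e.2, he⟩

theorem IsMatching.exists_of_card_cols_le (h : G.IsMatching M) (hM : G.cols.card ≤ M.card)
    {c : C} (hc : c ∈ G.cols) : ∃ r, (r, c) ∈ M := by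
  obtain ⟨e, he, rfl⟩ := Finset.surjOn_of_injOn_of_card_le Prod.snd
    (fun e he => (G.incident e (h.1 he)).2) h.injOn_snd hM hc
  exact ⟨e.1, he⟩

theorem card_rows_le_of_forall_exists (h : ∀ r ∈ G.rows, ∃ c, (r, c) ∈ M) :
    G.rows.card ≤ M.card := by
  classical
  refine (Finset.card_le_card (fun r hr => ?_)).trans (Finset.card_image_le (f := Prod.fst))
  obtain ⟨c, hc⟩ := h r hr
  exact Finset.mem_image_of_mem Prod.fst hc

theorem IsMatching.card_le_mt (h : G.IsMatching M) : M.card ≤ G.mt := by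
  classical
  exact Finset.le_sup (f := Finset.card) (by simp [h, h.1])

theorem exists_isMatching_card_eq_mt (G : BipGraph R C) : ∃ M, G.IsMatching M ∧ M.card = G.mt := by
  classical
  obtain ⟨M, hM, h⟩ := Finset.exists_mem_eq_sup (G.edges.powerset.filter G.IsMatching)
    ⟨∅, by simp [IsMatching]⟩ Finset.card
  refine ⟨M, (Finset.mem_filter.1 hM).2, ?_⟩
  rw [mt, h]

theorem isMaxMatching_iff_card {N : Finset (R × C)} (hN : G.IsMatching N)
    (hNc : N.card = G.rows.card) :
    G.IsMaxMatching M ↔ G.IsMatching M ∧ G.rows.card ≤ M.card :=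
  ⟨fun h => ⟨h.1, hNc ▸ h.2 N hN⟩, fun h => ⟨h.1, fun _ hN' => hN'.card_le_rows.trans h.2⟩⟩

variable [DecidableEq R] [DecidableEq C]

/-- The set of edges `(r, σ r)`, `r ∈ S`. -/
def graphOn (σ : R → C) (S : Finset R) : Finset (R × C) := S.image fun r => (r, σ r)

theorem mem_graphOn {σ : R → C} {S : Finset R} {r : R} {c : C} :
    (r, c) ∈ graphOn σ S ↔ r ∈ S ∧ σ r = c := by
  simp [graphOn]

theorem card_graphOn (σ : R → C) (S : Finset R) : (graphOn σ S).card = S.card :=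
  Finset.card_image_of_injective _ fun _ _ h => (Prod.ext_iff.1 h).1

theorem isMatching_graphOn {σ : R → C} {S : Finset R} (hσ : Set.InjOn σ S)
    (h : ∀ r ∈ S, (r, σ r) ∈ G.edges) : G.IsMatching (graphOn σ S) := by
  refine ⟨fun e he => ?_, ?_⟩
  · obtain ⟨r, hr, rfl⟩ := Finset.mem_image.1 he
    exact h r hr
  · intro e he f hf hne
    obtain ⟨r, hr, rfl⟩ := Finset.mem_image.1 he
    obtain ⟨s, hs, rfl⟩ := Finset.mem_image.1 hf
    have hrs : r ≠ s := by
      rintro rfl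
      exact hne rfl
    exact ⟨hrs, fun h => hrs (hσ hr hs h)⟩

/-- Hall's marriage theorem for the rows in `A`. -/
theorem exists_injOn_of_card_le_biUnion [Nonempty C] (A : Finset R) (t : R → Finset C)
    (h : ∀ S ⊆ A, S.card ≤ (S.biUnion t).card) :
    ∃ f : R → C, Set.InjOn f A ∧ ∀ r ∈ A, f r ∈ t r := by
  classical
  obtain ⟨f, hf, hft⟩ := (Finset.all_card_le_biUnion_card_iff_exists_injective
    (fun r : A => t r)).1 fun S => by
      have := h (S.map (Function.Embedding.subtype _)) (by
        intro r hr
        obtain ⟨x, _, rfl⟩ := Finset.mem_map.1 hr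
        exact x.2)
      rw [Finset.card_map] at this
      refine this.trans (Finset.card_le_card ?_)
      intro c hc
      simp only [Finset.mem_biUnion, Finset.mem_map, Function.Embedding.subtype_apply] at hc ⊢
      obtain ⟨_, ⟨x, hx, rfl⟩, hc⟩ := hc
      exact ⟨x, hx, hc⟩
  refine ⟨fun r => if hr : r ∈ A then f ⟨r, hr⟩ else Classical.arbitrary C, ?_, ?_⟩
  · intro r hr s hs hrs
    have hr' : r ∈ A := hr
    have hs' : s ∈ A := hs
    simp only [hr', hs', dite_true] at hrs
    exact congrArg Subtype.val (hf hrs)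
  · intro r hr
    simp only [hr, dite_true]
    exact hft ⟨r, hr⟩

end Matchings

/-! ## Graphs with a perfect matching -/

section Perfect

variable {R C : Type*} [Fintype R] [Fintype C] [DecidableEq R] [DecidableEq C]
  {G : BipGraph R C} {σ τ : R → C}

/-- `σ` is a perfect matching of `G`, whose rows are all elements of `R`. -/
structure IsPerfect (G : BipGraph R C) (σ : R → C) : Prop where
  rows_eq : G.rows = Finset.univ
  injective : Function.Injective σ
  mem : ∀ r, (r, σ r) ∈ G.edges
  surj : ∀ c ∈ G.cols, ∃ r, σ r = c

theorem IsPerfect.cols_eq (h : G.IsPerfect σ) : G.cols = Finset.univ.image σ := by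
  ext c
  simp only [Finset.mem_image, Finset.mem_univ, true_and]
  refine ⟨h.surj c, ?_⟩
  rintro ⟨r, rfl⟩
  exact (G.incident _ (h.mem r)).2

theorem IsPerfect.mem_cols (h : G.IsPerfect σ) (r : R) : σ r ∈ G.cols :=
  (G.incident _ (h.mem r)).2

theorem IsPerfect.of_injective (h : G.IsPerfect σ) (hτ : Function.Injective τ)
    (hmem : ∀ r, (r, τ r) ∈ G.edges) : G.IsPerfect τ := by
  refine ⟨h.rows_eq, hτ, hmem, fun c hc => ?_⟩
  have hsub : Finset.univ.image τ ⊆ G.cols := by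
    intro c hc
    obtain ⟨r, _, rfl⟩ := Finset.mem_image.1 hc
    exact (G.incident _ (hmem r)).2
  have hcard : G.cols.card ≤ (Finset.univ.image τ).card := by
    rw [h.cols_eq, Finset.card_image_of_injective _ h.injective,
      Finset.card_image_of_injective _ hτ]
  rw [← Finset.eq_of_subset_of_card_le hsub hcard] at hc
  obtain ⟨r, _, hr⟩ := Finset.mem_image.1 hc
  exact ⟨r, hr⟩

theorem IsPerfect.isMatching (h : G.IsPerfect σ) : G.IsMatching (graphOn σ Finset.univ) :=
  isMatching_graphOn h.injective.injOn fun r _ => h.mem r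

theorem IsPerfect.isMaxMatching_iff (h : G.IsPerfect σ) {M : Finset (R × C)} :
    G.IsMaxMatching M ↔ G.IsMatching M ∧ G.rows.card ≤ M.card :=
  isMaxMatching_iff_card h.isMatching (by rw [card_graphOn, h.rows_eq])

theorem IsPerfect.isMaxMatching (h : G.IsPerfect σ) : G.IsMaxMatching (graphOn σ Finset.univ) :=
  h.isMaxMatching_iff.2 ⟨h.isMatching, by rw [card_graphOn, h.rows_eq]⟩

/-- A maximum matching is the graph of a perfect matching. -/
theorem IsPerfect.exists_of_isMaxMatching (h : G.IsPerfect σ) {M : Finset (R × C)}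
    (hM : G.IsMaxMatching M) : ∃ τ, G.IsPerfect τ ∧ M = graphOn τ Finset.univ := by
  obtain ⟨h1, h2⟩ := h.isMaxMatching_iff.1 hM
  have hex : ∀ r, ∃ c, (r, c) ∈ M := fun r =>
    h1.exists_of_card_rows_le h2 (by simp [h.rows_eq])
  choose τ hτ using hex
  refine ⟨τ, h.of_injective ?_ fun r => h1.1 (hτ r), ?_⟩
  · intro r s hrs
    exact (Prod.ext_iff.1 (h1.injOn_snd (hτ r) (hτ s) hrs)).1
  · ext ⟨r, c⟩
    rw [mem_graphOn]
    refine ⟨fun hrc => ⟨Finset.mem_univ _, ?_⟩, ?_⟩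
    · exact (Prod.ext_iff.1 (h1.injOn_fst (hτ r) hrc rfl)).2
    · rintro ⟨_, rfl⟩
      exact hτ r

/-- The digraph on the rows obtained by identifying matched vertices. -/
def Step (G : BipGraph R C) (σ : R → C) (r s : R) : Prop := (r, σ s) ∈ G.edges

/-- Reachability in the digraph on the rows obtained by identifying matched vertices. -/
def Reach (G : BipGraph R C) (σ : R → C) : R → R → Prop := Relation.ReflTransGen (G.Step σ)

/-- A set of rows that is closed under `Step`. -/
def StepClosed (G : BipGraph R C) (σ : R → C) (S : Finset R) : Prop :=
  ∀ r ∈ S, ∀ s, G.Step σ r s → s ∈ S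

theorem StepClosed.mem_of_reach {S : Finset R} (hS : G.StepClosed σ S) {r s : R} (hr : r ∈ S)
    (h : G.Reach σ r s) : s ∈ S := by
  induction h with
  | refl => exact hr
  | tail _ h ih => exact hS _ ih _ h

/-- A path that leaves `S` has an edge that leaves `S`. -/
theorem Reach.exists_step {S : Finset R} {r s : R} (h : G.Reach σ r s) (hr : r ∈ S) (hs : s ∉ S) :
    ∃ x ∈ S, ∃ y, y ∉ S ∧ G.Step σ x y := by
  by_contra hcon
  push Not at hcon
  refine hs (StepClosed.mem_of_reach (S := S) (fun x hx y hxy => ?_) hr h)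
  by_contra hy
  exact hcon x hx y hy hxy

/-- If `s` reaches `r`, then the rows other than `r` can be matched without the column `σ s`. -/
theorem IsPerfect.exists_exchange (h : G.IsPerfect σ) {r s : R} (hsr : G.Reach σ s r) :
    ∃ τ : R → C, Set.InjOn τ {r}ᶜ ∧ ∀ x, x ≠ r → (x, τ x) ∈ G.edges ∧ τ x ≠ σ s := by
  have : Nonempty C := ⟨σ r⟩
  obtain ⟨τ, hτ, hτm⟩ := exists_injOn_of_card_le_biUnion (Finset.univ.erase r)
    (fun x => Finset.univ.filter fun c => (x, c) ∈ G.edges ∧ c ≠ σ s) (by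
    intro S hS
    have hrS : r ∉ S := fun hr => by simpa using hS hr
    -- Hall's condition could fail only by the loss of the column `σ s`. If `s ∈ S`, then the path
    -- from `s` to `r ∉ S` leaves `S` along some edge, and this edge supplies a column `σ y` outside
    -- `σ(S)` as a replacement.
    by_cases hsS : s ∈ S
    · obtain ⟨x, hx, y, hy, hxy⟩ := Reach.exists_step hsr hsS hrS
      rw [← Finset.card_image_of_injective S h.injective]
      have h1 : (insert (σ y) ((S.image σ).erase (σ s))) ⊆
          S.biUnion fun x => Finset.univ.filter fun c => (x, c) ∈ G.edges ∧ c ≠ σ s := by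
        intro c hc
        simp only [Finset.mem_insert, Finset.mem_erase, Finset.mem_image, Finset.mem_biUnion,
          Finset.mem_filter, Finset.mem_univ, true_and] at hc ⊢
        rcases hc with rfl | ⟨hc, z, hz, rfl⟩
        · refine ⟨x, hx, hxy, fun hys => hy ?_⟩
          rwa [h.injective hys]
        · exact ⟨z, hz, h.mem z, hc⟩
      refine le_trans ?_ (Finset.card_le_card h1)
      rw [Finset.card_insert_of_notMem, Finset.card_erase_of_mem]
      · omega
      · exact Finset.mem_image_of_mem σ hsS
      · simp only [Finset.mem_erase, Finset.mem_image, not_and, not_exists]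
        rintro _ z hz hzy
        exact hy (h.injective hzy ▸ hz)
    · rw [← Finset.card_image_of_injective S h.injective]
      refine Finset.card_le_card fun c hc => ?_
      obtain ⟨z, hz, rfl⟩ := Finset.mem_image.1 hc
      simp only [Finset.mem_biUnion, Finset.mem_filter, Finset.mem_univ, true_and]
      refine ⟨z, hz, h.mem z, fun hzs => hsS ?_⟩
      rwa [← h.injective hzs])
  refine ⟨τ, ?_, fun x hx => ?_⟩
  · simpa [← Set.compl_eq_univ_sdiff] using hτ
  · simpa using hτm x (by simpa using hx)

/-- An edge on a cycle of the row digraph belongs to a perfect matching. -/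
theorem IsPerfect.exists_isPerfect_apply_eq (h : G.IsPerfect σ) {r s : R} (hsr : G.Reach σ s r)
    (hrs : (r, σ s) ∈ G.edges) : ∃ τ, G.IsPerfect τ ∧ τ r = σ s := by
  obtain ⟨τ, hτ, hτm⟩ := h.exists_exchange hsr
  refine ⟨Function.update τ r (σ s), h.of_injective ?_ fun x => ?_, by simp⟩
  · intro x y hxy
    by_cases hx : x = r <;> by_cases hy : y = r
    · rw [hx, hy]
    · subst hx
      rw [Function.update_self, Function.update_of_ne hy] at hxy
      exact absurd hxy.symm (hτm y hy).2
    · subst hy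
      rw [Function.update_self, Function.update_of_ne hx] at hxy
      exact absurd hxy (hτm x hx).2
    · rw [Function.update_of_ne hx, Function.update_of_ne hy] at hxy
      exact hτ hx hy hxy
  · by_cases hx : x = r
    · subst hx
      simpa using hrs
    · rw [Function.update_of_ne hx]
      exact (hτm x hx).1

/-- Each edge of a perfect matching lies on a cycle of the row digraph. -/
theorem IsPerfect.reach_of_apply_eq (h : G.IsPerfect σ) (hτ : G.IsPerfect τ) {r s : R}
    (hrs : τ r = σ s) : G.Reach σ s r := by
  classical
  have hex : ∀ x, ∃ y, σ y = τ x := fun x => h.surj _ (hτ.mem_cols x)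
  choose f hf using hex
  have hfinj : Function.Injective f := fun x y hxy => hτ.injective (by rw [← hf, ← hf, hxy])
  by_contra hcon
  set U : Finset R := Finset.univ.filter fun x => G.Reach σ s x with hU
  have hrU : r ∉ U := by simpa [hU] using hcon
  -- The map `f = σ⁻¹ ∘ τ` follows steps of the digraph and sends `r` to `s`. If `r` were not in the
  -- set `U` of rows reached from `s`, then `f` would map `U ∪ {r}` injectively into `U`.
  have hmap : (insert r U).image f ⊆ U := by
    intro y hy
    obtain ⟨x, hx, rfl⟩ := Finset.mem_image.1 hy
    rw [hU, Finset.mem_filter]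
    refine ⟨Finset.mem_univ _, ?_⟩
    rcases Finset.mem_insert.1 hx with rfl | hx
    · rw [h.injective ((hf x).trans hrs)]
      exact Relation.ReflTransGen.refl
    · rw [hU, Finset.mem_filter] at hx
      refine hx.2.tail ?_
      rw [Step, hf]
      exact hτ.mem x
  have := Finset.card_le_card hmap
  rw [Finset.card_image_of_injective _ hfinj, Finset.card_insert_of_notMem hrU] at this
  omega

open Classical in
/-- The strongly connected component of the row `r`. -/
noncomputable def sccRows (G : BipGraph R C) (σ : R → C) (r : R) : Finset R :=
  Finset.univ.filter fun s => G.Reach σ r s ∧ G.Reach σ s r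

theorem mem_sccRows {r s : R} : s ∈ G.sccRows σ r ↔ G.Reach σ r s ∧ G.Reach σ s r := by
  simp [sccRows]

theorem self_mem_sccRows (r : R) : r ∈ G.sccRows σ r :=
  mem_sccRows.2 ⟨Relation.ReflTransGen.refl, Relation.ReflTransGen.refl⟩

/-- The subgraph induced by the strongly connected component of the row `r` and the columns
matched with it. -/
noncomputable def scc (G : BipGraph R C) (σ : R → C) (r : R) : BipGraph R C :=
  G.induce (G.sccRows σ r) ((G.sccRows σ r).image σ)

end Perfect

end BipGraph

/-! ## The Dulmage–Mendelsohn components of a graph with a perfect matching -/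

namespace BipGraph

section DulmageMendelsohn

variable {R C : Type*} [Fintype R] [Fintype C] [DecidableEq R] [DecidableEq C]
  {G : BipGraph R C} {σ τ : R → C} {D : Labelling R C}

theorem mem_part_rows {k : Fin (D.d + 2)} {r : R} :
    r ∈ (G.part D k).rows ↔ r ∈ G.rows ∧ D.row r = k := by
  simp only [part, induce, Finset.mem_inter, Finset.mem_filter]
  tauto

theorem mem_part_cols {k : Fin (D.d + 2)} {c : C} :
    c ∈ (G.part D k).cols ↔ c ∈ G.cols ∧ D.col c = k := by
  simp only [part, induce, Finset.mem_inter, Finset.mem_filter]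
  tauto

theorem mem_part_edges {k : Fin (D.d + 2)} {e : R × C} :
    e ∈ (G.part D k).edges ↔ e ∈ G.edges ∧ D.row e.1 = k ∧ D.col e.2 = k := by
  simp only [part, induce, Finset.mem_filter]
  constructor
  · rintro ⟨h, ⟨_, h1⟩, _, h2⟩
    exact ⟨h, h1, h2⟩
  · rintro ⟨h, h1, h2⟩
    exact ⟨h, ⟨(G.incident e h).1, h1⟩, (G.incident e h).2, h2⟩

/-- The column labels of `D` are transported from the row labels by the matching `σ`. -/
def Labelling.Compatible (D : Labelling R C) (σ : R → C) : Prop := ∀ r, D.col (σ r) = D.row r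

theorem IsPerfect.part_cols_eq (h : G.IsPerfect σ) (hD : D.Compatible σ) (k : Fin (D.d + 2)) :
    (G.part D k).cols = (G.part D k).rows.image σ := by
  ext c
  simp only [mem_part_cols, Finset.mem_image, mem_part_rows, h.rows_eq, Finset.mem_univ, true_and]
  constructor
  · rintro ⟨hc, hk⟩
    obtain ⟨r, rfl⟩ := h.surj c hc
    exact ⟨r, by rw [← hD r, hk], rfl⟩
  · rintro ⟨r, hk, rfl⟩
    exact ⟨h.mem_cols r, by rw [hD r, hk]⟩

theorem IsPerfect.part_cols_card (h : G.IsPerfect σ) (hD : D.Compatible σ) (k : Fin (D.d + 2)) :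
    (G.part D k).cols.card = (G.part D k).rows.card := by
  rw [h.part_cols_eq hD, Finset.card_image_of_injective _ h.injective]

theorem IsPerfect.isMatching_part (h : G.IsPerfect σ) (hD : D.Compatible σ) (k : Fin (D.d + 2)) :
    (G.part D k).IsMatching (graphOn σ (G.part D k).rows) :=
  isMatching_graphOn h.injective.injOn fun r hr =>
    mem_part_edges.2 ⟨h.mem r, (mem_part_rows.1 hr).2, by rw [hD, (mem_part_rows.1 hr).2]⟩

theorem IsPerfect.part_isMaxMatching_iff (h : G.IsPerfect σ) (hD : D.Compatible σ)
    (k : Fin (D.d + 2)) {M : Finset (R × C)} : (G.part D k).IsMaxMatching M ↔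
      (G.part D k).IsMatching M ∧ (G.part D k).rows.card ≤ M.card :=
  isMaxMatching_iff_card (h.isMatching_part hD k) (card_graphOn _ _)

theorem IsPerfect.part_mt (h : G.IsPerfect σ) (hD : D.Compatible σ) (k : Fin (D.d + 2)) :
    (G.part D k).mt = (G.part D k).rows.card := by
  apply le_antisymm
  · obtain ⟨M, hM, hc⟩ := (G.part D k).exists_isMatching_card_eq_mt
    rw [← hc]
    exact hM.card_le_rows
  · rw [← card_graphOn σ (G.part D k).rows]
    exact (h.isMatching_part hD k).card_le_mt

/-- A perfect matching is a maximum matching, and maximum matchings split along the classes of a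
block decomposition. -/
theorem IsBlockDecomposition.compatible (hD : G.IsBlockDecomposition D) (h : G.IsPerfect σ) :
    D.Compatible σ := by
  intro r
  obtain ⟨k, hk⟩ := ((hD.maxMatching_iff _ h.isMatching.1).1 h.isMaxMatching).1 (r, σ r)
    (mem_graphOn.2 ⟨Finset.mem_univ _, rfl⟩)
  obtain ⟨_, h1, h2⟩ := mem_part_edges.1 hk
  exact h2.trans h1.symm

theorem IsBlockDecomposition.row_le_of_reach (hD : G.IsBlockDecomposition D) (h : G.IsPerfect σ)
    {r s : R} (hrs : G.Reach σ r s) : D.row r ≤ D.row s := by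
  induction hrs with
  | refl => exact le_rfl
  | tail _ hst ih =>
    have := hD.triangular _ hst
    rw [hD.compatible h] at this
    exact ih.trans this

/-- Under a perfect matching each class has as many columns as rows, which contradicts the strict
inequality required of a tail. -/
theorem IsBlockDecomposition.row_ne_zero (hD : G.IsBlockDecomposition D) (h : G.IsPerfect σ)
    (r : R) : D.row r ≠ 0 := by
  intro hr
  have := (hD.horizontal ⟨r, mem_part_rows.2 ⟨by simp [h.rows_eq], hr⟩⟩).2
  rw [h.part_cols_card (hD.compatible h)] at this
  exact lt_irrefl _ this

theorem IsBlockDecomposition.row_ne_last (hD : G.IsBlockDecomposition D) (h : G.IsPerfect σ)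
    (r : R) : D.row r ≠ Fin.last _ := by
  intro hr
  have := (hD.vertical ⟨σ r, mem_part_cols.2 ⟨h.mem_cols r, by rw [hD.compatible h, hr]⟩⟩).2
  rw [h.part_cols_card (hD.compatible h)] at this
  exact lt_irrefl _ this

/-- Reachability as a preorder on the rows. -/
@[reducible]
def reachPreorder (G : BipGraph R C) (σ : R → C) : Preorder R where
  le := G.Reach σ
  le_refl _ := Relation.ReflTransGen.refl
  le_trans _ _ _ := Relation.ReflTransGen.trans

/-- The strongly connected components of the row digraph can be numbered in topological order. -/
theorem exists_topological_numbering (G : BipGraph R C) (σ : R → C) :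
    ∃ (d : ℕ) (f : R → Fin d), Function.Surjective f ∧
      (∀ r s, G.Reach σ r s → f r ≤ f s) ∧
      ∀ r s, f r = f s ↔ G.Reach σ r s ∧ G.Reach σ s r := by
  classical
  let _ := G.reachPreorder σ
  -- The quotient by mutual reachability is a finite partial order. A linear extension of it is
  -- isomorphic to some `Fin d`, which provides the numbering.
  let Q := Antisymmetrization R (· ≤ ·)
  have : Finite (LinearExtension Q) := inferInstanceAs (Finite (Quotient _))
  have := Fintype.ofFinite (LinearExtension Q)
  let e := (Fintype.orderIsoFinOfCardEq (LinearExtension Q) rfl).symm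
  let q : R → Q := toAntisymmetrization (· ≤ ·)
  refine ⟨_, fun r => e (toLinearExtension (q r)), ?_, ?_, ?_⟩
  · intro k
    obtain ⟨x, rfl⟩ := e.surjective k
    obtain ⟨r, hr⟩ := Quotient.exists_rep (show Q from x)
    exact ⟨r, congrArg e hr⟩
  · intro r s hrs
    exact e.monotone (toLinearExtension.monotone (toAntisymmetrization_le_toAntisymmetrization_iff.2 hrs))
  · intro r s
    rw [e.injective.eq_iff]
    have h1 : toLinearExtension (q r) = toLinearExtension (q s) ↔ q r = q s := Iff.rfl
    rw [h1]
    constructor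
    · intro h
      exact Quotient.exact h
    · intro h
      exact Quotient.sound h

/-- The labelling by strongly connected components. -/
noncomputable def sccLabelling (σ : R → C) {d : ℕ} (f : R → Fin d) : Labelling R C where
  d := d
  row r := (f r).succ.castSucc
  col := Function.extend σ (fun r => (f r).succ.castSucc) fun _ => 0

theorem sccLabelling_compatible (hσ : Function.Injective σ) {d : ℕ} (f : R → Fin d) :
    (sccLabelling σ f).Compatible σ := fun r =>
  hσ.extend_apply (fun r => (f r).succ.castSucc) (fun _ => 0) r

theorem val_sccLabelling_row {d : ℕ} (f : R → Fin d) (r : R) :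
    ((sccLabelling σ f).row r : ℕ) = f r + 1 := rfl

/-- Every edge of a perfect matching lies on a cycle of the row digraph, hence within one strongly
connected component, so maximum matchings split along the components. Conversely, an edge within a
component lies on a cycle and therefore belongs to a perfect matching, which gives admissibility.
Triangularity is the topological order. -/
theorem IsPerfect.isBlockDecomposition (h : G.IsPerfect σ) (hD : D.Compatible σ)
    (h0 : ∀ r, D.row r ≠ 0) (hl : ∀ r, D.row r ≠ Fin.last _)
    (hsurj : ∀ k, k ≠ 0 → k ≠ Fin.last _ → ∃ r, D.row r = k)
    (hle : ∀ r s, G.Reach σ r s → D.row r ≤ D.row s)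
    (heq : ∀ r s, D.row r = D.row s ↔ G.Reach σ r s ∧ G.Reach σ s r) :
    G.IsBlockDecomposition D := by
  have hmax : ∀ M, M ⊆ G.edges → (G.IsMaxMatching M ↔
      (∀ e ∈ M, ∃ k, e ∈ (G.part D k).edges) ∧
        ∀ k, (G.part D k).IsMaxMatching (M ∩ (G.part D k).edges)) := by
    intro M hM
    constructor
    · intro hMmax
      obtain ⟨τ, hτ, rfl⟩ := h.exists_of_isMaxMatching hMmax
      have hcomp : ∀ r, (r, τ r) ∈ (G.part D (D.row r)).edges := by
        intro r
        refine mem_part_edges.2 ⟨hτ.mem r, rfl, ?_⟩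
        obtain ⟨s, hs⟩ := h.surj _ (hτ.mem_cols r)
        rw [← hs, hD, heq]
        refine ⟨h.reach_of_apply_eq hτ hs.symm, Relation.ReflTransGen.single ?_⟩
        rw [Step, hs]
        exact hτ.mem r
      refine ⟨?_, fun k => ?_⟩
      · rintro ⟨r, c⟩ he
        obtain ⟨_, rfl⟩ := mem_graphOn.1 he
        exact ⟨_, hcomp r⟩
      · rw [h.part_isMaxMatching_iff hD]
        refine ⟨⟨Finset.inter_subset_right, fun e he e' he' => ?_⟩, ?_⟩
        · exact hτ.isMatching.2 e (Finset.mem_inter.1 he).1 e' (Finset.mem_inter.1 he').1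
        · refine card_rows_le_of_forall_exists fun r hr => ⟨τ r, ?_⟩
          rw [Finset.mem_inter, mem_graphOn, ← (mem_part_rows.1 hr).2]
          exact ⟨⟨Finset.mem_univ _, rfl⟩, hcomp r⟩
    · rintro ⟨h1, h2⟩
      rw [h.isMaxMatching_iff]
      refine ⟨⟨hM, fun e he e' he' hne => ?_⟩, ?_⟩
      · obtain ⟨k, hk⟩ := h1 e he
        obtain ⟨k', hk'⟩ := h1 e' he'
        by_cases hkk : k = k'
        · subst hkk
          exact (h2 k).1.2 e (Finset.mem_inter.2 ⟨he, hk⟩) e' (Finset.mem_inter.2 ⟨he', hk'⟩) hne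
        · obtain ⟨_, a, b⟩ := mem_part_edges.1 hk
          obtain ⟨_, a', b'⟩ := mem_part_edges.1 hk'
          exact ⟨fun h => hkk (by rw [← a, ← a', h]), fun h => hkk (by rw [← b, ← b', h])⟩
      · refine card_rows_le_of_forall_exists fun r hr => ?_
        have h3 := (h.part_isMaxMatching_iff hD (D.row r)).1 (h2 (D.row r))
        obtain ⟨c, hc⟩ := h3.1.exists_of_card_rows_le h3.2 (mem_part_rows.2 ⟨hr, rfl⟩)
        exact ⟨c, (Finset.mem_inter.1 hc).1⟩
  refine ⟨?_, ?_, ?_, ?_, ?_, hmax⟩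
  · intro k hk0 hkl
    refine ⟨?_, h.part_mt hD k, (h.part_cols_card hD k).symm⟩
    obtain ⟨r, hr⟩ := hsurj k hk0 hkl
    exact ⟨r, mem_part_rows.2 ⟨by simp [h.rows_eq], hr⟩⟩
  · rintro ⟨r, hr⟩
    exact absurd (mem_part_rows.1 hr).2 (h0 r)
  · rintro ⟨c, hc⟩
    obtain ⟨hc, hcl⟩ := mem_part_cols.1 hc
    obtain ⟨r, rfl⟩ := h.surj c hc
    exact absurd ((hD r).symm.trans hcl) (hl r)
  · rintro k ⟨r, c⟩ he
    obtain ⟨hrc, hr, hc⟩ := mem_part_edges.1 he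
    obtain ⟨s, rfl⟩ := h.surj c (G.incident _ hrc).2
    have hsr : G.Reach σ s r := ((heq r s).1 (by
      rw [← hD s]
      exact hr.trans hc.symm)).2
    obtain ⟨τ, hτ, hτr⟩ := h.exists_isPerfect_apply_eq hsr hrc
    refine ⟨_, ((hmax _ hτ.isMatching.1).1 hτ.isMaxMatching).2 k, ?_⟩
    rw [Finset.mem_inter, mem_graphOn]
    exact ⟨⟨Finset.mem_univ _, hτr⟩, he⟩
  · rintro ⟨r, c⟩ he
    obtain ⟨s, rfl⟩ := h.surj c (G.incident _ he).2
    change D.row r ≤ D.col (σ s)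
    rw [hD]
    exact hle r s (Relation.ReflTransGen.single he)

/-- The labels are shifted by one, so that they run through `1, …, d` and both tails are empty. -/
theorem IsPerfect.isBlockDecomposition_sccLabelling (h : G.IsPerfect σ) {d : ℕ} {f : R → Fin d}
    (hf : Function.Surjective f) (hle : ∀ r s, G.Reach σ r s → f r ≤ f s)
    (heq : ∀ r s, f r = f s ↔ G.Reach σ r s ∧ G.Reach σ s r) :
    G.IsBlockDecomposition (sccLabelling σ f) := by
  refine h.isBlockDecomposition (sccLabelling_compatible h.injective f) ?_ ?_ ?_ ?_ ?_
  · intro r hr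
    have := congrArg Fin.val hr
    rw [val_sccLabelling_row] at this
    exact Nat.succ_ne_zero _ this
  · intro r hr
    have := congrArg Fin.val hr
    rw [val_sccLabelling_row, Fin.val_last] at this
    exact (f r).2.ne (Nat.succ_injective this)
  · intro k hk0 hkl
    have hk1 : (k : ℕ) ≠ 0 := fun h => hk0 (Fin.ext h)
    have hk2 : (k : ℕ) ≠ d + 1 := fun h => hkl (Fin.ext h)
    have hk3 : (k : ℕ) < d + 2 := k.2
    obtain ⟨r, hr⟩ := hf ⟨k - 1, by omega⟩
    refine ⟨r, Fin.ext ?_⟩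
    rw [val_sccLabelling_row, hr]
    simp only
    omega
  · intro r s hrs
    exact Nat.succ_le_succ (hle r s hrs)
  · intro r s
    rw [← heq, Fin.ext_iff, Fin.ext_iff, val_sccLabelling_row, val_sccLabelling_row]
    omega

theorem IsPerfect.part_eq_scc (h : G.IsPerfect σ) (hD : D.Compatible σ)
    (heq : ∀ r s, D.row r = D.row s ↔ G.Reach σ r s ∧ G.Reach σ s r) (r : R) :
    G.part D (D.row r) = G.scc σ r := by
  have h1 : G.rows.filter (fun s => D.row s = D.row r) = G.sccRows σ r := by
    ext s
    rw [mem_sccRows, Finset.mem_filter, h.rows_eq, heq]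
    simp [and_comm]
  have h2 : G.cols.filter (fun c => D.col c = D.row r) = (G.sccRows σ r).image σ := by
    rw [← h1]
    ext c
    simp only [Finset.mem_filter, Finset.mem_image, h.rows_eq, Finset.mem_univ, true_and]
    constructor
    · rintro ⟨hc, hk⟩
      obtain ⟨s, rfl⟩ := h.surj c hc
      exact ⟨s, by rw [← hD s, hk], rfl⟩
    · rintro ⟨s, hk, rfl⟩
      exact ⟨h.mem_cols s, by rw [hD s, hk]⟩
  rw [part, scc, h1, h2]

/-- The number of components of a block decomposition is at most the number of strongly connected
components, with equality only if the components are the strongly connected ones. -/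
theorem IsBlockDecomposition.d_le (hD : G.IsBlockDecomposition D) (h : G.IsPerfect σ) {d : ℕ}
    {f : R → Fin d} (hf : Function.Surjective f)
    (heq : ∀ r s, f r = f s ↔ G.Reach σ r s ∧ G.Reach σ s r) :
    D.d ≤ d ∧ (d ≤ D.d → ∀ r s, D.row r = D.row s ↔ f r = f s) := by
  have hfac : ∀ r s, f r = f s → D.row r = D.row s := fun r s hrs =>
    le_antisymm (hD.row_le_of_reach h ((heq r s).1 hrs).1)
      (hD.row_le_of_reach h ((heq r s).1 hrs).2)
  -- Labels are monotone along reachability, hence constant on strongly connected components, so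
  -- each nonempty class is a union of components. Choosing one component in each class is
  -- injective, and if the numbers agree then each class is exactly one component.
  have hex : ∀ k : Fin D.d, ∃ i : Fin d, ∀ r, f r = i → D.row r = k.succ.castSucc := by
    intro k
    obtain ⟨r, hr⟩ := (hD.square k.succ.castSucc (by
      rw [← Fin.castSucc_zero, (Fin.castSucc_injective _).ne_iff]
      exact Fin.succ_ne_zero _) (Fin.castSucc_ne_last _)).1
    exact ⟨f r, fun s hs => (hfac s r hs).trans (mem_part_rows.1 hr).2⟩
  choose g hg using hex
  have hginj : Function.Injective g := by
    intro k l hkl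
    obtain ⟨r, hr⟩ := hf (g k)
    have := (hg k r hr).symm.trans (hg l r (hr.trans hkl))
    rwa [(Fin.castSucc_injective _).eq_iff, (Fin.succ_injective _).eq_iff] at this
  refine ⟨by simpa using Fintype.card_le_of_injective g hginj, fun hd r s => ⟨fun hrs => ?_, hfac r s⟩⟩
  have hgsurj : Function.Surjective g :=
    ((Fintype.bijective_iff_injective_and_card g).2
      ⟨hginj, by simpa using le_antisymm (by simpa using Fintype.card_le_of_injective g hginj) hd⟩).2
  obtain ⟨k, hk⟩ := hgsurj (f r)
  obtain ⟨l, hl⟩ := hgsurj (f s)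
  have h1 := hg k r hk.symm
  have h2 := hg l s hl.symm
  rw [h1, h2, (Fin.castSucc_injective _).eq_iff, (Fin.succ_injective _).eq_iff] at hrs
  rw [← hk, ← hl, hrs]

/-- The DM-components of a graph with a perfect matching are its strongly connected components. -/
theorem IsPerfect.mem_dmComponents_iff (h : G.IsPerfect σ) {K : BipGraph R C} :
    K ∈ G.dmComponents ↔ ∃ r, K = G.scc σ r := by
  obtain ⟨d, f, hf, hle, heq⟩ := G.exists_topological_numbering σ
  have hD₀ := h.isBlockDecomposition_sccLabelling hf hle heq
  constructor
  · rintro ⟨D, ⟨hD, hmax⟩, k, hk0, hkl, rfl⟩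
    obtain ⟨r, hr⟩ := (hD.square k hk0 hkl).1
    obtain ⟨_, rfl⟩ := mem_part_rows.1 hr
    exact ⟨r, h.part_eq_scc (hD.compatible h) (fun r s =>
      ((hD.d_le h hf heq).2 (hmax _ hD₀) r s).trans (heq r s)) r⟩
  · rintro ⟨r, rfl⟩
    refine ⟨sccLabelling σ f, ⟨hD₀, fun D' hD' => (hD'.d_le h hf heq).1⟩,
      (sccLabelling σ f).row r, hD₀.row_ne_zero h r, hD₀.row_ne_last h r, ?_⟩
    refine (h.part_eq_scc (hD₀.compatible h) (fun r s => ?_) r).symm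
    exact ((hD₀.d_le h hf heq).2 le_rfl r s).trans (heq r s)

end DulmageMendelsohn

end BipGraph

/-! ## Coverings by maximum matchings after the deletion of a row -/

namespace BipGraph

section Covers

variable {R C : Type*} [Fintype R] [Fintype C] [DecidableEq R] [DecidableEq C]
  {G H : BipGraph R C} {σ τ : R → C} {N : Finset (R × C)}

theorem mem_deleteRow_edges {l : R} {e : R × C} :
    e ∈ (G.deleteRow l).edges ↔ e ∈ G.edges ∧ e.1 ≠ l := by
  simp only [deleteRow, induce, Finset.mem_filter, Finset.mem_erase]
  constructor
  · rintro ⟨h, ⟨h1, _⟩, _⟩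
    exact ⟨h, h1⟩
  · rintro ⟨h, h1⟩
    exact ⟨h, ⟨h1, (G.incident e h).1⟩, (G.incident e h).2⟩

theorem mem_deleteCol_edges {j : C} {e : R × C} :
    e ∈ (G.deleteCol j).edges ↔ e ∈ G.edges ∧ e.2 ≠ j := by
  simp only [deleteCol, induce, Finset.mem_filter, Finset.mem_erase]
  constructor
  · rintro ⟨h, _, h1, _⟩
    exact ⟨h, h1⟩
  · rintro ⟨h, h1⟩
    exact ⟨h, (G.incident e h).1, h1, (G.incident e h).2⟩

theorem deleteRow_rows (h : G.rows = Finset.univ) (l : R) :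
    (G.deleteRow l).rows = Finset.univ.erase l := by
  simp [deleteRow, induce, h]

theorem IsPerfect.deleteRow_isMaxMatching_iff (h : G.IsPerfect σ) {l : R} :
    (G.deleteRow l).IsMaxMatching N ↔
      (G.deleteRow l).IsMatching N ∧ (G.deleteRow l).rows.card ≤ N.card :=
  isMaxMatching_iff_card (N := graphOn σ (G.deleteRow l).rows)
    (isMatching_graphOn h.injective.injOn fun r hr => by
      rw [deleteRow_rows h.rows_eq] at hr
      exact mem_deleteRow_edges.2 ⟨h.mem r, Finset.ne_of_mem_erase hr⟩) (card_graphOn _ _)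

/-- `H` is perfectly matched by the restriction of `σ`. -/
structure MatchedBy (H : BipGraph R C) (σ : R → C) : Prop where
  mem : ∀ r ∈ H.rows, (r, σ r) ∈ H.edges
  cols_eq : H.cols = H.rows.image σ

/-- Since `H` has a perfect matching, its maximum matchings are those that saturate its rows. -/
theorem MatchedBy.covers_iff (hH : H.MatchedBy σ) (hσ : Function.Injective σ)
    (hN : G.IsMatching N) :
    Covers N H ↔ ∀ r ∈ H.rows, ∃ c, (r, c) ∈ N ∧ (r, c) ∈ H.edges := by
  have hNH : H.IsMatching (N ∩ H.edges) := ⟨Finset.inter_subset_right, fun e he f hf =>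
    hN.2 e (Finset.mem_inter.1 he).1 f (Finset.mem_inter.1 hf).1⟩
  rw [Covers, isMaxMatching_iff_card (isMatching_graphOn hσ.injOn hH.mem) (card_graphOn _ _)]
  constructor
  · rintro ⟨_, h⟩ r hr
    obtain ⟨c, hc⟩ := hNH.exists_of_card_rows_le h hr
    exact ⟨c, Finset.mem_inter.1 hc⟩
  · intro h
    refine ⟨hNH, card_rows_le_of_forall_exists fun r hr => ?_⟩
    obtain ⟨c, hc⟩ := h r hr
    exact ⟨c, Finset.mem_inter.2 hc⟩

theorem MatchedBy.exists_of_covers (hH : H.MatchedBy σ) (hσ : Function.Injective σ)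
    (h : Covers N H) {c : C} (hc : c ∈ H.cols) : ∃ r, (r, c) ∈ N := by
  have h1 := (isMaxMatching_iff_card (isMatching_graphOn hσ.injOn hH.mem) (card_graphOn _ _)).1 h
  obtain ⟨r, hr⟩ := h1.1.exists_of_card_cols_le (by
    rw [hH.cols_eq, Finset.card_image_of_injective _ hσ]
    exact h1.2) hc
  exact ⟨r, (Finset.mem_inter.1 hr).1⟩

theorem IsPerfect.scc_rows (h : G.IsPerfect σ) (r : R) : (G.scc σ r).rows = G.sccRows σ r := by
  simp [scc, induce, h.rows_eq]

theorem mem_scc_edges {r : R} {e : R × C} : e ∈ (G.scc σ r).edges ↔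
    e ∈ G.edges ∧ e.1 ∈ G.sccRows σ r ∧ e.2 ∈ (G.sccRows σ r).image σ := by
  simp [scc, induce]

theorem IsPerfect.scc_matchedBy (h : G.IsPerfect σ) (r : R) : (G.scc σ r).MatchedBy σ := by
  refine ⟨fun s hs => ?_, ?_⟩
  · rw [h.scc_rows] at hs
    exact mem_scc_edges.2 ⟨h.mem s, hs, Finset.mem_image_of_mem σ hs⟩
  · rw [h.scc_rows]
    simp only [scc, induce, h.cols_eq]
    exact Finset.inter_eq_right.2 (Finset.image_subset_image (Finset.subset_univ _))

theorem IsPerfect.union_matchedBy (h : G.IsPerfect σ) {𝒦 : Set (BipGraph R C)}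
    (h𝒦 : ∀ K ∈ 𝒦, ∃ r, K = G.scc σ r) : (union 𝒦).MatchedBy σ := by
  have hK : ∀ K ∈ 𝒦, K.MatchedBy σ := by
    intro K hK
    obtain ⟨r, rfl⟩ := h𝒦 K hK
    exact h.scc_matchedBy r
  refine ⟨fun s hs => ?_, ?_⟩
  · simp only [union, Finset.mem_filter, Finset.mem_univ, true_and] at hs ⊢
    obtain ⟨K, hK1, hs⟩ := hs
    exact ⟨K, hK1, (hK K hK1).mem s hs⟩
  · ext c
    simp only [union, Finset.mem_filter, Finset.mem_univ, true_and, Finset.mem_image]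
    constructor
    · rintro ⟨K, hK1, hc⟩
      rw [(hK K hK1).cols_eq] at hc
      obtain ⟨s, hs, rfl⟩ := Finset.mem_image.1 hc
      exact ⟨s, ⟨K, hK1, hs⟩, rfl⟩
    · rintro ⟨s, ⟨K, hK1, hs⟩, rfl⟩
      exact ⟨K, hK1, (K.incident _ ((hK K hK1).mem s hs)).2⟩

/-- If `r` reaches `l`, then some maximum matching of `G - l` avoids the column `σ r`. -/
theorem IsPerfect.exists_isMaxMatching_deleteRow (h : G.IsPerfect σ) {r l : R}
    (hr : G.Reach σ r l) : ∃ N, (G.deleteRow l).IsMaxMatching N ∧ ∀ x, (x, σ r) ∉ N := by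
  obtain ⟨τ, hτ, hτm⟩ := h.exists_exchange hr
  have hrows := deleteRow_rows h.rows_eq l
  refine ⟨graphOn τ (G.deleteRow l).rows, ?_, ?_⟩
  · rw [h.deleteRow_isMaxMatching_iff]
    refine ⟨isMatching_graphOn (fun x hx y hy => ?_) fun x hx => ?_, (card_graphOn _ _).ge⟩
    · rw [hrows] at hx hy
      exact hτ (by simpa using hx) (by simpa using hy)
    · rw [hrows] at hx
      have hx' := Finset.ne_of_mem_erase hx
      exact mem_deleteRow_edges.2 ⟨(hτm x hx').1, hx'⟩
  · intro x hx
    obtain ⟨hx1, hx2⟩ := mem_graphOn.1 hx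
    rw [hrows] at hx1
    exact (hτm x (Finset.ne_of_mem_erase hx1)).2 hx2

/-- If `r` does not reach `l`, then the maximum matchings of `G - l` match the rows of the
component of `r` within this component. -/
theorem IsPerfect.exists_mem_scc_edges (h : G.IsPerfect σ) {r l : R} (hr : ¬ G.Reach σ r l)
    (hN : (G.deleteRow l).IsMaxMatching N) {x : R} (hx : x ∈ (G.scc σ r).rows) :
    ∃ c, (x, c) ∈ N ∧ (x, c) ∈ (G.scc σ r).edges := by
  classical
  obtain ⟨hN1, hN2⟩ := h.deleteRow_isMaxMatching_iff.1 hN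
  have hex : ∀ y, ¬ G.Reach σ y l → ∃ c, (y, c) ∈ N := by
    intro y hy
    apply hN1.exists_of_card_rows_le hN2
    rw [deleteRow_rows h.rows_eq, Finset.mem_erase]
    refine ⟨?_, Finset.mem_univ _⟩
    rintro rfl
    exact hy Relation.ReflTransGen.refl
  choose f hf using hex
  have hfedge : ∀ y hy, (y, f y hy) ∈ G.edges := fun y hy =>
    (mem_deleteRow_edges.1 (hN1.1 (hf y hy))).1
  have hfσ : ∀ y hy s, f y hy = σ s → ¬ G.Reach σ s l := by
    intro y hy s hs hsl
    refine hy (Relation.ReflTransGen.head ?_ hsl)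
    rw [Step, ← hs]
    exact hfedge y hy
  -- The matching `N` is kept on the rows that do not reach `l` and replaced by `σ` on those that
  -- do. No column is used twice, because a row that does not reach `l` is adjacent only to columns
  -- of rows that do not reach `l`. The result is a perfect matching of `G`, and the edges of
  -- perfect matchings stay within components.
  set τ : R → C := fun y => if hy : G.Reach σ y l then σ y else f y hy with hτdef
  have hτ : G.IsPerfect τ := by
    refine h.of_injective ?_ ?_
    · intro y y' hyy
      by_cases hy : G.Reach σ y l <;> by_cases hy' : G.Reach σ y' l <;>
        simp only [hτdef, hy, hy', dite_true, dite_false] at hyy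
      · exact h.injective hyy
      · exact absurd hy (hfσ _ _ _ hyy.symm)
      · exact absurd hy' (hfσ _ _ _ hyy)
      · exact (Prod.ext_iff.1 (hN1.injOn_snd (hf y hy) (hf y' hy') hyy)).1
    · intro y
      by_cases hy : G.Reach σ y l
      · simp only [hτdef, hy, dite_true]
        exact h.mem y
      · simp only [hτdef, hy, dite_false]
        exact hfedge y hy
  rw [h.scc_rows, mem_sccRows] at hx
  have hxl : ¬ G.Reach σ x l := fun hxl => hr (hx.1.trans hxl)
  have hτx : τ x = f x hxl := by simp only [hτdef, hxl, dite_false]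
  refine ⟨τ x, hτx ▸ hf x hxl, ?_⟩
  obtain ⟨s, hs⟩ := h.surj _ (hτ.mem_cols x)
  have hsx : G.Reach σ s x := h.reach_of_apply_eq hτ hs.symm
  have hxs : G.Reach σ x s := Relation.ReflTransGen.single (by
    rw [Step, hs]
    exact hτ.mem x)
  refine mem_scc_edges.2 ⟨hτ.mem x, mem_sccRows.2 hx, Finset.mem_image.2 ⟨s, ?_, hs⟩⟩
  exact mem_sccRows.2 ⟨hx.1.trans hxs, hsx.trans hx.2⟩

/-- If `r` reaches `l`, an exchange along the path frees the column `σ r` of the component.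
Otherwise the deletion of `l` does not affect how the component is matched. -/
theorem IsPerfect.exists_not_covers_scc_iff (h : G.IsPerfect σ) {r l : R} :
    (∃ N, (G.deleteRow l).IsMaxMatching N ∧ ¬ Covers N (G.scc σ r)) ↔ G.Reach σ r l := by
  constructor
  · rintro ⟨N, hN, hcov⟩
    by_contra hr
    exact hcov (((h.scc_matchedBy r).covers_iff h.injective hN.1).2 fun x hx =>
      h.exists_mem_scc_edges hr hN hx)
  · intro hr
    obtain ⟨N, hN, hNr⟩ := h.exists_isMaxMatching_deleteRow hr
    refine ⟨N, hN, fun hcov => ?_⟩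
    obtain ⟨x, hx⟩ := (h.scc_matchedBy r).exists_of_covers h.injective hcov (c := σ r) (by
      rw [(h.scc_matchedBy r).cols_eq, h.scc_rows]
      exact Finset.mem_image_of_mem σ (self_mem_sccRows r))
    exact hNr x hx

/-- The union is again perfectly matched by `σ`, so covering it can be tested row by row in its
components. -/
theorem IsPerfect.forall_covers_union_iff (h : G.IsPerfect σ) {𝒦 : Set (BipGraph R C)}
    (h𝒦 : ∀ K ∈ 𝒦, ∃ r, K = G.scc σ r) {l : R} :
    (∀ N, (G.deleteRow l).IsMaxMatching N → Covers N (union 𝒦)) ↔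
      ∀ r, G.scc σ r ∈ 𝒦 → ¬ G.Reach σ r l := by
  have hU := h.union_matchedBy h𝒦
  constructor
  · intro hcov r hr𝒦 hr
    obtain ⟨N, hN, hNr⟩ := h.exists_isMaxMatching_deleteRow hr
    obtain ⟨x, hx⟩ := hU.exists_of_covers h.injective (hcov N hN) (c := σ r) (by
      simp only [union, Finset.mem_filter, Finset.mem_univ, true_and]
      refine ⟨_, hr𝒦, ?_⟩
      rw [(h.scc_matchedBy r).cols_eq, h.scc_rows]
      exact Finset.mem_image_of_mem σ (self_mem_sccRows r))
    exact hNr x hx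
  · intro hreach N hN
    rw [hU.covers_iff h.injective hN.1]
    intro x hx
    simp only [union, Finset.mem_filter, Finset.mem_univ, true_and] at hx ⊢
    obtain ⟨K, hK, hxK⟩ := hx
    obtain ⟨r, rfl⟩ := h𝒦 K hK
    obtain ⟨c, hc, hcK⟩ := h.exists_mem_scc_edges (hreach r hK) hN hxK
    exact ⟨c, hc, _, hK, hcK⟩

end Covers

end BipGraph

/-! ### Conditions c1) and c2) as reachability statements -/

namespace Structured

open BipGraph

section Conditions

variable {n m : ℕ} {M : Matrix (Fin n) (Fin n ⊕ Fin m) Entry} {j : Fin n ⊕ Fin m}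
  {σ : Fin n → Fin n ⊕ Fin m}

theorem mem_bip_edges {r : Fin n} {c : Fin n ⊕ Fin m} :
    (r, c) ∈ (bip M).edges ↔ M r c ≠ Entry.zero := by
  simp [bip]

theorem mem_lambdaEdges {r : Fin n} {c : Fin n ⊕ Fin m} :
    (r, c) ∈ lambdaEdges n m ↔ c = Sum.inl r := by
  simp only [lambdaEdges, Finset.mem_image, Finset.mem_univ, true_and, Prod.mk.injEq]
  constructor
  · rintro ⟨k, rfl, rfl⟩
    rfl
  · rintro rfl
    exact ⟨r, rfl, rfl⟩

theorem mem_bipPencil_edges {r : Fin n} {c : Fin n ⊕ Fin m} :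
    (r, c) ∈ (bipPencil M).edges ↔ c = Sum.inl r ∨ M r c ≠ Entry.zero := by
  rw [← mem_lambdaEdges, ← mem_bip_edges]
  simp [bipPencil]

theorem mem_bipPencilMinor_edges {r : Fin n} {c : Fin n ⊕ Fin m} :
    (r, c) ∈ (bipPencilMinor M j).edges ↔ (c = Sum.inl r ∨ M r c ≠ Entry.zero) ∧ c ≠ j := by
  rw [bipPencilMinor, mem_deleteCol_edges, mem_bipPencil_edges]

theorem bipPencilMinor_rows : (bipPencilMinor M j).rows = Finset.univ := by
  simp [bipPencilMinor, deleteCol, induce, bipPencil]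

theorem mem_bipPencilMinor_cols {c : Fin n ⊕ Fin m} :
    c ∈ (bipPencilMinor M j).cols ↔ c ≠ j := by
  simp [bipPencilMinor, deleteCol, induce, bipPencil]

theorem mem_omegaAt_iff (h : (bipPencilMinor M j).IsPerfect σ) {l : Fin n}
    {K : BipGraph (Fin n) (Fin n ⊕ Fin m)} : K ∈ OmegaAt M j l ↔
      ∃ r, K = (bipPencilMinor M j).scc σ r ∧ GammaNZ M K ∧ (bipPencilMinor M j).Reach σ r l := by
  constructor
  · rintro ⟨⟨hK, hnz⟩, hN⟩
    obtain ⟨r, rfl⟩ := h.mem_dmComponents_iff.1 hK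
    exact ⟨r, rfl, hnz, h.exists_not_covers_scc_iff.1 hN⟩
  · rintro ⟨r, rfl, hnz, hr⟩
    exact ⟨⟨h.mem_dmComponents_iff.2 ⟨r, rfl⟩, hnz⟩, h.exists_not_covers_scc_iff.2 hr⟩

/-- The conditions c1), c2) in terms of reachability. -/
theorem condC1_or_condC2_iff (h : (bipPencilMinor M j).IsPerfect σ) (i : Fin n) :
    (CondC1 M i j ∨ CondC2 M i j) ↔
      ∀ r, GammaNZ M ((bipPencilMinor M j).scc σ r) → (bipPencilMinor M j).Reach σ r i →
        j ≠ Sum.inl i ∧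
          ∀ l ∈ (bipPencil M).colNbrs j \ {i}, ¬ (bipPencilMinor M j).Reach σ r l := by
  have h𝒦 : ∀ K ∈ OmegaAt M j i, ∃ r, K = (bipPencilMinor M j).scc σ r := by
    intro K hK
    obtain ⟨r, hr, _⟩ := (mem_omegaAt_iff h).1 hK
    exact ⟨r, hr⟩
  constructor
  · rintro (hc | ⟨_, hij, hc⟩) r hnz hr
    · have : (bipPencilMinor M j).scc σ r ∈ OmegaAt M j i := (mem_omegaAt_iff h).2 ⟨r, rfl, hnz, hr⟩
      rw [CondC1] at hc
      rw [hc] at this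
      exact this.elim
    · exact ⟨hij, fun l hl => (h.forall_covers_union_iff h𝒦).1 (hc l hl) r
        ((mem_omegaAt_iff h).2 ⟨r, rfl, hnz, hr⟩)⟩
  · intro hall
    rcases (OmegaAt M j i).eq_empty_or_nonempty with he | hne
    · exact Or.inl he
    · refine Or.inr ⟨hne, ?_, fun l hl => ?_⟩
      · obtain ⟨K, hK⟩ := hne
        obtain ⟨r, rfl, hnz, hr⟩ := (mem_omegaAt_iff h).1 hK
        exact (hall r hnz hr).1
      · refine (h.forall_covers_union_iff h𝒦).2 fun r hr => ?_
        obtain ⟨s, hs, hnz, hsi⟩ := (mem_omegaAt_iff h).1 hr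
        -- The rows `r` and `s` represent the same component, so reachability of `i` transfers from
        -- `s` to `r`.
        have hrs : (bipPencilMinor M j).Reach σ r s := by
          have : s ∈ (bipPencilMinor M j).sccRows σ r := by
            rw [← h.scc_rows, hs, h.scc_rows]
            exact self_mem_sccRows s
          exact (mem_sccRows.1 this).1
        exact (hall r hnz (hrs.trans hsi)).2 l hl

end Conditions

end Structured

/-! ## The Popov–Belevitch–Hautus test -/

namespace Structured

section PBH

variable {n m : ℕ}

theorem controllable_iff_forall_vecMul {A : Matrix (Fin n) (Fin n) ℂ}
    {B : Matrix (Fin n) (Fin m) ℂ} :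
    Controllable A B ↔ ∀ u : Fin n → ℂ, (∀ k : Fin n, Matrix.vecMul u (A ^ (k : ℕ) * B) = 0) → u = 0 := by
  have h1 : Controllable A B ↔ LinearIndependent ℂ (ctrbMatrix A B).row := by
    rw [Controllable, Matrix.rank_eq_finrank_span_row, linearIndependent_iff_card_eq_finrank_span,
      Fintype.card_fin, Set.finrank, eq_comm]
  rw [h1, ← Matrix.vecMul_injective_iff]
  have h2 : ∀ u : Fin n → ℂ, Matrix.vecMul u (ctrbMatrix A B) = 0 ↔
      ∀ k : Fin n, Matrix.vecMul u (A ^ (k : ℕ) * B) = 0 := by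
    intro u
    constructor
    · intro h k
      ext c
      exact congrFun h (k, c)
    · intro h
      ext ⟨k, c⟩
      exact congrFun (h k) c
  constructor
  · intro h u hu
    apply h
    simp only [Matrix.zero_vecMul]
    exact (h2 u).2 hu
  · intro h u v huv
    rw [← sub_eq_zero]
    apply h
    rw [← h2, Matrix.sub_vecMul]
    exact sub_eq_zero.2 huv

/-- The row vectors annihilated by all `A ^ k * B` form a subspace invariant under right
multiplication by `A`. If it is nonzero, it contains an eigenvector, since the field is `ℂ`. -/
theorem controllable_iff_forall_eigenvector {A : Matrix (Fin n) (Fin n) ℂ}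
    {B : Matrix (Fin n) (Fin m) ℂ} :
    Controllable A B ↔ ∀ (μ : ℂ) (u : Fin n → ℂ), Matrix.vecMul u A = μ • u →
      Matrix.vecMul u B = 0 → u = 0 := by
  rw [controllable_iff_forall_vecMul]
  constructor
  · intro h μ u hA hB
    refine h u fun k => ?_
    have : ∀ k : ℕ, Matrix.vecMul u (A ^ k) = μ ^ k • u := by
      intro k
      induction k with
      | zero => simp
      | succ k ih =>
        rw [pow_succ, ← Matrix.vecMul_vecMul, ih, Matrix.smul_vecMul, hA, smul_smul, pow_succ]
    rw [← Matrix.vecMul_vecMul, this, Matrix.smul_vecMul, hB, smul_zero]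
  · intro h u hu
    rcases Nat.eq_zero_or_pos n with rfl | hn
    · exact Subsingleton.elim _ _
    have : NeZero n := ⟨hn.ne'⟩
    -- By Cayley–Hamilton, the powers below `n` suffice. Reduction modulo the characteristic
    -- polynomial lowers the degree only if that polynomial is not `1`, hence the separate case `n =
    -- 0`.
    have hall : ∀ k : ℕ, Matrix.vecMul u (A ^ k * B) = 0 := by
      intro k
      rw [Matrix.pow_eq_aeval_mod_charpoly]
      have hdeg : (Polynomial.X ^ k %ₘ A.charpoly).natDegree < n := by
        have := Polynomial.natDegree_modByMonic_lt (Polynomial.X ^ k) A.charpoly_monic (by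
          intro h1
          have := A.charpoly_natDegree_eq_dim
          rw [h1, Polynomial.natDegree_one, Fintype.card_fin] at this
          omega)
        rwa [A.charpoly_natDegree_eq_dim, Fintype.card_fin] at this
      rw [Polynomial.aeval_eq_sum_range' hdeg, Matrix.sum_mul, Matrix.vecMul_sum]
      refine Finset.sum_eq_zero fun i hi => ?_
      rw [Matrix.smul_mul, Matrix.vecMul_smul, hu ⟨i, Finset.mem_range.1 hi⟩, smul_zero]
    let W : Submodule ℂ (Fin n → ℂ) :=
      { carrier := {v | ∀ k : ℕ, Matrix.vecMul v (A ^ k * B) = 0}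
        add_mem' := fun ha hb k => by rw [Matrix.add_vecMul, ha k, hb k, add_zero]
        zero_mem' := fun k => Matrix.zero_vecMul _
        smul_mem' := fun c v hv k => by rw [Matrix.smul_vecMul, hv k, smul_zero] }
    have hW : ∀ v ∈ W, Matrix.vecMulLinear A v ∈ W := by
      intro v hv k
      have := hv (k + 1)
      rw [pow_succ', Matrix.mul_assoc, ← Matrix.vecMul_vecMul] at this
      exact this
    by_contra hu0
    have : Nontrivial W := ⟨⟨⟨u, hall⟩, 0, fun h0 => hu0 (congrArg Subtype.val h0)⟩⟩
    obtain ⟨μ, hμ⟩ := Module.End.exists_eigenvalue ((Matrix.vecMulLinear A).restrict hW)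
    obtain ⟨v, hv⟩ := hμ.exists_hasEigenvector
    refine hv.2 (Subtype.ext (h μ v ?_ ?_))
    · exact congrArg Subtype.val hv.apply_eq_smul
    · have := v.2 0
      simpa using this

end PBH

/-! ## The pencil of a structured system -/

section Pencil

variable {n m : ℕ}

/-- The realization of the pattern `M` with parameters `z`. -/
def realize (M : Matrix (Fin n) (Fin n ⊕ Fin m) Entry) (z : Fin n × (Fin n ⊕ Fin m) → ℂ) :
    Matrix (Fin n) (Fin n ⊕ Fin m) ℂ :=
  Matrix.of fun r c => if M r c = Entry.zero then 0 else z (r, c)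

/-- The entries of the pencil `[A - μ I, B]` of the realization of `M` with parameters `z`. -/
def pencil (M : Matrix (Fin n) (Fin n ⊕ Fin m) Entry) (z : Fin n × (Fin n ⊕ Fin m) → ℂ) (μ : ℂ)
    (r : Fin n) (c : Fin n ⊕ Fin m) : ℂ :=
  (if M r c = Entry.zero then 0 else z (r, c)) - if c = Sum.inl r then μ else 0

/-- `u` is annihilated by the column `c` of the pencil. -/
def Kills (M : Matrix (Fin n) (Fin n ⊕ Fin m) Entry) (z : Fin n × (Fin n ⊕ Fin m) → ℂ) (μ : ℂ)
    (u : Fin n → ℂ) (c : Fin n ⊕ Fin m) : Prop := ∑ r, u r * pencil M z μ r c = 0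

/-- The realization of `M` with parameters `z` is controllable. -/
def RealizesControllable (M : Matrix (Fin n) (Fin n ⊕ Fin m) Entry)
    (z : Fin n × (Fin n ⊕ Fin m) → ℂ) : Prop :=
  Controllable (realize M z).toCols₁ (realize M z).toCols₂

/-- This is the Popov–Belevitch–Hautus test with one equation per column: the state columns give the
eigenvalue equation, and the input columns give the annihilation of `B`. -/
theorem realizesControllable_iff {M : Matrix (Fin n) (Fin n ⊕ Fin m) Entry}
    {z : Fin n × (Fin n ⊕ Fin m) → ℂ} :
    RealizesControllable M z ↔ ∀ μ u, (∀ c, Kills M z μ u c) → u = 0 := by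
  rw [RealizesControllable, controllable_iff_forall_eigenvector]
  have h : ∀ μ u, (∀ c, Kills M z μ u c) ↔ Matrix.vecMul u (realize M z).toCols₁ = μ • u ∧
      Matrix.vecMul u (realize M z).toCols₂ = 0 := by
    intro μ u
    rw [Sum.forall]
    refine and_congr ?_ ?_
    · rw [funext_iff]
      refine forall_congr' fun k => ?_
      rw [Kills]
      simp only [pencil, mul_sub, Finset.sum_sub_distrib, Sum.inl.injEq, mul_ite, mul_zero,
        Finset.sum_ite_eq, Finset.mem_univ, if_true, sub_eq_zero]
      simp [Matrix.vecMul, dotProduct, realize, mul_comm]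
    · rw [funext_iff]
      refine forall_congr' fun k => ?_
      rw [Kills]
      simp [pencil, Matrix.vecMul, dotProduct, realize]
  constructor
  · intro H μ u hu
    exact H μ u ((h μ u).1 hu).1 ((h μ u).1 hu).2
  · intro H μ u h1 h2
    exact H μ u ((h μ u).2 ⟨h1, h2⟩)

end Pencil

end Structured

/-! ## Reduction of PSSC to one varying entry at a generic point -/

namespace Structured

section Generic

variable {n : ℕ}

/-- The determinant of the controllability matrix of a single-input system. -/
noncomputable def ctrbDet {S : Type*} [CommRing S] (H : Matrix (Fin n) (Fin n ⊕ Fin 1) S) : S :=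
  Matrix.det (Matrix.of fun r k : Fin n => (H.toCols₁ ^ (k : ℕ) * H.toCols₂) r 0)

theorem map_ctrbDet {S T : Type*} [CommRing S] [CommRing T] (φ : S →+* T)
    (H : Matrix (Fin n) (Fin n ⊕ Fin 1) S) : φ (ctrbDet H) = ctrbDet (H.map φ) := by
  rw [ctrbDet, ctrbDet, RingHom.map_det]
  congr 1
  ext r k
  have h1 : (H.map φ).toCols₁ = H.toCols₁.map φ := rfl
  have h2 : (H.map φ).toCols₂ = H.toCols₂.map φ := rfl
  rw [h1, h2, RingHom.mapMatrix_apply, Matrix.map_apply, Matrix.of_apply, Matrix.of_apply,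
    ← RingHom.mapMatrix_apply, ← map_pow, RingHom.mapMatrix_apply, ← Matrix.map_mul,
    Matrix.map_apply]

theorem controllable_iff_ctrbDet_ne_zero (H : Matrix (Fin n) (Fin n ⊕ Fin 1) ℂ) :
    Controllable H.toCols₁ H.toCols₂ ↔ ctrbDet H ≠ 0 := by
  rw [controllable_iff_forall_vecMul, ctrbDet, ne_eq, ← Matrix.exists_vecMul_eq_zero_iff]
  push Not
  refine forall_congr' fun u => ?_
  have : Matrix.vecMul u (Matrix.of fun r k : Fin n => (H.toCols₁ ^ (k : ℕ) * H.toCols₂) r 0) = 0 ↔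
      ∀ k : Fin n, Matrix.vecMul u (H.toCols₁ ^ (k : ℕ) * H.toCols₂) = 0 := by
    rw [funext_iff]
    refine forall_congr' fun k => ?_
    rw [funext_iff, Unique.forall_iff]
    rfl
  rw [← this]
  tauto

/-- The determinant of the controllability matrix as a polynomial in the indeterminate entries. -/
noncomputable def ctrbPoly (M : Matrix (Fin n) (Fin n ⊕ Fin 1) Entry) :
    MvPolynomial (Fin n × (Fin n ⊕ Fin 1)) ℚ :=
  ctrbDet (Matrix.of fun r c => if M r c = Entry.zero then 0 else MvPolynomial.X (r, c))

variable {M : Matrix (Fin n) (Fin n ⊕ Fin 1) Entry}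

theorem aeval_ctrbPoly (z : Fin n × (Fin n ⊕ Fin 1) → ℂ) :
    MvPolynomial.aeval z (ctrbPoly M) = ctrbDet (realize M z) := by
  have := map_ctrbDet (MvPolynomial.aeval (R := ℚ) z).toRingHom
    (Matrix.of fun r c => if M r c = Entry.zero then 0 else MvPolynomial.X (r, c))
  rw [AlgHom.toRingHom_eq_coe, RingHom.coe_coe] at this
  rw [ctrbPoly, this]
  congr 1
  ext r c
  simp only [Matrix.map_apply, Matrix.of_apply, realize]
  split_ifs <;> simp

theorem realizesControllable_iff_aeval (z : Fin n × (Fin n ⊕ Fin 1) → ℂ) :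
    RealizesControllable M z ↔ MvPolynomial.aeval z (ctrbPoly M) ≠ 0 := by
  rw [RealizesControllable, controllable_iff_ctrbDet_ne_zero, aeval_ctrbPoly]

theorem realize_congr {z w : Fin n × (Fin n ⊕ Fin 1) → ℂ}
    (h : ∀ x : Fin n × (Fin n ⊕ Fin 1), M x.1 x.2 ≠ Entry.zero → z x = w x) :
    realize M z = realize M w := by
  ext r c
  simp only [realize, Matrix.of_apply]
  split_ifs with h0
  · rfl
  · exact h (r, c) h0

variable {A' : Matrix (Fin n) (Fin n) Entry} {b' : Matrix (Fin n) (Fin 1) Entry}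

/-- If `ctrbPoly` vanished at an algebraically independent point, it would be the zero polynomial,
and no realization would be controllable. -/
theorem structurallyControllable_iff {z : Fin n × (Fin n ⊕ Fin 1) → ℂ}
    (hz : AlgebraicIndependent ℚ z) :
    StructurallyControllable A' b' ↔ RealizesControllable (Matrix.fromCols A' b') z := by
  constructor
  · rintro ⟨A, B, hAB, hc⟩
    rw [realizesControllable_iff_aeval]
    intro h0
    have h1 : ctrbPoly (Matrix.fromCols A' b') = 0 := hz.eq_zero_of_aeval_eq_zero _ h0
    have h2 := aeval_ctrbPoly (M := Matrix.fromCols A' b')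
      fun x => Matrix.fromCols A B x.1 x.2
    rw [h1, map_zero] at h2
    have h3 : realize (Matrix.fromCols A' b') (fun x => Matrix.fromCols A B x.1 x.2) =
        Matrix.fromCols A B := by
      ext r c
      simp only [realize, Matrix.of_apply]
      split_ifs with h0
      · exact ((hAB r c).2 (by simp [toStar, h0])).symm
      · rfl
    rw [h3] at h2
    exact (controllable_iff_ctrbDet_ne_zero (Matrix.fromCols A B)).1
      (by rwa [Matrix.toCols₁_fromCols, Matrix.toCols₂_fromCols]) h2.symm
  · intro h
    refine ⟨_, _, ?_, h⟩
    rw [Matrix.fromCols_toCols]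
    intro r c
    constructor
    · intro hc
      simp only [toStar, Matrix.of_apply] at hc
      split_ifs at hc with h1
      exact absurd hc h1
    · intro hc
      simp only [toStar, Matrix.of_apply] at hc
      split_ifs at hc with h1
      simp [realize, hc]

/-- Both parts of a realization are merged into one parameter vector on all positions, so that a `×`
entry can be moved by `Function.update`. The coordinates at `0` entries are ignored by `realize`. -/
theorem pssc_iff_forall_extension :
    PSSC A' b' ↔ ∀ᵐ p : StarPos (Matrix.fromCols A' b') → ℂ ∂volume,
      ∀ z : Fin n × (Fin n ⊕ Fin 1) → ℂ, (∀ x : StarPos (Matrix.fromCols A' b'), z x.1 = p x) →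
        (∀ x : Fin n × (Fin n ⊕ Fin 1), Matrix.fromCols A' b' x.1 x.2 = Entry.cross → z x ≠ 0) →
          RealizesControllable (Matrix.fromCols A' b') z := by
  set M := Matrix.fromCols A' b'
  have h : ∀ p : StarPos M → ℂ, (∀ X ∈ realizations (crossPart M),
      Controllable (starMatrix M p + X).toCols₁ (starMatrix M p + X).toCols₂) ↔
      ∀ z : Fin n × (Fin n ⊕ Fin 1) → ℂ, (∀ x : StarPos M, z x.1 = p x) →
        (∀ x : Fin n × (Fin n ⊕ Fin 1), M x.1 x.2 = Entry.cross → z x ≠ 0) →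
          RealizesControllable M z := by
    intro p
    constructor
    · intro H z hzp hz
      have h1 := H (Matrix.of fun r c => if M r c = Entry.cross then z (r, c) else 0) (by
        intro r c
        simp only [crossPart, Matrix.of_apply]
        by_cases hc : M r c = Entry.cross
        · simpa [hc] using hz (r, c) hc
        · simp [hc])
      have h2 : starMatrix M p + (Matrix.of fun r c => if M r c = Entry.cross then z (r, c) else 0) =
          realize M z := by
        ext r c
        have hs := fun h => hzp ⟨(r, c), h⟩
        rcases hc : M r c <;> simp [starMatrix, realize, hc]
        exact (hs hc).symm
      rw [h2] at h1
      exact h1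
    · intro H X hX
      have h1 := H (fun x => if h : M x.1 x.2 = Entry.star then p ⟨x, h⟩ else X x.1 x.2)
        (fun x => by simp [x.2]) (fun x hx => by
          have := (hX x.1 x.2).1 (by simp [crossPart, hx])
          simpa [hx] using this)
      have h2 : realize M (fun x => if h : M x.1 x.2 = Entry.star then p ⟨x, h⟩ else X x.1 x.2) =
          starMatrix M p + X := by
        ext r c
        have h3 := (hX r c).2
        rcases hc : M r c <;> simp [starMatrix, realize, hc, crossPart] at h3 ⊢ <;> simp [h3]
      rw [RealizesControllable, h2] at h1
      exact h1
  exact Filter.eventually_congr (Filter.Eventually.of_forall h)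

/-- A PSSC system has a generic realization that stays controllable when a `×` entry is moved in
`ℂˣ`. -/
theorem PSSC.exists_generic (h : PSSC A' b') :
    ∃ z : Fin n × (Fin n ⊕ Fin 1) → ℂ, AlgebraicIndependent ℚ z ∧
      RealizesControllable (Matrix.fromCols A' b') z ∧
        ∀ x : Fin n × (Fin n ⊕ Fin 1), Matrix.fromCols A' b' x.1 x.2 = Entry.cross →
          ∀ t : ℂ, t ≠ 0 → RealizesControllable (Matrix.fromCols A' b') (Function.update z x t) := by
  rw [pssc_iff_forall_extension] at h
  set M := Matrix.fromCols A' b'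
  have hmp := volume_preserving_piEquivPiSubtypeProd (fun _ : Fin n × (Fin n ⊕ Fin 1) => ℂ)
    fun x => M x.1 x.2 = Entry.star
  -- The projection to the `*` coordinates pulls null sets back to null sets, so a property of
  -- almost all `*` values holds for the `*` coordinates of some algebraically independent point of
  -- the full space.
  have hq := Measure.quasiMeasurePreserving_fst.comp hmp.quasiMeasurePreserving
  obtain ⟨z, hz, hgood⟩ := ((ae_algebraicIndependent _).and (hq.ae h)).exists
  have hgood' : ∀ w : Fin n × (Fin n ⊕ Fin 1) → ℂ, (∀ x : StarPos M, w x.1 = z x.1) →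
      (∀ x : Fin n × (Fin n ⊕ Fin 1), M x.1 x.2 = Entry.cross → w x ≠ 0) →
        RealizesControllable M w := hgood
  refine ⟨z, hz, hgood' z (fun _ => rfl) fun x _ => hz.ne_zero x, fun x hx t ht => ?_⟩
  refine hgood' _ (fun y => ?_) fun y _ => ?_
  · refine Function.update_of_ne ?_ _ _
    intro hyx
    have := y.2
    rw [hyx, hx] at this
    cases this
  · by_cases hyx : y = x
    · subst hyx
      simpa using ht
    · rw [Function.update_of_ne hyx]
      exact hz.ne_zero y

/-- If a generic realization stays controllable whenever a `×` entry is moved in `ℂˣ`, then the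
system is PSSC. -/
theorem pssc_of_generic {z : Fin n × (Fin n ⊕ Fin 1) → ℂ} (hz : AlgebraicIndependent ℚ z)
    (hc : RealizesControllable (Matrix.fromCols A' b') z)
    (h : ∀ x : Fin n × (Fin n ⊕ Fin 1), Matrix.fromCols A' b' x.1 x.2 = Entry.cross →
      ∀ t : ℂ, t ≠ 0 → RealizesControllable (Matrix.fromCols A' b') (Function.update z x t)) :
    PSSC A' b' := by
  rw [pssc_iff_forall_extension]
  set M := Matrix.fromCols A' b'
  set f := ctrbPoly M with hf
  have hexp : ∀ x : Fin n × (Fin n ⊕ Fin 1), ∃ k, M x.1 x.2 = Entry.cross →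
      ∀ m ∈ f.support, m x = k := by
    intro x
    by_cases hx : M x.1 x.2 = Entry.cross
    · obtain ⟨k, hk⟩ := MvPolynomial.exponent_eq_of_forall_ne_zero hz f x fun t ht =>
        (realizesControllable_iff_aeval _).1 (h x hx t ht)
      exact ⟨k, fun _ => hk⟩
    · exact ⟨0, fun h => absurd h hx⟩
  choose k hk using hexp
  -- Since the exponents of the `×` variables are the same in all monomials, these variables factor
  -- out. The coordinates at `0` entries can be set to `1` because the value of `f` does not depend
  -- on them.
  have hscale : ∀ w : Fin n × (Fin n ⊕ Fin 1) → ℂ, MvPolynomial.aeval w f =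
      (∏ x, (if M x.1 x.2 = Entry.cross then w x else 1) ^ k x) *
        MvPolynomial.aeval (fun x => if M x.1 x.2 = Entry.star then w x else 1) f := by
    intro w
    have h1 : MvPolynomial.aeval w f =
        MvPolynomial.aeval (fun x => if M x.1 x.2 = Entry.zero then 1 else w x) f := by
      rw [hf, aeval_ctrbPoly, aeval_ctrbPoly]
      congr 1
      exact realize_congr fun x hx => by simp [hx]
    rw [h1, MvPolynomial.aeval_def, MvPolynomial.aeval_def, MvPolynomial.eval₂_eq',
      MvPolynomial.eval₂_eq', Finset.mul_sum]
    refine Finset.sum_congr rfl fun m hm => ?_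
    rw [mul_left_comm, ← Finset.prod_mul_distrib]
    congr 1
    refine Finset.prod_congr rfl fun x _ => ?_
    have := fun h => hk x h m hm
    rcases hx : M x.1 x.2 <;> simp [hx] at this ⊢
    rw [this]
  have hae := ae_algebraicIndependent (StarPos M)
  filter_upwards [hae] with p hp w hwp hw
  rw [realizesControllable_iff_aeval, ← hf, hscale]
  set g : MvPolynomial (StarPos M) ℚ := MvPolynomial.aeval
    (fun x => if hx : M x.1 x.2 = Entry.star then MvPolynomial.X ⟨x, hx⟩ else 1) f with hg
  have hgev : ∀ w : Fin n × (Fin n ⊕ Fin 1) → ℂ,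
      MvPolynomial.aeval (fun x => if M x.1 x.2 = Entry.star then w x else 1) f =
        MvPolynomial.aeval (fun x : StarPos M => w x.1) g := by
    intro w
    rw [hg, MvPolynomial.comp_aeval_apply]
    congr 2
    funext x
    split_ifs <;> simp
  -- The factor `g` involves only the `*` variables and is nonzero because `z` is controllable. It
  -- therefore does not vanish at any algebraically independent `p`.
  have hg0 : g ≠ 0 := by
    intro h0
    rw [realizesControllable_iff_aeval, ← hf, hscale, hgev, h0, map_zero, mul_zero] at hc
    exact hc rfl
  refine mul_ne_zero (Finset.prod_ne_zero_iff.2 fun x _ => pow_ne_zero _ ?_) ?_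
  · split_ifs with hx
    · exact hw x hx
    · exact one_ne_zero
  · rw [hgev]
    have : (fun x : StarPos M => w x.1) = p := funext hwp
    rw [this]
    exact fun h0 => hg0 (hp.eq_zero_of_aeval_eq_zero _ h0)

end Generic

end Structured

/-! ### Kernel vectors of the pencil and parameter counts -/

namespace Structured

open BipGraph

section Kernel

/-- More rows than columns are linearly dependent on these columns. -/
theorem exists_relation_of_card_lt {ρ γ : Type*} [Fintype ρ] [DecidableEq ρ] [DecidableEq γ]
    (A : ρ → γ → ℂ) (S : Finset ρ) (T : Finset γ) (h : T.card < S.card) :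
    ∃ u : ρ → ℂ, u ≠ 0 ∧ (∀ r, r ∉ S → u r = 0) ∧ ∀ c ∈ T, ∑ r, u r * A r c = 0 := by
  let B : Matrix S T ℂ := Matrix.of fun r c => A r c
  have hker : LinearMap.ker (Matrix.vecMulLinear B) ≠ ⊥ :=
    LinearMap.ker_ne_bot_of_finrank_lt (by simpa using h)
  obtain ⟨v, hv, hv0⟩ := (Submodule.ne_bot_iff _).1 hker
  refine ⟨fun r => if hr : r ∈ S then v ⟨r, hr⟩ else 0, ?_, ?_, ?_⟩
  · intro h0
    apply hv0
    ext ⟨r, hr⟩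
    simpa [hr] using congrFun h0 r
  · intro r hr
    simp [hr]
  · intro c hc
    have h1 := congrFun (LinearMap.mem_ker.1 hv) ⟨c, hc⟩
    rw [← Finset.sum_subset (Finset.subset_univ S) (fun r _ hr => by simp [hr]),
      ← Finset.sum_coe_sort]
    simpa [Matrix.vecMul, dotProduct, B] using h1

end Kernel

section Pencil

variable {n m : ℕ} {M : Matrix (Fin n) (Fin n ⊕ Fin m) Entry}
  {z : Fin n × (Fin n ⊕ Fin m) → ℂ} {μ t : ℂ} {u v : Fin n → ℂ} {i : Fin n} {j : Fin n ⊕ Fin m}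

theorem pencil_update_of_ne {r : Fin n} {c : Fin n ⊕ Fin m} (h : (r, c) ≠ (i, j)) :
    pencil M (Function.update z (i, j) t) μ r c = pencil M z μ r c := by
  rw [pencil, pencil, Function.update_of_ne h]

theorem kills_update_iff_of_ne {c : Fin n ⊕ Fin m} (h : c ≠ j) :
    Kills M (Function.update z (i, j) t) μ u c ↔ Kills M z μ u c := by
  rw [Kills, Kills]
  simp_rw [pencil_update_of_ne (M := M) (z := z) (t := t) (μ := μ) (fun h' => h (Prod.ext_iff.1 h').2)]

theorem kills_update_iff_of_apply_eq_zero {c : Fin n ⊕ Fin m} (h : u i = 0) :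
    Kills M (Function.update z (i, j) t) μ u c ↔ Kills M z μ u c := by
  rw [Kills, Kills]
  suffices ∀ r, u r * pencil M (Function.update z (i, j) t) μ r c = u r * pencil M z μ r c by
    simp_rw [this]
  intro r
  by_cases hr : r = i
  · subst hr
    rw [h, zero_mul, zero_mul]
  · rw [pencil_update_of_ne fun h' => hr (Prod.ext_iff.1 h').1]

/-- The entry at `(i, j)` can be chosen such that `u` is annihilated by the column `j`. -/
theorem exists_kills_update (hM : M i j ≠ Entry.zero) (hu : u i ≠ 0) :
    ∃ t, Kills M (Function.update z (i, j) t) μ u j := by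
  refine ⟨z (i, j) - (∑ r, u r * pencil M z μ r j) / u i, ?_⟩
  have hrest : ∀ s, ∑ r ∈ Finset.univ.erase i, u r * pencil M (Function.update z (i, j) s) μ r j =
      ∑ r ∈ Finset.univ.erase i, u r * pencil M z μ r j := by
    intro s
    refine Finset.sum_congr rfl fun r hr => ?_
    rw [pencil_update_of_ne fun h' => Finset.ne_of_mem_erase hr (Prod.ext_iff.1 h').1]
  rw [Kills, ← Finset.add_sum_erase _ _ (Finset.mem_univ i), hrest,
    ← Finset.add_sum_erase _ (fun r => u r * pencil M z μ r j) (Finset.mem_univ i)]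
  simp only [pencil, if_neg hM, Function.update_self]
  field_simp
  ring

theorem kills_smul_iff {a : ℂ} (ha : a ≠ 0) {c : Fin n ⊕ Fin m} :
    Kills M z μ (a • u) c ↔ Kills M z μ u c := by
  rw [Kills, Kills]
  simp only [Pi.smul_apply, smul_eq_mul, mul_assoc, ← Finset.mul_sum, mul_eq_zero, ha, false_or]

/-- The support of a row vector. -/
noncomputable def supp (u : Fin n → ℂ) : Finset (Fin n) := Finset.univ.filter fun r => u r ≠ 0

theorem mem_supp {r : Fin n} : r ∈ supp u ↔ u r ≠ 0 := by simp [supp]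

theorem supp_smul {a : ℂ} (ha : a ≠ 0) : supp (a • u) = supp u := by
  ext r
  simp [mem_supp, ha]

theorem supp_nonempty (hu : u ≠ 0) : (supp u).Nonempty := by
  obtain ⟨r, hr⟩ := Function.ne_iff.1 hu
  exact ⟨r, mem_supp.2 hr⟩

theorem kills_iff_sum_supp {c : Fin n ⊕ Fin m} :
    Kills M z μ u c ↔ ∑ r ∈ supp u, u r * pencil M z μ r c = 0 := by
  rw [Kills, Finset.sum_subset (Finset.subset_univ (supp u)) fun r _ hr => by
    rw [mem_supp, not_not] at hr
    rw [hr, zero_mul]]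

/-- The column `c` has a generic entry, other than the one at `(i, j)`, in a row of the support
of `u`. -/
def HasPivot (M : Matrix (Fin n) (Fin n ⊕ Fin m) Entry) (i : Fin n) (j : Fin n ⊕ Fin m)
    (u : Fin n → ℂ) (c : Fin n ⊕ Fin m) : Prop :=
  ∃ r, u r ≠ 0 ∧ M r c ≠ Entry.zero ∧ (r, c) ≠ (i, j)

theorem pencil_sub_mem {L : Finset ℂ} (hμ : μ ∈ IntermediateField.adjoin ℚ (L : Set ℂ))
    {r : Fin n} {c : Fin n ⊕ Fin m} (hM : M r c ≠ Entry.zero) (hrc : (r, c) ≠ (i, j)) :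
    pencil M (Function.update z (i, j) 0) μ r c - z (r, c) ∈
      IntermediateField.adjoin ℚ (L : Set ℂ) := by
  rw [pencil_update_of_ne hrc, pencil, if_neg hM, sub_right_comm, sub_self, zero_sub]
  refine neg_mem ?_
  split_ifs
  · exact hμ
  · exact zero_mem _

theorem pencil_mem_or {L : Finset ℂ} (hμ : μ ∈ IntermediateField.adjoin ℚ (L : Set ℂ))
    (r : Fin n) (c : Fin n ⊕ Fin m) :
    pencil M (Function.update z (i, j) 0) μ r c ∈ IntermediateField.adjoin ℚ (L : Set ℂ) ∨
      pencil M (Function.update z (i, j) 0) μ r c - z (r, c) ∈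
        IntermediateField.adjoin ℚ (L : Set ℂ) := by
  by_cases h : M r c = Entry.zero ∨ (r, c) = (i, j)
  · left
    have : (if M r c = Entry.zero then 0 else Function.update z (i, j) 0 (r, c)) = 0 := by
      split_ifs with h0
      · rfl
      · rw [h.resolve_left h0, Function.update_self]
    rw [pencil, this, zero_sub]
    refine neg_mem ?_
    split_ifs
    · exact hμ
    · exact zero_mem _
  · rw [not_or] at h
    exact Or.inr (pencil_sub_mem hμ h.1 h.2)

/-- A vector with `s` nonzero entries is annihilated by at most `s - 1 + #L` columns with a pivot
if the eigenvalue lies in `ℚ(L)`. -/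
theorem card_add_one_le (hz : AlgebraicIndependent ℚ z) {L : Finset ℂ}
    (hμ : μ ∈ IntermediateField.adjoin ℚ (L : Set ℂ)) (hu : u ≠ 0)
    {C₀ : Finset (Fin n ⊕ Fin m)}
    (hk : ∀ c ∈ C₀, Kills M (Function.update z (i, j) 0) μ u c)
    (hp : ∀ c ∈ C₀, HasPivot M i j u c) : C₀.card + 1 ≤ (supp u).card + L.card := by
  obtain ⟨s, hs⟩ := supp_nonempty hu
  have ha : (u s)⁻¹ ≠ 0 := inv_ne_zero (mem_supp.1 hs)
  -- Scaling one entry to `1` saves one parameter. The entry at `(i, j)` is set to `0`, so that it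
  -- contributes no parameter to the coefficients.
  have := card_columns_add_card_le hz L (pencil M (Function.update z (i, j) 0) μ) ((u s)⁻¹ • u)
    (supp u) {s} (by simpa using hs) (by simpa using inv_mul_cancel₀ (mem_supp.1 hs)) C₀
    (fun _ => supp u) (fun _ _ => subset_rfl) (fun c _ r _ => pencil_mem_or hμ r c)
    (fun c hc => by
      obtain ⟨r, h1, h2, h3⟩ := hp c hc
      exact ⟨r, mem_supp.2 h1, by simp [mem_supp.1 hs, h1], pencil_sub_mem hμ h2 h3⟩)
    (fun c hc => by
      have := (kills_smul_iff ha).2 (hk c hc)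
      rwa [kills_iff_sum_supp, supp_smul ha] at this)
  simpa using this

/-- The parameter count for two vectors with disjoint supports that are annihilated by disjoint
sets of columns for the same eigenvalue. -/
theorem card_add_card_add_two_le (hz : AlgebraicIndependent ℚ z) {L : Finset ℂ}
    (hμ : μ ∈ IntermediateField.adjoin ℚ (L : Set ℂ)) (hu : u ≠ 0) (hv : v ≠ 0)
    (huv : Disjoint (supp u) (supp v)) {C₁ C₂ : Finset (Fin n ⊕ Fin m)} (hC : Disjoint C₁ C₂)
    (hk₁ : ∀ c ∈ C₁, Kills M (Function.update z (i, j) 0) μ u c)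
    (hk₂ : ∀ c ∈ C₂, Kills M (Function.update z (i, j) 0) μ v c)
    (hp₁ : ∀ c ∈ C₁, HasPivot M i j u c) (hp₂ : ∀ c ∈ C₂, HasPivot M i j v c) :
    C₁.card + C₂.card + 2 ≤ (supp u).card + (supp v).card + L.card := by
  classical
  obtain ⟨s, hs⟩ := supp_nonempty hu
  obtain ⟨s', hs'⟩ := supp_nonempty hv
  have ha : (u s)⁻¹ ≠ 0 := inv_ne_zero (mem_supp.1 hs)
  have ha' : (v s')⁻¹ ≠ 0 := inv_ne_zero (mem_supp.1 hs')
  -- Disjoint supports allow both vectors to be normalised independently and stored in one vector.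
  -- This saves two parameters, while the common eigenvalue is counted once.
  set w : Fin n → ℂ := (u s)⁻¹ • u + (v s')⁻¹ • v with hw
  have hwu : ∀ r ∈ supp u, w r = ((u s)⁻¹ • u) r := by
    intro r hr
    have : v r = 0 := by
      by_contra h
      exact Finset.disjoint_left.1 huv hr (mem_supp.2 h)
    simp [hw, this]
  have hwv : ∀ r ∈ supp v, w r = ((v s')⁻¹ • v) r := by
    intro r hr
    have : u r = 0 := by
      by_contra h
      exact Finset.disjoint_right.1 huv hr (mem_supp.2 h)
    simp [hw, this]
  have hss : s ≠ s' := by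
    rintro rfl
    exact Finset.disjoint_left.1 huv hs hs'
  have := card_columns_add_card_le hz L (pencil M (Function.update z (i, j) 0) μ) w
    (supp u ∪ supp v) {s, s'} (by
      intro r hr
      rcases Finset.mem_insert.1 hr with rfl | hr
      · exact Finset.mem_union_left _ hs
      · rw [Finset.mem_singleton.1 hr]
        exact Finset.mem_union_right _ hs') (by
      intro r hr
      rcases Finset.mem_insert.1 hr with rfl | hr
      · rw [hwu _ hs]
        simpa using inv_mul_cancel₀ (mem_supp.1 hs)
      · rw [Finset.mem_singleton.1 hr, hwv _ hs']
        simpa using inv_mul_cancel₀ (mem_supp.1 hs')) (C₁ ∪ C₂)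
    (fun c => if c ∈ C₁ then supp u else supp v)
    (fun c _ => by
      split_ifs
      · exact Finset.subset_union_left
      · exact Finset.subset_union_right)
    (fun c _ r _ => pencil_mem_or hμ r c)
    (fun c hc => by
      by_cases hc1 : c ∈ C₁
      · obtain ⟨r, h1, h2, h3⟩ := hp₁ c hc1
        refine ⟨r, by simpa [hc1] using mem_supp.2 h1, ?_, pencil_sub_mem hμ h2 h3⟩
        rw [hwu r (mem_supp.2 h1)]
        simp [mem_supp.1 hs, h1]
      · obtain ⟨r, h1, h2, h3⟩ := hp₂ c ((Finset.mem_union.1 hc).resolve_left hc1)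
        refine ⟨r, by simpa [hc1] using mem_supp.2 h1, ?_, pencil_sub_mem hμ h2 h3⟩
        rw [hwv r (mem_supp.2 h1)]
        simp [mem_supp.1 hs', h1])
    (fun c hc => by
      by_cases hc1 : c ∈ C₁
      · have := (kills_smul_iff ha).2 (hk₁ c hc1)
        rw [kills_iff_sum_supp, supp_smul ha] at this
        simp only [hc1, if_true]
        exact (Finset.sum_congr rfl fun r hr => by rw [hwu r hr]).trans this
      · have := (kills_smul_iff ha').2 (hk₂ c ((Finset.mem_union.1 hc).resolve_left hc1))
        rw [kills_iff_sum_supp, supp_smul ha'] at this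
        simp only [hc1, if_false]
        exact (Finset.sum_congr rfl fun r hr => by rw [hwv r hr]).trans this)
  rw [Finset.card_union_of_disjoint hC, Finset.card_union_of_disjoint huv,
    Finset.card_pair hss] at this
  exact this

/-- For a nonzero eigenvalue, a column that is adjacent to the support of `u` and annihilates `u`
has a pivot. -/
theorem Kills.hasPivot {c : Fin n ⊕ Fin m} (hμ : μ ≠ 0)
    (hk : Kills M (Function.update z (i, j) 0) μ u c) {s : Fin n} (hs : u s ≠ 0)
    (hsc : c = Sum.inl s ∨ M s c ≠ Entry.zero ∧ (s, c) ≠ (i, j)) : HasPivot M i j u c := by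
  rcases hsc with rfl | hsc
  · by_contra hcon
    rw [HasPivot] at hcon
    push Not at hcon
    -- Without a pivot, only the term `-μ` in row `s` survives on the support, and the column cannot
    -- annihilate `u`.
    have h1 : ∀ r, u r * pencil M (Function.update z (i, j) 0) μ r (Sum.inl s) =
        if r = s then -(u r * μ) else 0 := by
      intro r
      by_cases hr : u r = 0
      · simp [hr]
      · have h2 : (if M r (Sum.inl s) = Entry.zero then 0 else
            Function.update z (i, j) 0 (r, Sum.inl s)) = 0 := by
          split_ifs with h0
          · rfl
          · rw [hcon r hr h0, Function.update_self]
        rw [pencil, h2]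
        by_cases hrs : r = s
        · simp [hrs]
        · simp [hrs, Ne.symm hrs]
    rw [Kills] at hk
    simp_rw [h1] at hk
    simp [hs, hμ] at hk
  · exact ⟨s, hs, hsc⟩

end Pencil

/-! ## Perfect matchings from controllability -/

section Matchings

variable {n m : ℕ} {M : Matrix (Fin n) (Fin n ⊕ Fin m) Entry}
  {z : Fin n × (Fin n ⊕ Fin m) → ℂ} {μ : ℂ} {u v : Fin n → ℂ} {i : Fin n} {j : Fin n ⊕ Fin m}

/-- The columns adjacent to the rows in `S` in the graph of `M`. -/
noncomputable def nbrs (M : Matrix (Fin n) (Fin n ⊕ Fin m) Entry) (S : Finset (Fin n)) :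
    Finset (Fin n ⊕ Fin m) := Finset.univ.filter fun c => ∃ r ∈ S, M r c ≠ Entry.zero

theorem mem_nbrs {S : Finset (Fin n)} {c : Fin n ⊕ Fin m} :
    c ∈ nbrs M S ↔ ∃ r ∈ S, M r c ≠ Entry.zero := by simp [nbrs]

theorem kills_zero_of_notMem_nbrs {S : Finset (Fin n)} (hu : ∀ r, r ∉ S → u r = 0)
    {c : Fin n ⊕ Fin m} (hc : c ∉ nbrs M S) : Kills M z 0 u c := by
  refine Finset.sum_eq_zero fun r _ => ?_
  by_cases hr : r ∈ S
  · have : M r c = Entry.zero := by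
      by_contra h
      exact hc (mem_nbrs.2 ⟨r, hr, h⟩)
    simp [pencil, this]
  · rw [hu r hr, zero_mul]

/-- Otherwise the rows in `S` are linearly dependent, which makes `0` an uncontrollable eigenvalue.
-/
theorem card_le_card_nbrs (hc : RealizesControllable M z) (S : Finset (Fin n)) :
    S.card ≤ (nbrs M S).card := by
  by_contra hlt
  obtain ⟨u, hu0, huS, hu⟩ := exists_relation_of_card_lt (pencil M z 0) S (nbrs M S) (not_le.1 hlt)
  refine hu0 (realizesControllable_iff.1 hc 0 u fun c => ?_)
  by_cases hcS : c ∈ nbrs M S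
  · exact hu c hcS
  · exact kills_zero_of_notMem_nbrs huS hcS

/-- A violation of Hall's condition by `S` means that the rows in `S` have no entries outside the
state columns of `S`. Such a set of states cannot be influenced from outside, and a left eigenvector
of its block, extended by zero, contradicts controllability. -/
theorem exists_isPerfect_bipPencilMinor {M : Matrix (Fin n) (Fin n ⊕ Fin 1) Entry}
    {z : Fin n × (Fin n ⊕ Fin 1) → ℂ} (hc : RealizesControllable M z) (j : Fin n ⊕ Fin 1) :
    ∃ σ, (bipPencilMinor M j).IsPerfect σ := by
  classical
  have : Nonempty (Fin n ⊕ Fin 1) := ⟨j⟩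
  obtain ⟨σ, hσ, hσe⟩ := exists_injOn_of_card_le_biUnion (Finset.univ : Finset (Fin n))
    (fun r => Finset.univ.filter fun c => (r, c) ∈ (bipPencilMinor M j).edges) (by
    intro S _
    by_contra hlt
    rw [not_le] at hlt
    set T := S.biUnion fun r => Finset.univ.filter fun c => (r, c) ∈ (bipPencilMinor M j).edges with hT
    have hmemT : ∀ c, c ∈ T ↔ ∃ r ∈ S, (c = Sum.inl r ∨ M r c ≠ Entry.zero) ∧ c ≠ j := by
      intro c
      simp [hT, mem_bipPencilMinor_edges]
    set I : Finset (Fin n ⊕ Fin 1) := S.image Sum.inl with hI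
    have hIcard : I.card = S.card := Finset.card_image_of_injective _ Sum.inl_injective
    have hsub : I.erase j ⊆ T := by
      intro c hc
      obtain ⟨hcj, hcI⟩ := Finset.mem_erase.1 hc
      obtain ⟨r, hr, rfl⟩ := Finset.mem_image.1 hcI
      exact (hmemT _).2 ⟨r, hr, Or.inl rfl, hcj⟩
    have hjI : j ∈ I := by
      by_contra hj
      rw [Finset.erase_eq_of_notMem hj] at hsub
      have := Finset.card_le_card hsub
      omega
    -- The `λ`-edges alone give `#S - 1` neighbours, so the violation is tight: `j` belongs to a row
    -- of `S`, and there are no neighbours other than the `λ`-ones.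
    have hTI : T = I.erase j := by
      refine (Finset.eq_of_subset_of_card_le hsub ?_).symm
      rw [Finset.card_erase_of_mem hjI]
      omega
    have hout : ∀ r ∈ S, ∀ c, c ∉ I → pencil M z 0 r c = 0 ∧ c ≠ Sum.inl r := by
      intro r hr c hcI
      have hcr : c ≠ Sum.inl r := by
        rintro rfl
        exact hcI (Finset.mem_image_of_mem _ hr)
      refine ⟨?_, hcr⟩
      have : M r c = Entry.zero := by
        by_contra h0
        have hcj : c ≠ j := by
          rintro rfl
          exact hcI hjI
        have : c ∈ T := (hmemT c).2 ⟨r, hr, Or.inr h0, hcj⟩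
        rw [hTI] at this
        exact hcI (Finset.mem_erase.1 this).2
      simp [pencil, this]
    obtain ⟨s, hs, _⟩ := Finset.mem_image.1 hjI
    have : Nonempty S := ⟨⟨s, hs⟩⟩
    let B : Matrix S S ℂ := Matrix.of fun r k => pencil M z 0 r (Sum.inl k)
    obtain ⟨μ, hμ⟩ := Module.End.exists_eigenvalue (Matrix.vecMulLinear B)
    obtain ⟨v, hv⟩ := hμ.exists_hasEigenvector
    set u : Fin n → ℂ := fun r => if hr : r ∈ S then v ⟨r, hr⟩ else 0 with hu
    have huS : ∀ r, r ∉ S → u r = 0 := fun r hr => by simp [hu, hr]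
    have hu0 : u = 0 := by
      refine realizesControllable_iff.1 hc μ u fun c => ?_
      rw [Kills, ← Finset.sum_subset (Finset.subset_univ S) (fun r _ hr => by
        rw [huS r hr, zero_mul])]
      by_cases hcI : c ∈ I
      · obtain ⟨k, hk, rfl⟩ := Finset.mem_image.1 hcI
        have h1 := congrFun hv.apply_eq_smul ⟨k, hk⟩
        have h2 : ∑ r ∈ S, u r * pencil M z 0 r (Sum.inl k) = μ * u k := by
          rw [← Finset.sum_coe_sort]
          simpa [Matrix.vecMul, dotProduct, B, hu, hk] using h1
        have h3 : ∀ r ∈ S, u r * pencil M z μ r (Sum.inl k) =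
            u r * pencil M z 0 r (Sum.inl k) - if r = k then u r * μ else 0 := by
          intro r _
          simp only [pencil, Sum.inl.injEq, eq_comm (a := k)]
          split_ifs <;> ring
        rw [Finset.sum_congr rfl h3, Finset.sum_sub_distrib, h2, Finset.sum_ite_eq', if_pos hk]
        ring
      · refine Finset.sum_eq_zero fun r hr => ?_
        have h1 := hout r hr c hcI
        have h2 : pencil M z μ r c = pencil M z 0 r c := by simp [pencil, h1.2]
        rw [h2, h1.1, mul_zero]
    refine hv.2 ?_
    ext ⟨r, hr⟩
    simpa [hu, hr] using congrFun hu0 r)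
  have hmem : ∀ r, (r, σ r) ∈ (bipPencilMinor M j).edges := fun r => by
    simpa using hσe r (Finset.mem_univ _)
  have hinj : Function.Injective σ := by simpa using hσ
  refine ⟨σ, bipPencilMinor_rows, hinj, hmem, fun c hcj => ?_⟩
  have hsub : Finset.univ.image σ ⊆ Finset.univ.erase j := by
    intro c hc
    obtain ⟨r, _, rfl⟩ := Finset.mem_image.1 hc
    exact Finset.mem_erase.2 ⟨(mem_bipPencilMinor_edges.1 (hmem r)).2, Finset.mem_univ _⟩
  -- With a single input there are exactly `n` columns besides `j`, so a matching of all rows uses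
  -- all of them.
  have heq := Finset.eq_of_subset_of_card_le hsub (by
    rw [Finset.card_image_of_injective _ hinj, Finset.card_erase_of_mem (Finset.mem_univ _)]
    simp)
  have : c ∈ Finset.univ.erase j := Finset.mem_erase.2 ⟨mem_bipPencilMinor_cols.1 hcj, Finset.mem_univ _⟩
  rw [← heq] at this
  obtain ⟨r, _, hr⟩ := Finset.mem_image.1 this
  exact ⟨r, hr⟩

end Matchings

end Structured

namespace Structured

open BipGraph

/-! ## The eigenvalue zero -/

section Zero

variable {n m : ℕ} {M : Matrix (Fin n) (Fin n ⊕ Fin m) Entry}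
  {z : Fin n × (Fin n ⊕ Fin m) → ℂ} {u v : Fin n → ℂ} {i a : Fin n} {j : Fin n ⊕ Fin m}

theorem bip_delete_edges {r : Fin n} {c : Fin n ⊕ Fin m} :
    (r, c) ∈ (((bip M).deleteRow a).deleteCol j).edges ↔ M r c ≠ Entry.zero ∧ r ≠ a ∧ c ≠ j := by
  rw [mem_deleteCol_edges, mem_deleteRow_edges, mem_bip_edges, and_assoc]

theorem bip_delete_rows : (((bip M).deleteRow a).deleteCol j).rows = Finset.univ.erase a := by
  simp [deleteCol, deleteRow, induce, bip]

theorem exists_injective_of_controllable (hc : RealizesControllable M z) (j : Fin n ⊕ Fin m) :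
    ∃ ρ : Fin n → Fin n ⊕ Fin m, Function.Injective ρ ∧ ∀ r, M r (ρ r) ≠ Entry.zero := by
  have : Nonempty (Fin n ⊕ Fin m) := ⟨j⟩
  obtain ⟨ρ, hρ, hρe⟩ := exists_injOn_of_card_le_biUnion (Finset.univ : Finset (Fin n))
    (fun r => Finset.univ.filter fun c => M r c ≠ Entry.zero) (fun S _ => by
      refine (card_le_card_nbrs hc S).trans (Finset.card_le_card fun c hcS => ?_)
      simpa using mem_nbrs.1 hcS)
  exact ⟨ρ, by simpa using hρ, fun r => by simpa using hρe r (Finset.mem_univ _)⟩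

/-- Injectivity bounds the size of a set of rows by the number of its neighbours. -/
theorem card_le_card_nbrs_erase {S : Finset (Fin n)} {f : Fin n → Fin n ⊕ Fin m}
    (hf : Set.InjOn f S) (hfM : ∀ r ∈ S, M r (f r) ≠ Entry.zero ∧ f r ≠ j) :
    S.card ≤ ((nbrs M S).erase j).card :=
  Finset.card_le_card_of_injOn f (fun r hr =>
    Finset.mem_erase.2 ⟨(hfM r hr).2, mem_nbrs.2 ⟨r, hr, (hfM r hr).1⟩⟩) hf

/-- Controllability gives a matching of all `n` rows, so deleting one row and one column leaves a
maximum matching of size `n - 1` or `n - 2`. The larger size is Hall's condition for the remaining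
rows. -/
theorem mt_ne_iff (hc : RealizesControllable M z) :
    (((((bip M).deleteRow a).deleteCol j).mt : ℤ) ≠ (n : ℤ) - 2) ↔
      ∀ S : Finset (Fin n), a ∉ S → S.card ≤ ((nbrs M S).erase j).card := by
  have hn : 0 < n := a.pos
  have hrows : (((bip M).deleteRow a).deleteCol j).rows.card = n - 1 := by
    rw [bip_delete_rows, Finset.card_erase_of_mem (Finset.mem_univ _)]
    simp
  constructor
  · intro hmt S haS
    obtain ⟨ρ, hρ, hρM⟩ := exists_injective_of_controllable hc j
    set P : Finset (Fin n) := (Finset.univ.erase a).filter fun r => ρ r ≠ j with hP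
    have hPm : (((bip M).deleteRow a).deleteCol j).IsMatching (graphOn ρ P) :=
      isMatching_graphOn hρ.injOn fun r hr => by
        obtain ⟨h1, h2⟩ := Finset.mem_filter.1 hr
        exact bip_delete_edges.2 ⟨hρM r, Finset.ne_of_mem_erase h1, h2⟩
    have hPc : n - 2 ≤ P.card := by
      have h1 : ((Finset.univ.erase a) \ P).card ≤ 1 := by
        refine Finset.card_le_one.2 fun x hx y hy => hρ ?_
        have hval : ∀ x ∈ (Finset.univ.erase a) \ P, ρ x = j := by
          intro x hx
          obtain ⟨hx1, hx2⟩ := Finset.mem_sdiff.1 hx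
          by_contra h
          exact hx2 (Finset.mem_filter.2 ⟨hx1, h⟩)
        rw [hval x hx, hval y hy]
      have h2 := Finset.card_sdiff_add_card_eq_card (Finset.filter_subset (fun r => ρ r ≠ j)
        (Finset.univ.erase a))
      rw [Finset.card_erase_of_mem (Finset.mem_univ _), Finset.card_univ, Fintype.card_fin,
        ← hP] at h2
      omega
    have hle := hPm.card_le_mt
    rw [card_graphOn] at hle
    obtain ⟨N, hN, hNc⟩ := (((bip M).deleteRow a).deleteCol j).exists_isMatching_card_eq_mt
    have hNr : (((bip M).deleteRow a).deleteCol j).rows.card ≤ N.card := by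
      rw [hrows, hNc]
      omega
    have hex : ∀ r, ∃ c, r ∈ S → (r, c) ∈ N := by
      intro r
      by_cases hr : r ∈ S
      · obtain ⟨c, hc⟩ := hN.exists_of_card_rows_le hNr (r := r) (by
          rw [bip_delete_rows, Finset.mem_erase]
          refine ⟨?_, Finset.mem_univ _⟩
          rintro rfl
          exact haS hr)
        exact ⟨c, fun _ => hc⟩
      · exact ⟨j, fun h => absurd h hr⟩
    choose f hf using hex
    refine card_le_card_nbrs_erase (f := f) (fun x hx y hy hxy => ?_) fun r hr => ?_
    · exact (Prod.ext_iff.1 (hN.injOn_snd (hf x hx) (hf y hy) hxy)).1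
    · have := bip_delete_edges.1 (hN.1 (hf r hr))
      exact ⟨this.1, this.2.2⟩
  · intro hS
    have : Nonempty (Fin n ⊕ Fin m) := ⟨j⟩
    obtain ⟨f, hf, hfM⟩ := exists_injOn_of_card_le_biUnion (Finset.univ.erase a)
      (fun r => Finset.univ.filter fun c => M r c ≠ Entry.zero ∧ c ≠ j) (fun S hSa => by
        refine (hS S fun h => by simpa using hSa h).trans (Finset.card_le_card fun c hcS => ?_)
        obtain ⟨hcj, hcS⟩ := Finset.mem_erase.1 hcS
        obtain ⟨r, hr, hrc⟩ := mem_nbrs.1 hcS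
        simp only [Finset.mem_biUnion, Finset.mem_filter, Finset.mem_univ, true_and]
        exact ⟨r, hr, hrc, hcj⟩)
    have hm : (((bip M).deleteRow a).deleteCol j).IsMatching (graphOn f (Finset.univ.erase a)) :=
      isMatching_graphOn hf fun r hr => by
        have := hfM r hr
        simp only [Finset.mem_filter, Finset.mem_univ, true_and] at this
        exact bip_delete_edges.2 ⟨this.1, Finset.ne_of_mem_erase hr, this.2⟩
    have hle := hm.card_le_mt
    rw [card_graphOn, Finset.card_erase_of_mem (Finset.mem_univ _), Finset.card_univ,
      Fintype.card_fin] at hle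
    omega

/-- Maximum matchings saturate all rows, so b1) is Hall's condition after the removal of column `j`.
-/
theorem condB1_iff (hc : RealizesControllable M z) :
    CondB1 M j ↔ ∀ S : Finset (Fin n), S.card ≤ ((nbrs M S).erase j).card := by
  obtain ⟨ρ, hρ, hρM⟩ := exists_injective_of_controllable hc j
  have hrows : (bip M).rows = Finset.univ := rfl
  have hmax : ∀ N, (bip M).IsMaxMatching N ↔ (bip M).IsMatching N ∧ (bip M).rows.card ≤ N.card :=
    fun N => isMaxMatching_iff_card (N := graphOn ρ Finset.univ)
      (isMatching_graphOn hρ.injOn fun r _ => mem_bip_edges.2 (hρM r)) (card_graphOn _ _)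
  constructor
  · rintro ⟨N, hN, hNj⟩ S
    obtain ⟨hN1, hN2⟩ := (hmax N).1 hN
    have hex : ∀ r, ∃ c, (r, c) ∈ N := fun r => hN1.exists_of_card_rows_le hN2 (by simp [hrows])
    choose f hf using hex
    refine card_le_card_nbrs_erase (f := f) (fun x _ y _ hxy => ?_) fun r _ => ?_
    · exact (Prod.ext_iff.1 (hN1.injOn_snd (hf x) (hf y) hxy)).1
    · exact ⟨mem_bip_edges.1 (hN1.1 (hf r)), hNj _ (hf r)⟩
  · intro hS
    have : Nonempty (Fin n ⊕ Fin m) := ⟨j⟩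
    obtain ⟨f, hf, hfM⟩ := exists_injOn_of_card_le_biUnion Finset.univ
      (fun r => Finset.univ.filter fun c => M r c ≠ Entry.zero ∧ c ≠ j) (fun S _ => by
        refine (hS S).trans (Finset.card_le_card fun c hcS => ?_)
        obtain ⟨hcj, hcS⟩ := Finset.mem_erase.1 hcS
        obtain ⟨r, hr, hrc⟩ := mem_nbrs.1 hcS
        simp only [Finset.mem_biUnion, Finset.mem_filter, Finset.mem_univ, true_and]
        exact ⟨r, hr, hrc, hcj⟩)
    have hfM' : ∀ r, M r (f r) ≠ Entry.zero ∧ f r ≠ j := fun r => by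
      simpa using hfM r (Finset.mem_univ _)
    refine ⟨graphOn f Finset.univ, (hmax _).2 ⟨isMatching_graphOn hf fun r _ =>
      mem_bip_edges.2 (hfM' r).1, (card_graphOn _ _).ge⟩, ?_⟩
    rintro ⟨r, c⟩ he
    obtain ⟨_, rfl⟩ := mem_graphOn.1 he
    exact (hfM' r).2

/-- A vector annihilated by the columns other than `j` for the eigenvalue `0` has a support with
fewer neighbours than elements. -/
theorem card_nbrs_erase_lt (hz : AlgebraicIndependent ℚ z) (hu : u ≠ 0)
    (hk : ∀ c, c ≠ j → Kills M z 0 u c) : ((nbrs M (supp u)).erase j).card < (supp u).card := by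
  -- The choice of `i` is immaterial, since columns other than `j` do not see the entry at `(i, j)`.
  -- The eigenvalue `0` is rational, hence `L = ∅`.
  obtain ⟨i, _⟩ := supp_nonempty hu
  have := card_add_one_le (M := M) (i := i) (j := j) (L := ∅) hz (zero_mem _) hu
    (C₀ := (nbrs M (supp u)).erase j)
    (fun c hc => (kills_update_iff_of_ne (Finset.ne_of_mem_erase hc)).2
      (hk c (Finset.ne_of_mem_erase hc)))
    (fun c hc => by
      obtain ⟨hcj, hc⟩ := Finset.mem_erase.1 hc
      obtain ⟨r, hr, hrc⟩ := mem_nbrs.1 hc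
      exact ⟨r, mem_supp.1 hr, hrc, fun h => hcj (Prod.ext_iff.1 h).2⟩)
  simpa using this

/-- If the realization is controllable, the vectors annihilated by the columns other than `j` form
a line, so that one with a nonzero entry at `a` forces the Hall condition for the rows without
`a`. -/
theorem card_le_of_kills (hc : RealizesControllable M z) (hu : ∀ c, c ≠ j → Kills M z 0 u c)
    (hua : u a ≠ 0) {S : Finset (Fin n)} (haS : a ∉ S) :
    S.card ≤ ((nbrs M S).erase j).card := by
  by_contra hlt
  obtain ⟨v, hv0, hvS, hv⟩ := exists_relation_of_card_lt (pencil M z 0) S ((nbrs M S).erase j)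
    (not_le.1 hlt)
  have hvk : ∀ c, c ≠ j → Kills M z 0 v c := by
    intro c hcj
    by_cases hcS : c ∈ nbrs M S
    · exact hv c (Finset.mem_erase.2 ⟨hcj, hcS⟩)
    · exact kills_zero_of_notMem_nbrs hvS hcS
  set α := ∑ r, v r * pencil M z 0 r j with hα
  set β := ∑ r, u r * pencil M z 0 r j with hβ
  -- This combination is also annihilated by column `j`, so it vanishes by controllability. Its
  -- entry at `a` is `α * u a`, which forces `α = 0`, and then `v` contradicts controllability.
  have hw : α • u - β • v = 0 := by
    refine realizesControllable_iff.1 hc 0 _ fun c => ?_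
    have h1 : ∑ r, (α • u - β • v) r * pencil M z 0 r c =
        α * ∑ r, u r * pencil M z 0 r c - β * ∑ r, v r * pencil M z 0 r c := by
      rw [Finset.mul_sum, Finset.mul_sum, ← Finset.sum_sub_distrib]
      refine Finset.sum_congr rfl fun r _ => ?_
      simp only [Pi.sub_apply, Pi.smul_apply, smul_eq_mul]
      ring
    rw [Kills, h1]
    by_cases hcj : c = j
    · subst hcj
      rw [← hα, ← hβ]
      ring
    · rw [hu c hcj, hvk c hcj]
      ring
  have hα0 : α = 0 := by
    have := congrFun hw a
    simp only [Pi.sub_apply, Pi.smul_apply, smul_eq_mul, hvS a haS, Pi.zero_apply] at this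
    rw [mul_zero, sub_zero] at this
    exact (mul_eq_zero.1 this).resolve_right hua
  refine hv0 (realizesControllable_iff.1 hc 0 v fun c => ?_)
  by_cases hcj : c = j
  · subst hcj
    exact hα0
  · exact hvk c hcj

/-- The conditions b1)-b3) say that no nonzero value of the entry at `(i, j)` creates the
uncontrollable eigenvalue `0`. -/
theorem condB_iff (hz : AlgebraicIndependent ℚ z) (hc : RealizesControllable M z)
    (hM : M i j ≠ Entry.zero) :
    (CondB1 M j ∨ CondB2 M i j ∨ CondB3 M i j) ↔
      ∀ t, t ≠ 0 → ∀ u, (∀ c, Kills M (Function.update z (i, j) t) 0 u c) → u = 0 := by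
  constructor
  · intro hB t ht u hu
    by_contra hu0
    have hku : ∀ c, c ≠ j → Kills M z 0 u c := fun c hcj => (kills_update_iff_of_ne hcj).1 (hu c)
    have hlt := card_nbrs_erase_lt hz hu0 hku
    have hui : u i ≠ 0 := by
      intro hui
      exact hu0 (realizesControllable_iff.1 hc 0 u fun c =>
        (kills_update_iff_of_apply_eq_zero hui).1 (hu c))
    -- Otherwise column `j` would contribute only `u i * t`, which is nonzero.
    have hl : ∃ l, l ≠ i ∧ u l ≠ 0 ∧ M l j ≠ Entry.zero := by
      by_contra hcon
      push Not at hcon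
      have h1 := hu j
      rw [Kills, Finset.sum_eq_single i (fun r _ hri => by
        by_cases hur : u r = 0
        · rw [hur, zero_mul]
        · simp [pencil, hcon r hri hur]) (fun h => absurd (Finset.mem_univ _) h)] at h1
      simp [pencil, hM, hui, ht] at h1
    obtain ⟨l, hli, hul, hMl⟩ := hl
    have hmt : ∀ a, u a ≠ 0 →
        ((((bip M).deleteRow a).deleteCol j).mt : ℤ) ≠ (n : ℤ) - 2 := fun a ha =>
      (mt_ne_iff hc).2 fun S hS => card_le_of_kills hc hku ha hS
    rcases hB with hB | (hB | hB) | hB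
    · exact absurd ((condB1_iff hc).1 hB (supp u)) (not_le.2 hlt)
    · have : l ∈ (bip M).colNbrs j := mem_bip_edges.2 hMl
      rw [hB] at this
      exact hli this
    · exact hmt l hul (hB l ⟨mem_bip_edges.2 hMl, hli⟩)
    · exact hmt i hui hB
  · intro hgood
    by_contra hB
    simp only [not_or, CondB2, CondB3] at hB
    obtain ⟨hB1, ⟨_, hB2⟩, hB3⟩ := hB
    rw [condB1_iff hc] at hB1
    push Not at hB1 hB2
    obtain ⟨S, hS⟩ := hB1
    obtain ⟨k, ⟨hkM, hki⟩, hk⟩ := hB2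
    obtain ⟨u, hu0, huS, hu⟩ := exists_relation_of_card_lt (pencil M z 0) S _ hS
    have hku : ∀ c, c ≠ j → Kills M z 0 u c := by
      intro c hcj
      by_cases hcS : c ∈ nbrs M S
      · exact hu c (Finset.mem_erase.2 ⟨hcj, hcS⟩)
      · exact kills_zero_of_notMem_nbrs huS hcS
    have hlt := card_nbrs_erase_lt hz hu0 hku
    -- The support violates Hall's condition without column `j`, hence it must contain every row
    -- whose deletion restores this condition. In particular it contains `i` and `k`.
    have hne : ∀ a, ((((bip M).deleteRow a).deleteCol j).mt : ℤ) ≠ (n : ℤ) - 2 → u a ≠ 0 := by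
      intro a ha hua
      exact absurd ((mt_ne_iff hc).1 ha (supp u) fun h => mem_supp.1 h hua) (not_le.2 hlt)
    obtain ⟨t, ht⟩ := exists_kills_update (z := z) (μ := 0) hM (hne i hB3)
    have hut : ∀ c, Kills M (Function.update z (i, j) t) 0 u c := by
      intro c
      by_cases hcj : c = j
      · subst hcj
        exact ht
      · exact (kills_update_iff_of_ne hcj).2 (hku c hcj)
    -- With `t = 0`, column `j` still has a pivot in row `k`. It would be one more annihilated
    -- column, and then the support would have more elements than neighbours.
    by_cases ht0 : t = 0
    · subst ht0
      have h1 := card_add_one_le (L := ∅) hz (zero_mem _) hu0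
        (C₀ := insert j ((nbrs M (supp u)).erase j)) (fun c _ => hut c) (fun c hc => by
          rcases Finset.mem_insert.1 hc with rfl | hc
          · exact ⟨k, hne k hk, mem_bip_edges.1 hkM, fun h => hki (Prod.ext_iff.1 h).1⟩
          · obtain ⟨hcj, hc⟩ := Finset.mem_erase.1 hc
            obtain ⟨r, hr, hrc⟩ := mem_nbrs.1 hc
            exact ⟨r, mem_supp.1 hr, hrc, fun h => hcj (Prod.ext_iff.1 h).2⟩)
      rw [Finset.card_insert_of_notMem (Finset.notMem_erase _ _), Finset.card_empty] at h1
      have h2 := card_le_card_nbrs hc (supp u)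
      have h3 := Finset.pred_card_le_card_erase (s := nbrs M (supp u)) (a := j)
      omega
    · exact hu0 (hgood t ht0 u hut)

end Zero

end Structured

namespace Structured

open BipGraph

/-! ## The determinant of a component of the pencil -/

section Block

variable {n m : ℕ} {M : Matrix (Fin n) (Fin n ⊕ Fin m) Entry} {z : Fin n × (Fin n ⊕ Fin m) → ℂ}
  {μ : ℂ} {j : Fin n ⊕ Fin m} {σ : Fin n → Fin n ⊕ Fin m} {X : Finset (Fin n)}

/-- The transpose of the submatrix of the pencil with rows `X` and columns `σ(X)`. -/
def block (M : Matrix (Fin n) (Fin n ⊕ Fin m) Entry) (σ : Fin n → Fin n ⊕ Fin m)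
    (X : Finset (Fin n)) (z : Fin n × (Fin n ⊕ Fin m) → ℂ) (μ : ℂ) : Matrix X X ℂ :=
  Matrix.of fun s r => pencil M z μ r (σ s)

theorem det_block_eq_zero_iff : (block M σ X z μ).det = 0 ↔
    ∃ u : Fin n → ℂ, u ≠ 0 ∧ (∀ r, r ∉ X → u r = 0) ∧ ∀ s ∈ X, Kills M z μ u (σ s) := by
  have hkey : ∀ u : Fin n → ℂ, (∀ r, r ∉ X → u r = 0) → ∀ s : X,
      (Kills M z μ u (σ s) ↔ (block M σ X z μ).mulVec (fun r => u r) s = 0) := by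
    intro u hu s
    rw [Kills, ← Finset.sum_subset (Finset.subset_univ X) (fun r _ hr => by
      rw [hu r hr, zero_mul]), ← Finset.sum_coe_sort]
    simp [Matrix.mulVec, dotProduct, block, mul_comm]
  rw [← Matrix.exists_mulVec_eq_zero_iff]
  constructor
  · rintro ⟨v, hv, hv0⟩
    refine ⟨fun r => if hr : r ∈ X then v ⟨r, hr⟩ else 0, ?_, fun r hr => by simp [hr], ?_⟩
    · intro h0
      apply hv
      ext ⟨r, hr⟩
      simpa [hr] using congrFun h0 r
    · intro s hs
      rw [hkey _ (fun r hr => by simp [hr]) ⟨s, hs⟩]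
      simpa using congrFun hv0 ⟨s, hs⟩
  · rintro ⟨u, hu0, huX, hu⟩
    refine ⟨fun r => u r, ?_, ?_⟩
    · intro h0
      apply hu0
      funext r
      by_cases hr : r ∈ X
      · exact congrFun h0 ⟨r, hr⟩
      · exact huX r hr
    · funext s
      exact (hkey u huX s).1 (hu s s.2)

/-- A permutation of `X` corresponds to a perfect matching of the component. -/
def Admissible (M : Matrix (Fin n) (Fin n ⊕ Fin m) Entry) (σ : Fin n → Fin n ⊕ Fin m)
    {X : Finset (Fin n)} (τ : Equiv.Perm X) : Prop :=
  ∀ r : X, σ (τ r) = Sum.inl r.1 ∨ M r (σ (τ r)) ≠ Entry.zero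

/-- The rows that are matched by a `λ`-edge. -/
def lambdaRows (σ : Fin n → Fin n ⊕ Fin m) {X : Finset (Fin n)} (τ : Equiv.Perm X) : Finset X :=
  Finset.univ.filter fun r => σ (τ r) = Sum.inl r.1

theorem mem_lambdaRows {τ : Equiv.Perm X} {r : X} :
    r ∈ lambdaRows σ τ ↔ σ (τ r) = Sum.inl r.1 := by simp [lambdaRows]

theorem exists_perm_of_injective {f : X → Fin n ⊕ Fin m} (hf : Function.Injective f)
    (hfX : ∀ r, f r ∈ X.image σ) : ∃ τ : Equiv.Perm X, ∀ r, σ (τ r) = f r := by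
  have hex : ∀ r, ∃ s : X, σ s = f r := by
    intro r
    obtain ⟨s, hs, h⟩ := Finset.mem_image.1 (hfX r)
    exact ⟨⟨s, hs⟩, h⟩
  choose g hg using hex
  have hginj : Function.Injective g := fun r s hrs => hf (by rw [← hg, ← hg, hrs])
  exact ⟨Equiv.ofBijective g (Finite.injective_iff_bijective.1 hginj), hg⟩

section Matching

variable (h : (bipPencilMinor M j).IsPerfect σ) (a : Fin n)

include h

theorem mem_scc_edges_iff {r s : Fin n} (hr : r ∈ (bipPencilMinor M j).sccRows σ a)
    (hs : s ∈ (bipPencilMinor M j).sccRows σ a) :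
    (r, σ s) ∈ ((bipPencilMinor M j).scc σ a).edges ↔
      σ s = Sum.inl r ∨ M r (σ s) ≠ Entry.zero := by
  rw [mem_scc_edges, mem_bipPencilMinor_edges]
  have := mem_bipPencilMinor_cols.1 (h.mem_cols s)
  have := Finset.mem_image_of_mem σ hs
  tauto

/-- A permutation `τ` encodes the matching `r ↦ σ (τ r)` of the component, so that maximum matchings
index the nonzero terms of the Leibniz formula. -/
theorem exists_isMaxMatching_of_admissible
    {τ : Equiv.Perm ((bipPencilMinor M j).sccRows σ a)} (hτ : Admissible M σ τ) :
    ∃ N, ((bipPencilMinor M j).scc σ a).IsMaxMatching N ∧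
      (N ∩ lambdaEdges n m).card = (lambdaRows σ τ).card := by
  have hmatch := h.scc_matchedBy a
  have hinj : Function.Injective fun r : (bipPencilMinor M j).sccRows σ a => (r.1, σ (τ r)) := fun r s hrs =>
    Subtype.ext (Prod.ext_iff.1 hrs).1
  refine ⟨Finset.univ.image fun r : (bipPencilMinor M j).sccRows σ a => (r.1, σ (τ r)), ?_, ?_⟩
  · rw [isMaxMatching_iff_card (isMatching_graphOn h.injective.injOn hmatch.mem)
      (card_graphOn _ _)]
    refine ⟨⟨fun e he => ?_, fun e he e' he' hne => ?_⟩, ?_⟩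
    · obtain ⟨r, _, rfl⟩ := Finset.mem_image.1 he
      exact (mem_scc_edges_iff h a r.2 (τ r).2).2 (hτ r)
    · obtain ⟨r, _, rfl⟩ := Finset.mem_image.1 he
      obtain ⟨s, _, rfl⟩ := Finset.mem_image.1 he'
      have hrs : r ≠ s := by
        rintro rfl
        exact hne rfl
      exact ⟨fun h0 => hrs (Subtype.ext h0),
        fun h0 => hrs (τ.injective (Subtype.ext (h.injective h0)))⟩
    · rw [Finset.card_image_of_injective _ hinj, h.scc_rows]
      simp
  · rw [← Finset.card_image_of_injective (lambdaRows σ τ) hinj]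
    congr 1
    ext ⟨r, c⟩
    simp only [Finset.mem_inter, Finset.mem_image, Finset.mem_univ, true_and, mem_lambdaRows,
      mem_lambdaEdges, Prod.mk.injEq]
    constructor
    · rintro ⟨⟨s, rfl, rfl⟩, hl⟩
      exact ⟨s, hl, rfl, rfl⟩
    · rintro ⟨s, hl, rfl, rfl⟩
      exact ⟨⟨s, rfl, rfl⟩, hl⟩

theorem exists_admissible_of_isMaxMatching {N : Finset (Fin n × (Fin n ⊕ Fin m))}
    (hN : ((bipPencilMinor M j).scc σ a).IsMaxMatching N) :
    ∃ τ : Equiv.Perm ((bipPencilMinor M j).sccRows σ a), Admissible M σ τ ∧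
      (N ∩ lambdaEdges n m).card = (lambdaRows σ τ).card := by
  set X := (bipPencilMinor M j).sccRows σ a with hX
  have hmatch := h.scc_matchedBy a
  obtain ⟨hN1, hN2⟩ := (isMaxMatching_iff_card
    (isMatching_graphOn h.injective.injOn hmatch.mem) (card_graphOn _ _)).1 hN
  have hex : ∀ r : X, ∃ c, (r.1, c) ∈ N := fun r =>
    hN1.exists_of_card_rows_le hN2 (by
      rw [h.scc_rows]
      exact r.2)
  choose f hf using hex
  obtain ⟨τ, hτ⟩ := exists_perm_of_injective (σ := σ) (f := f) (fun r s hrs =>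
    Subtype.ext (Prod.ext_iff.1 (hN1.injOn_snd (hf r) (hf s) hrs)).1)
    (fun r => (mem_scc_edges.1 (hN1.1 (hf r))).2.2)
  refine ⟨τ, fun r => ?_, ?_⟩
  · rw [← mem_scc_edges_iff h a r.2 (τ r).2, hτ]
    exact hN1.1 (hf r)
  · have hinj : Function.Injective fun r : X => (r.1, σ (τ r)) := fun r s hrs =>
      Subtype.ext (Prod.ext_iff.1 hrs).1
    rw [← Finset.card_image_of_injective (lambdaRows σ τ) hinj]
    congr 1
    ext ⟨r, c⟩
    simp only [Finset.mem_inter, Finset.mem_image, mem_lambdaRows, mem_lambdaEdges, Prod.mk.injEq]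
    constructor
    · rintro ⟨hrc, rfl⟩
      have hrX : r ∈ X := (mem_scc_edges.1 (hN1.1 hrc)).2.1
      have : f ⟨r, hrX⟩ = Sum.inl r :=
        (Prod.ext_iff.1 (hN1.injOn_fst (hf ⟨r, hrX⟩) hrc rfl)).2
      exact ⟨⟨r, hrX⟩, by rw [hτ, this], rfl, by rw [hτ, this]⟩
    · rintro ⟨s, hl, rfl, rfl⟩
      exact ⟨by
        rw [hτ]
        exact hf s, hl⟩

/-- `γ_nz` of a component in terms of permutations. -/
theorem gammaNZ_iff : GammaNZ M ((bipPencilMinor M j).scc σ a) ↔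
    (∃ τ₁ τ₂ : Equiv.Perm ((bipPencilMinor M j).sccRows σ a), Admissible M σ τ₁ ∧
      Admissible M σ τ₂ ∧ (lambdaRows σ τ₁).card ≠ (lambdaRows σ τ₂).card) ∨
    ∃ τ : Equiv.Perm ((bipPencilMinor M j).sccRows σ a), Admissible M σ τ ∧
      ∃ r ∈ lambdaRows σ τ, M r (Sum.inl r) ≠ Entry.zero := by
  set K := (bipPencilMinor M j).scc σ a with hK
  set T := {k | ∃ N, K.IsMaxMatching N ∧ (N ∩ lambdaEdges n m).card = k} with hT
  have hTbdd : BddAbove T := by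
    refine ⟨K.edges.card, ?_⟩
    rintro k ⟨N, hN, rfl⟩
    exact Finset.card_le_card (Finset.inter_subset_left.trans hN.1.1)
  have hTne : T.Nonempty := by
    obtain ⟨N, hN, _⟩ := exists_isMaxMatching_of_admissible h a (τ := 1) (fun r =>
      (mem_scc_edges_iff h a r.2 r.2).1 ((h.scc_matchedBy a).mem r (by
        rw [h.scc_rows]
        exact r.2)))
    exact ⟨_, N, hN, rfl⟩
  rw [GammaNZ]
  refine or_congr ?_ ?_
  · constructor
    · intro hlt
      obtain ⟨N₁, hN₁, h1⟩ := Nat.sInf_mem hTne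
      obtain ⟨N₂, hN₂, h2⟩ := Nat.sSup_mem hTne hTbdd
      obtain ⟨τ₁, hτ₁, h1'⟩ := exists_admissible_of_isMaxMatching h a hN₁
      obtain ⟨τ₂, hτ₂, h2'⟩ := exists_admissible_of_isMaxMatching h a hN₂
      refine ⟨τ₁, τ₂, hτ₁, hτ₂, ?_⟩
      rw [← h1', ← h2', h1, h2]
      exact hlt.ne
    · rintro ⟨τ₁, τ₂, hτ₁, hτ₂, hne⟩
      obtain ⟨N₁, hN₁, h1⟩ := exists_isMaxMatching_of_admissible h a hτ₁
      obtain ⟨N₂, hN₂, h2⟩ := exists_isMaxMatching_of_admissible h a hτ₂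
      have m1 : (lambdaRows σ τ₁).card ∈ T := ⟨N₁, hN₁, h1⟩
      have m2 : (lambdaRows σ τ₂).card ∈ T := ⟨N₂, hN₂, h2⟩
      have a1 := Nat.sInf_le m1
      have a2 := Nat.sInf_le m2
      have b1 := le_csSup hTbdd m1
      have b2 := le_csSup hTbdd m2
      change sInf T < sSup T
      omega
  · constructor
    · rintro ⟨⟨r, c⟩, heK, hel, heM⟩
      obtain rfl := mem_lambdaEdges.1 hel
      obtain ⟨heG, hrX, hcX⟩ := mem_scc_edges.1 heK
      obtain ⟨s, hsX, hs⟩ := Finset.mem_image.1 hcX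
      simp only at hs hrX
      -- A self-loop within a component lies on a cycle, hence in a perfect matching `ρ`. This
      -- matching preserves the component and restricts to a permutation.
      have hsr : (bipPencilMinor M j).Reach σ s r :=
        (mem_sccRows.1 hsX).2.trans (mem_sccRows.1 hrX).1
      obtain ⟨ρ, hρ, hρr⟩ := h.exists_isPerfect_apply_eq hsr (by
        rw [hs]
        exact heG)
      have hρX : ∀ x : (bipPencilMinor M j).sccRows σ a,
          ρ x ∈ ((bipPencilMinor M j).sccRows σ a).image σ := by
        intro x
        obtain ⟨y, hy⟩ := h.surj _ (hρ.mem_cols x.1)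
        have hx := mem_sccRows.1 x.2
        refine Finset.mem_image.2 ⟨y, mem_sccRows.2 ⟨hx.1.tail ?_,
          (h.reach_of_apply_eq hρ hy.symm).trans hx.2⟩, hy⟩
        rw [Step, hy]
        exact hρ.mem x
      obtain ⟨τ, hτ⟩ := exists_perm_of_injective (σ := σ)
        (f := fun x : (bipPencilMinor M j).sccRows σ a => ρ x)
        (fun x y hxy => Subtype.ext (hρ.injective hxy)) hρX
      refine ⟨τ, fun x => ?_, ⟨r, hrX⟩, ?_, mem_bip_edges.1 heM⟩
      · rw [hτ]
        exact (mem_bipPencilMinor_edges.1 (hρ.mem x)).1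
      · rw [mem_lambdaRows, hτ]
        exact hρr.trans hs
    · rintro ⟨τ, hτ, r, hr, hrM⟩
      rw [mem_lambdaRows] at hr
      refine ⟨(r, Sum.inl r), ?_, mem_lambdaEdges.2 rfl, mem_bip_edges.2 hrM⟩
      rw [← hr]
      exact (mem_scc_edges_iff h a r.2 (τ r).2).2 (Or.inl hr)

end Matching

/-- If all perfect matchings have the same number `k` of `λ`-edges and there is no self-loop, then
the determinant of the component is a multiple of `μ ^ k`. -/
theorem det_block_eq_pow_mul (k : ℕ)
    (hk : ∀ τ : Equiv.Perm X, Admissible M σ τ → (lambdaRows σ τ).card = k)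
    (hloop : ∀ τ : Equiv.Perm X, Admissible M σ τ → ∀ r ∈ lambdaRows σ τ,
      M r (Sum.inl r) = Entry.zero) :
    (block M σ X z μ).det = μ ^ k * (block M σ X z 1).det := by
  rw [Matrix.det_apply, Matrix.det_apply, Finset.mul_sum]
  refine Finset.sum_congr rfl fun τ _ => ?_
  rw [mul_smul_comm]
  congr 1
  by_cases hτ : Admissible M σ τ
  · have h1 : ∀ r : X, block M σ X z μ (τ r) r =
        (if r ∈ lambdaRows σ τ then μ else 1) * block M σ X z 1 (τ r) r := by
      intro r
      by_cases hr : r ∈ lambdaRows σ τ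
      · have h0 := hloop τ hτ r hr
        rw [if_pos hr]
        rw [mem_lambdaRows] at hr
        simp [block, pencil, hr, h0]
      · rw [if_neg hr]
        rw [mem_lambdaRows] at hr
        simp [block, pencil, hr]
    simp_rw [h1]
    rw [Finset.prod_mul_distrib, Finset.prod_ite, Finset.prod_const, Finset.prod_const_one, mul_one]
    congr 2
    rw [← hk τ hτ]
    congr 1
    ext r
    simp
  · rw [Admissible] at hτ
    push Not at hτ
    obtain ⟨r, hr1, hr2⟩ := hτ
    have h1 : ∀ ν, block M σ X z ν (τ r) r = 0 := by
      intro ν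
      simp [block, pencil, hr1, hr2]
    have hp : ∀ ν, ∏ r, block M σ X z ν (τ r) r = 0 := fun ν =>
      Finset.prod_eq_zero (Finset.mem_univ r) (h1 ν)
    rw [hp, hp, mul_zero]

/-- Without nonzero roots the determinant is a monomial in `μ`, so its values at `2` and `1` have
ratio `2 ^ k` at `z`. This is a polynomial relation over `ℚ` and extends from the generic point to
all parameters. -/
theorem exists_det_block_ratio (hz : AlgebraicIndependent ℚ z)
    (hroot : ∀ μ, μ ≠ 0 → (block M σ X z μ).det ≠ 0) :
    ∃ k : ℕ, ∀ w : Fin n × (Fin n ⊕ Fin m) → ℂ,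
      (block M σ X w 2).det = 2 ^ k * (block M σ X w 1).det := by
  set φ : Polynomial ℂ := Matrix.det (Matrix.of fun s r : X =>
    Polynomial.C (if M r (σ s) = Entry.zero then 0 else z (r, σ s)) -
      if σ s = Sum.inl r.1 then Polynomial.X else 0) with hφ
  have hev : ∀ μ, φ.eval μ = (block M σ X z μ).det := by
    intro μ
    rw [hφ, ← Polynomial.coe_evalRingHom, RingHom.map_det]
    congr 1
    ext s r
    simp only [RingHom.mapMatrix_apply, Matrix.map_apply, Matrix.of_apply, block, pencil,
      Polynomial.coe_evalRingHom, Polynomial.eval_sub, Polynomial.eval_C]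
    congr 1
    split_ifs <;> simp
  obtain ⟨c, k, hck⟩ := φ.exists_eq_C_mul_X_pow fun t ht => by
    rw [hev]
    exact hroot t ht
  refine ⟨k, ?_⟩
  set Q : ℚ → MvPolynomial (Fin n × (Fin n ⊕ Fin m)) ℚ := fun μ => Matrix.det (Matrix.of fun s r : X =>
    (if M r (σ s) = Entry.zero then 0 else MvPolynomial.X ((r : Fin n), σ s)) -
      if σ s = Sum.inl r.1 then MvPolynomial.C μ else 0) with hQ
  have hQev : ∀ (μ : ℚ) w, MvPolynomial.aeval w (Q μ) = (block M σ X w (μ : ℂ)).det := by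
    intro μ w
    rw [hQ]
    simp only
    rw [AlgHom.map_det]
    congr 1
    ext s r
    simp only [AlgHom.mapMatrix_apply, Matrix.map_apply, Matrix.of_apply, block, pencil, map_sub]
    congr 1 <;> split_ifs <;> simp
  have hzero : Q 2 - MvPolynomial.C (2 ^ k) * Q 1 = 0 := by
    apply hz.eq_zero_of_aeval_eq_zero
    rw [map_sub, map_mul, hQev, hQev, Rat.cast_one, Rat.cast_ofNat, ← hev, ← hev, hck]
    simp
    ring
  intro w
  have := congrArg (MvPolynomial.aeval w) hzero
  rw [map_sub, map_mul, hQev, hQev, Rat.cast_one, Rat.cast_ofNat, map_zero, sub_eq_zero] at this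
  simpa using this

/-- Isolating the terms of a single perfect matching in an identity between determinants. -/
theorem prod_lambdaRows_ratio {k : ℕ} (hσ : Function.Injective σ)
    (hid : ∀ w : Fin n × (Fin n ⊕ Fin m) → ℂ,
      (block M σ X w 2).det = 2 ^ k * (block M σ X w 1).det)
    {τ : Equiv.Perm X} (hτ : Admissible M σ τ) (y : X → ℂ)
    (hy : ∀ r : X, M r (Sum.inl r.1) = Entry.zero → y r = 0) :
    ∏ r ∈ lambdaRows σ τ, (y r - 2) = 2 ^ k * ∏ r ∈ lambdaRows σ τ, (y r - 1) := by
  -- The parameters are supported on the matching `τ`, with value `y` on `λ`-edges and `ε⁻¹` on the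
  -- others. `B` is the block after multiplying the columns of the latter by `ε`. As `ε → 0`, all
  -- terms of the determinant except that of `τ` disappear.
  set B : ℂ → ℂ → Matrix X X ℂ := fun ε μ => Matrix.of fun s r =>
    if r ∈ lambdaRows σ τ then (if s = τ r then y r - μ else 0)
    else (if s = τ r then 1 else 0) - ε * if σ s = Sum.inl r.1 then μ else 0 with hB
  have hcont : ∀ μ, Continuous fun ε => (B ε μ).det := by
    intro μ
    refine Continuous.matrix_det (continuous_matrix fun s r => ?_)
    simp only [hB, Matrix.of_apply]
    split_ifs <;> fun_prop
  have hne : ∀ ε : ℂ, ε ≠ 0 → (B ε 2).det = 2 ^ k * (B ε 1).det := by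
    intro ε hε
    set w : Fin n × (Fin n ⊕ Fin m) → ℂ := fun x => if hx : x.1 ∈ X then
      (if x.2 = σ (τ ⟨x.1, hx⟩) then
        (if (⟨x.1, hx⟩ : X) ∈ lambdaRows σ τ then y ⟨x.1, hx⟩ else ε⁻¹) else 0) else 0 with hw
    have hwB : ∀ μ, block M σ X w μ =
        B ε μ * Matrix.diagonal fun r => if r ∈ lambdaRows σ τ then 1 else ε⁻¹ := by
      intro μ
      ext s r
      have hwv : w (r, σ s) = if s = τ r then (if r ∈ lambdaRows σ τ then y r else ε⁻¹) else 0 := by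
        simp only [hw, r.2, dite_true, Subtype.coe_eta]
        congr 1
        rw [eq_iff_iff, hσ.eq_iff, Subtype.ext_iff]
      rw [Matrix.mul_diagonal]
      simp only [block, hB, Matrix.of_apply, pencil, hwv]
      by_cases hr : r ∈ lambdaRows σ τ
      · have hrl := mem_lambdaRows.1 hr
        by_cases hs : s = τ r
        · subst hs
          simp only [hr, if_true, hrl, mul_one]
          congr 1
          split_ifs with h0
          · rw [hy r h0]
          · rfl
        · have : σ s ≠ Sum.inl r.1 := fun h0 => hs (Subtype.ext (hσ (h0.trans hrl.symm)))
          simp [hr, hs, this]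
      · have hrl : σ (τ r) ≠ Sum.inl r.1 := fun h0 => hr (mem_lambdaRows.2 h0)
        by_cases hs : s = τ r
        · subst hs
          simp [hr, hrl, (hτ r).resolve_left hrl]
        · simp only [hr, hs, if_false]
          split_ifs <;> field_simp <;> ring
    have := hid w
    rw [hwB, hwB, Matrix.det_mul, Matrix.det_mul, ← mul_assoc] at this
    refine mul_right_cancel₀ ?_ this
    rw [Matrix.det_diagonal, Finset.prod_ne_zero_iff]
    intro r _
    split_ifs
    · exact one_ne_zero
    · exact inv_ne_zero hε
  -- The identity holds on the dense set `ε ≠ 0`, and continuity carries it to `ε = 0`.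
  have hall : (fun ε => (B ε 2).det) = fun ε => 2 ^ k * (B ε 1).det :=
    Continuous.ext_on (dense_compl_singleton (0 : ℂ)) (hcont 2) (continuous_const.mul (hcont 1))
      fun ε hε => hne ε hε
  have hdet : ∀ μ, (B 0 μ).det =
      ((Equiv.Perm.sign τ⁻¹ : ℤ) : ℂ) * ∏ r ∈ lambdaRows σ τ, (y r - μ) := by
    intro μ
    have : B 0 μ = (τ⁻¹.permMatrix ℂ) *
        Matrix.diagonal fun r => if r ∈ lambdaRows σ τ then y r - μ else 1 := by
      ext s r
      rw [Matrix.mul_diagonal, Equiv.Perm.permMatrix, PEquiv.toMatrix_apply]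
      have : (r ∈ (Equiv.toPEquiv τ⁻¹) s) ↔ s = τ r := by
        rw [Equiv.toPEquiv_apply, Option.mem_some_iff, Equiv.Perm.inv_eq_iff_eq]
      simp only [hB, Matrix.of_apply, this]
      split_ifs <;> simp
    rw [this, Matrix.det_mul, Matrix.det_diagonal, Matrix.det_permutation, Finset.prod_ite,
      Finset.prod_const_one, mul_one, Finset.filter_mem_eq_inter, Finset.univ_inter]
  have := congrFun hall 0
  simp only [hdet] at this
  rw [mul_left_comm] at this
  refine mul_left_cancel₀ ?_ this
  simp

/-- A component with `γ_nz = 1` has a generic nonzero eigenvalue. -/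
theorem exists_det_block_eq_zero (h : (bipPencilMinor M j).IsPerfect σ)
    (hz : AlgebraicIndependent ℚ z) {a : Fin n}
    (hnz : GammaNZ M ((bipPencilMinor M j).scc σ a)) :
    ∃ μ, μ ≠ 0 ∧ (block M σ ((bipPencilMinor M j).sccRows σ a) z μ).det = 0 := by
  by_contra hcon
  push Not at hcon
  obtain ⟨k, hk⟩ := exists_det_block_ratio hz hcon
  rcases (gammaNZ_iff h a).1 hnz with ⟨τ₁, τ₂, h1, h2, hne⟩ | ⟨τ, hτ, r, hr, hrM⟩
  · have key : ∀ τ : Equiv.Perm ((bipPencilMinor M j).sccRows σ a), Admissible M σ τ →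
        (lambdaRows σ τ).card = k := by
      intro τ hτ
      -- For `y = 0`, absolute values in the identity give `2 ^ #λ = 2 ^ k`, where `#λ` is the
      -- number of `λ`-edges. So this number cannot vary.
      have := prod_lambdaRows_ratio h.injective hk hτ 0 fun _ _ => rfl
      simp only [Pi.zero_apply, zero_sub, Finset.prod_const] at this
      have h3 := congrArg (fun x : ℂ => ‖x‖) this
      simp only [norm_mul, norm_pow, norm_neg, norm_one, one_pow, mul_one, RCLike.norm_ofNat] at h3
      exact pow_right_injective₀ (by norm_num) (by norm_num) h3
    exact hne ((key τ₁ h1).trans (key τ₂ h2).symm)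
  -- The value `1` on the self-loop makes the side for `μ = 1` vanish, while all factors `1 - 2` and
  -- `0 - 2` on the side for `μ = 2` are nonzero.
  · have := prod_lambdaRows_ratio h.injective hk hτ (fun s => if s = r then 1 else 0) (fun s hs => by
      rw [if_neg]
      rintro rfl
      exact hrM hs)
    have h0 : ∏ s ∈ lambdaRows σ τ, ((if s = r then 1 else 0) - 1 : ℂ) = 0 :=
      Finset.prod_eq_zero hr (by simp)
    rw [h0, mul_zero, Finset.prod_eq_zero_iff] at this
    obtain ⟨s, _, hs⟩ := this
    split_ifs at hs <;> norm_num at hs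

end Block

end Structured

namespace Structured

open BipGraph

/-! ## Nonzero uncontrollable eigenvalues -/

section NonzeroEigenvalue

variable {n m : ℕ} {M : Matrix (Fin n) (Fin n ⊕ Fin m) Entry} {z : Fin n × (Fin n ⊕ Fin m) → ℂ}
  {μ : ℂ} {u v : Fin n → ℂ} {i : Fin n} {j : Fin n ⊕ Fin m} {σ : Fin n → Fin n ⊕ Fin m}

theorem pencil_eq_zero_of_notMem {r : Fin n} {c : Fin n ⊕ Fin m} (hc : c ≠ j)
    (hrc : (r, c) ∉ (bipPencilMinor M j).edges) : pencil M z μ r c = 0 := by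
  rw [mem_bipPencilMinor_edges] at hrc
  have h1 : c ≠ Sum.inl r := fun h => hrc ⟨Or.inl h, hc⟩
  have h2 : M r c = Entry.zero := by
    by_contra h
    exact hrc ⟨Or.inr h, hc⟩
  simp [pencil, h1, h2]

theorem hasPivot_of_mem_edges (hμ : μ ≠ 0) {s : Fin n} {c : Fin n ⊕ Fin m} (hs : u s ≠ 0)
    (hsc : (s, c) ∈ (bipPencilMinor M j).edges) (hk : Kills M z μ u c) : HasPivot M i j u c := by
  obtain ⟨h1, h2⟩ := mem_bipPencilMinor_edges.1 hsc
  exact Kills.hasPivot (z := z) hμ ((kills_update_iff_of_ne h2).2 hk) hs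
    (h1.imp_right fun h => ⟨h, fun h' => h2 (Prod.ext_iff.1 h').2⟩)

/-- Every element of a finite set is reached from a source component of the set. -/
theorem exists_source {S : Finset (Fin n)} {a : Fin n} (ha : a ∈ S) :
    ∃ r ∈ S, (bipPencilMinor M j).Reach σ r a ∧
      ∀ s ∈ S, (bipPencilMinor M j).Reach σ s r → (bipPencilMinor M j).Reach σ r s := by
  classical
  -- Among the rows of `S` that reach `a`, one that reaches the most rows lies in a source
  -- component.
  set f : Fin n → ℕ := fun r => (Finset.univ.filter fun s => (bipPencilMinor M j).Reach σ r s).card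
  obtain ⟨r, hr, hmax⟩ := (S.filter fun r => (bipPencilMinor M j).Reach σ r a).exists_max_image f
    ⟨a, by simpa using ⟨ha, Relation.ReflTransGen.refl⟩⟩
  obtain ⟨hrS, hra⟩ := Finset.mem_filter.1 hr
  refine ⟨r, hrS, hra, fun s hs hsr => ?_⟩
  have hsub : (Finset.univ.filter fun x => (bipPencilMinor M j).Reach σ r x) ⊆
      Finset.univ.filter fun x => (bipPencilMinor M j).Reach σ s x := fun x hx => by
    simp only [Finset.mem_filter, Finset.mem_univ, true_and] at hx ⊢
    exact hsr.trans hx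
  have heq := Finset.eq_of_subset_of_card_le hsub
    (hmax s (Finset.mem_filter.2 ⟨hs, hsr.trans hra⟩))
  have : s ∈ Finset.univ.filter fun x => (bipPencilMinor M j).Reach σ r x := by
    rw [heq]
    exact Finset.mem_filter.2 ⟨Finset.mem_univ _, Relation.ReflTransGen.refl⟩
  simpa using this

section

variable (h : (bipPencilMinor M j).IsPerfect σ)

include h

theorem matched_ne (s : Fin n) : σ s ≠ j := mem_bipPencilMinor_cols.1 (h.mem_cols s)

theorem exists_matched_eq {c : Fin n ⊕ Fin m} (hc : c ≠ j) : ∃ s, σ s = c :=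
  h.surj c (mem_bipPencilMinor_cols.2 hc)

theorem kills_matched_update_iff {t : ℂ} (s : Fin n) :
    Kills M (Function.update z (i, j) t) μ u (σ s) ↔ Kills M z μ u (σ s) :=
  kills_update_iff_of_ne (matched_ne h s)

theorem hasPivot_matched (hμ : μ ≠ 0) (hk : ∀ s ∈ supp u, Kills M z μ u (σ s)) :
    ∀ c ∈ (supp u).image σ, HasPivot M i j u c := by
  intro c hc
  obtain ⟨s, hs, rfl⟩ := Finset.mem_image.1 hc
  exact hasPivot_of_mem_edges hμ (mem_supp.1 hs) (h.mem s) (hk s hs)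

theorem kills_matched (hk : ∀ s ∈ supp u, Kills M z μ u (σ s)) :
    ∀ c ∈ (supp u).image σ, Kills M (Function.update z (i, j) 0) μ u c := by
  intro c hc
  obtain ⟨s, hs, rfl⟩ := Finset.mem_image.1 hc
  exact (kills_matched_update_iff h s).2 (hk s hs)

/-- Generically, a vector that is annihilated by the columns matched with its support is not
annihilated by a further column adjacent to its support. -/
theorem not_kills_of_notMem_image (hz : AlgebraicIndependent ℚ z) (hμ : μ ≠ 0)
    (hk : ∀ s ∈ supp u, Kills M z μ u (σ s)) {c : Fin n ⊕ Fin m} (hc : c ∉ (supp u).image σ)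
    {s : Fin n} (hs : u s ≠ 0) (hsc : c = Sum.inl s ∨ M s c ≠ Entry.zero ∧ (s, c) ≠ (i, j)) :
    ¬ Kills M (Function.update z (i, j) 0) μ u c := by
  intro hkc
  have hu : u ≠ 0 := by
    rintro rfl
    exact hs rfl
  -- The eigenvalue costs one parameter and the normalisation saves one, so no more than `#supp u`
  -- columns with a pivot can annihilate `u`. The columns matched with the support already exhaust
  -- this number.
  have := card_add_one_le (L := {μ}) (i := i) (j := j) (C₀ := insert c ((supp u).image σ)) hz
    (IntermediateField.subset_adjoin _ _ (by simp)) hu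
    ((Finset.forall_mem_insert _ _ _).2 ⟨hkc, kills_matched h hk⟩)
    ((Finset.forall_mem_insert _ _ _).2 ⟨hkc.hasPivot hμ hs hsc, hasPivot_matched h hμ hk⟩)
  rw [Finset.card_insert_of_notMem hc, Finset.card_image_of_injective _ h.injective,
    Finset.card_singleton] at this
  omega

/-- A step leaving the support would yield an annihilating column beyond those matched with the
support, which the parameter count excludes. -/
theorem stepClosed_supp (hz : AlgebraicIndependent ℚ z) (hμ : μ ≠ 0)
    (hk : ∀ c, c ≠ j → Kills M z μ u c) : (bipPencilMinor M j).StepClosed σ (supp u) := by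
  intro r hr s hrs
  by_contra hs
  have h2 := mem_bipPencilMinor_edges.1 hrs
  refine not_kills_of_notMem_image (i := r) h hz hμ (fun x _ => hk _ (matched_ne h x)) (c := σ s) ?_
    (mem_supp.1 hr) (h2.1.imp_right fun h' => ⟨h', fun h'' => h2.2 (Prod.ext_iff.1 h'').2⟩)
    ((kills_matched_update_iff h s).2 (hk _ h2.2))
  intro hmem
  obtain ⟨x, hx, hxs⟩ := Finset.mem_image.1 hmem
  exact hs (h.injective hxs ▸ hx)

/-- Generically, two disjoint blocks of the pencil have no common nonzero eigenvalue. -/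
theorem not_disjoint_supp (hz : AlgebraicIndependent ℚ z) (hμ : μ ≠ 0) (hu : u ≠ 0) (hv : v ≠ 0)
    (hku : ∀ s ∈ supp u, Kills M z μ u (σ s)) (hkv : ∀ s ∈ supp v, Kills M z μ v (σ s)) :
    ¬ Disjoint (supp u) (supp v) := by
  intro huv
  obtain ⟨i, _⟩ := supp_nonempty hu
  -- Two normalisations save two parameters, but the common eigenvalue adds only one.
  have := card_add_card_add_two_le (L := {μ}) (i := i) (j := j) hz
    (IntermediateField.subset_adjoin _ _ (by simp)) hu hv huv
    ((Finset.disjoint_image h.injective).2 huv) (kills_matched h hku) (kills_matched h hkv)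
    (hasPivot_matched h hμ hku) (hasPivot_matched h hμ hkv)
  rw [Finset.card_image_of_injective _ h.injective, Finset.card_image_of_injective _ h.injective,
    Finset.card_singleton] at this
  omega

/-- The eigenvalue `1` is rational and costs no parameter, so the count leaves no room for a kernel
vector. -/
theorem det_block_one_ne_zero (hz : AlgebraicIndependent ℚ z) (X : Finset (Fin n)) :
    (block M σ X z 1).det ≠ 0 := by
  intro h0
  obtain ⟨u, hu, huX, huk⟩ := det_block_eq_zero_iff.1 h0
  obtain ⟨i, _⟩ := supp_nonempty hu
  have hk : ∀ s ∈ supp u, Kills M z 1 u (σ s) := fun s hs => huk s (by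
    by_contra hsX
    exact mem_supp.1 hs (huX s hsX))
  have := card_add_one_le (L := ∅) (i := i) (j := j) hz (one_mem _) hu (kills_matched h hk)
    (hasPivot_matched h one_ne_zero hk)
  rw [Finset.card_image_of_injective _ h.injective, Finset.card_empty] at this
  omega

/-- With a constant number `k` of `λ`-edges and no self-loops, the determinant is `μ ^ k` times its
nonzero value at `1`. -/
theorem det_block_ne_zero_of_not_gammaNZ (hz : AlgebraicIndependent ℚ z) (hμ : μ ≠ 0) {a : Fin n}
    (ha : ¬ GammaNZ M ((bipPencilMinor M j).scc σ a)) :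
    (block M σ ((bipPencilMinor M j).sccRows σ a) z μ).det ≠ 0 := by
  rw [gammaNZ_iff h a] at ha
  push Not at ha
  have h1 : Admissible M σ (1 : Equiv.Perm ((bipPencilMinor M j).sccRows σ a)) := fun r =>
    (mem_bipPencilMinor_edges.1 (h.mem r)).1
  rw [det_block_eq_pow_mul _ (fun τ hτ => ha.1 τ 1 hτ h1) ha.2]
  exact mul_ne_zero (pow_ne_zero _ hμ) (det_block_one_ne_zero h hz _)

/-- An eigenvector of a component extends to a vector annihilated by all columns except `j`. -/
theorem exists_kills_extension (hz : AlgebraicIndependent ℚ z) (hμ : μ ≠ 0) {a : Fin n}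
    (h0 : (block M σ ((bipPencilMinor M j).sccRows σ a) z μ).det = 0) :
    ∃ u : Fin n → ℂ, (∀ c, c ≠ j → Kills M z μ u c) ∧
      ∃ r ∈ (bipPencilMinor M j).sccRows σ a, u r ≠ 0 := by
  classical
  obtain ⟨v, hv, hvX, hvk⟩ := det_block_eq_zero_iff.1 h0
  set X := (bipPencilMinor M j).sccRows σ a with hX
  set Y : Finset (Fin n) := Finset.univ.filter fun r => (bipPencilMinor M j).Reach σ a r ∧ r ∉ X
    with hY
  have hmemY : ∀ r, r ∈ Y ↔ (bipPencilMinor M j).Reach σ a r ∧ r ∉ X := fun r => by simp [hY]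
  have hsuppv : ∀ s ∈ supp v, s ∈ X := fun s hs => by
    by_contra hsX
    exact mem_supp.1 hs (hvX s hsX)
  -- The rows `Y` reached from the component but outside it form a disjoint block, which cannot
  -- share the eigenvalue `μ`.
  have hdet : (block M σ Y z μ).det ≠ 0 := by
    intro hd
    obtain ⟨w, hw, hwY, hwk⟩ := det_block_eq_zero_iff.1 hd
    have hsuppw : ∀ s ∈ supp w, s ∈ Y := fun s hs => by
      by_contra hsY
      exact mem_supp.1 hs (hwY s hsY)
    refine not_disjoint_supp h hz hμ hv hw (fun s hs => hvk s (hsuppv s hs))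
      (fun s hs => hwk s (hsuppw s hs)) (Finset.disjoint_left.2 fun s hs hs' => ?_)
    exact ((hmemY s).1 (hsuppw s hs')).2 (hsuppv s hs)
  -- `w` is the vector on `Y` that cancels the contribution of `v` to the columns of `Y`. The
  -- columns of `X` are not adjacent to `Y`, and the other columns except `j` are adjacent to
  -- neither `X` nor `Y`.
  set b : Y → ℂ := fun s => -∑ r, v r * pencil M z μ r (σ s) with hb
  set w₀ : Y → ℂ := (block M σ Y z μ)⁻¹.mulVec b with hw₀
  have hw₀b : (block M σ Y z μ).mulVec w₀ = b := by
    rw [hw₀, Matrix.mulVec_mulVec, Matrix.mul_nonsing_inv _ (isUnit_iff_ne_zero.2 hdet),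
      Matrix.one_mulVec]
  set w : Fin n → ℂ := fun r => if hr : r ∈ Y then w₀ ⟨r, hr⟩ else 0 with hw
  have hwY : ∀ r, r ∉ Y → w r = 0 := fun r hr => by simp [hw, hr]
  have hwr : ∀ r : Y, w r = w₀ r := fun r => dif_pos r.2
  have hws : ∀ s (hs : s ∈ Y), ∑ r, w r * pencil M z μ r (σ s) = b ⟨s, hs⟩ := by
    intro s hs
    rw [← hw₀b, ← Finset.sum_subset (Finset.subset_univ Y) (fun r _ hr => by
      rw [hwY r hr, zero_mul]), ← Finset.sum_coe_sort]
    exact Finset.sum_congr rfl fun r _ => by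
      rw [mul_comm, hwr r]
      rfl
  have hzero : ∀ r s, ¬ (bipPencilMinor M j).Step σ r s → pencil M z μ r (σ s) = 0 := fun r s hrs =>
    pencil_eq_zero_of_notMem (matched_ne h s) hrs
  obtain ⟨r₀, hr₀⟩ := supp_nonempty hv
  refine ⟨v + w, fun c hc => ?_, r₀, hsuppv _ hr₀, ?_⟩
  · obtain ⟨s, rfl⟩ := exists_matched_eq h hc
    have hsplit : ∑ r, (v + w) r * pencil M z μ r (σ s) =
        ∑ r, v r * pencil M z μ r (σ s) + ∑ r, w r * pencil M z μ r (σ s) := by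
      rw [← Finset.sum_add_distrib]
      simp only [Pi.add_apply, add_mul]
    rw [Kills, hsplit]
    by_cases hsY : s ∈ Y
    · rw [hws s hsY, hb]
      simp
    · have hw0 : ∑ r, w r * pencil M z μ r (σ s) = 0 := by
        refine Finset.sum_eq_zero fun r _ => ?_
        by_cases hr : r ∈ Y
        · rw [hzero, mul_zero]
          intro hrs
          obtain ⟨har, hrX⟩ := (hmemY r).1 hr
          by_cases hsX : s ∈ X
          · exact hrX (mem_sccRows.2 ⟨har, (Relation.ReflTransGen.single hrs).trans
              (mem_sccRows.1 hsX).2⟩)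
          · exact hsY ((hmemY s).2 ⟨har.tail hrs, hsX⟩)
        · rw [hwY r hr, zero_mul]
      rw [hw0, add_zero]
      by_cases hsX : s ∈ X
      · exact hvk s hsX
      · refine Finset.sum_eq_zero fun r _ => ?_
        by_cases hr : r ∈ X
        · rw [hzero, mul_zero]
          intro hrs
          exact hsY ((hmemY s).2 ⟨(mem_sccRows.1 hr).1.tail hrs, hsX⟩)
        · rw [hvX r hr, zero_mul]
  · have : r₀ ∉ Y := fun hr => ((hmemY r₀).1 hr).2 (hsuppv _ hr₀)
    simpa [hwY r₀ this] using mem_supp.1 hr₀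

/-- The restriction of a vector annihilated by all columns except `j` to a source component of its
support is annihilated by the columns of this component. -/
theorem kills_restrict_source (hk : ∀ c, c ≠ j → Kills M z μ u c) {a : Fin n}
    (hmin : ∀ s ∈ supp u, (bipPencilMinor M j).Reach σ s a → (bipPencilMinor M j).Reach σ a s)
    {s : Fin n} (hs : s ∈ (bipPencilMinor M j).sccRows σ a) :
    Kills M z μ (fun r => if r ∈ (bipPencilMinor M j).sccRows σ a then u r else 0) (σ s) := by
  refine Eq.trans ?_ (hk (σ s) (matched_ne h s))
  refine Finset.sum_congr rfl fun r _ => ?_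
  simp only
  split_ifs with hr
  · rfl
  · rw [zero_mul, eq_comm, mul_eq_zero]
    by_contra hcon
    rw [not_or] at hcon
    apply hr
    have hrs : (bipPencilMinor M j).Step σ r s := by
      by_contra hrs
      exact hcon.2 (pencil_eq_zero_of_notMem (matched_ne h s) hrs)
    have hra : (bipPencilMinor M j).Reach σ r a :=
      (Relation.ReflTransGen.single hrs).trans (mem_sccRows.1 hs).2
    exact mem_sccRows.2 ⟨hmin r (mem_supp.2 hcon.1) hra, hra⟩

/-- All rows of the support of an eigenvector are reached from one component with `γ_nz = 1`. -/
theorem exists_gammaNZ_reach (hz : AlgebraicIndependent ℚ z) (hμ : μ ≠ 0)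
    (hk : ∀ c, c ≠ j → Kills M z μ u c) {a b : Fin n} (ha : u a ≠ 0) (hb : u b ≠ 0) :
    ∃ r, GammaNZ M ((bipPencilMinor M j).scc σ r) ∧ (bipPencilMinor M j).Reach σ r a ∧
      (bipPencilMinor M j).Reach σ r b := by
  obtain ⟨r, hr, hra, hrmin⟩ := exists_source (M := M) (j := j) (σ := σ) (mem_supp.2 ha)
  obtain ⟨s, hs, hsb, hsmin⟩ := exists_source (M := M) (j := j) (σ := σ) (mem_supp.2 hb)
  have hres : ∀ x ∈ supp u, (fun y => if y ∈ (bipPencilMinor M j).sccRows σ x then u y else 0) ≠ 0 := by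
    intro x hx h0
    have := congrFun h0 x
    rw [if_pos (self_mem_sccRows x)] at this
    exact mem_supp.1 hx this
  have hsub : ∀ x, ∀ y ∈ supp (fun y => if y ∈ (bipPencilMinor M j).sccRows σ x then u y else 0),
      y ∈ (bipPencilMinor M j).sccRows σ x := by
    intro x y hy
    by_contra hyx
    exact mem_supp.1 hy (if_neg hyx)
  refine ⟨r, ?_, hra, ?_⟩
  -- The restriction of `u` to a source component is a kernel vector of its block, so the
  -- determinant of that block vanishes.
  · by_contra hnz
    exact det_block_ne_zero_of_not_gammaNZ h hz hμ hnz (det_block_eq_zero_iff.2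
      ⟨_, hres r hr, fun y hy => if_neg hy, fun y hy => kills_restrict_source h hk hrmin hy⟩)
  -- The sources below `a` and `b` have the common eigenvalue `μ`, so their supports meet and the
  -- two components coincide.
  · have := not_disjoint_supp h hz hμ (hres r hr) (hres s hs)
      (fun y hy => kills_restrict_source h hk hrmin (hsub r y hy))
      (fun y hy => kills_restrict_source h hk hsmin (hsub s y hy))
    obtain ⟨y, hy1, hy2⟩ := Finset.not_disjoint_iff.1 this
    exact ((mem_sccRows.1 (hsub r y hy1)).1.trans (mem_sccRows.1 (hsub s y hy2)).2).trans hsb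

end

/-- The conditions c1), c2) say that no nonzero value of the entry at `(i, j)` creates a nonzero
uncontrollable eigenvalue. -/
theorem condC_iff {M : Matrix (Fin n) (Fin n ⊕ Fin 1) Entry} {z : Fin n × (Fin n ⊕ Fin 1) → ℂ}
    {j : Fin n ⊕ Fin 1} (hz : AlgebraicIndependent ℚ z) (hc : RealizesControllable M z)
    (hM : M i j ≠ Entry.zero) :
    (CondC1 M i j ∨ CondC2 M i j) ↔ ∀ t, t ≠ 0 → ∀ μ, μ ≠ 0 → ∀ u,
      (∀ c, Kills M (Function.update z (i, j) t) μ u c) → u = 0 := by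
  obtain ⟨σ, h⟩ := exists_isPerfect_bipPencilMinor hc j
  rw [condC1_or_condC2_iff h]
  constructor
  · intro hC t ht μ hμ u hu
    by_contra hu0
    have hku : ∀ c, c ≠ j → Kills M z μ u c := fun c hcj => (kills_update_iff_of_ne hcj).1 (hu c)
    have hui : u i ≠ 0 := by
      intro hui
      exact hu0 (realizesControllable_iff.1 hc μ u fun c =>
        (kills_update_iff_of_apply_eq_zero hui).1 (hu c))
    obtain ⟨r, hnz, hri, _⟩ := exists_gammaNZ_reach h hz hμ hku hui hui
    -- If `j` were the state column of `i`, the entry at `(i, j)` would be `t - μ`, which vanishes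
    -- for `t = μ ≠ 0`. Otherwise the entry `t` has to be balanced by another row of the support
    -- adjacent to `j`.
    have hji := (hC r hnz hri).1
    have hl : ∃ l, l ≠ i ∧ u l ≠ 0 ∧ (j = Sum.inl l ∨ M l j ≠ Entry.zero) := by
      by_contra hcon
      push Not at hcon
      have h1 := hu j
      rw [Kills, Finset.sum_eq_single i (fun r _ hri => by
        by_cases hur : u r = 0
        · rw [hur, zero_mul]
        · simp [pencil, hcon r hri hur]) (fun h => absurd (Finset.mem_univ _) h)] at h1
      simp [pencil, hM, hui, ht, hji] at h1
    obtain ⟨l, hli, hul, hMl⟩ := hl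
    obtain ⟨s, hsnz, hsi, hsl⟩ := exists_gammaNZ_reach h hz hμ hku hui hul
    exact (hC s hsnz hsi).2 l ⟨mem_bipPencil_edges.2 hMl, hli⟩ hsl
  · intro hgood a hnz hai
    by_contra hcon
    obtain ⟨μ, hμ, hdet⟩ := exists_det_block_eq_zero h hz hnz
    obtain ⟨u, hku, r, hrX, hur⟩ := exists_kills_extension h hz hμ hdet
    have hreach : ∀ s, (bipPencilMinor M j).Reach σ a s → u s ≠ 0 := fun s hs =>
      mem_supp.1 ((stepClosed_supp h hz hμ hku).mem_of_reach (mem_supp.2 hur)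
        ((mem_sccRows.1 hrX).2.trans hs))
    obtain ⟨t, ht⟩ := exists_kills_update (z := z) (μ := μ) hM (hreach i hai)
    have hut : ∀ c, Kills M (Function.update z (i, j) t) μ u c := by
      intro c
      by_cases hcj : c = j
      · subst hcj
        exact ht
      · exact (kills_update_iff_of_ne hcj).2 (hku c hcj)
    -- With `t = 0`, column `j` would annihilate `u` although it is not matched with the support and
    -- is adjacent to it apart from the moved entry: by the `λ`-edge at `i` if `j` is the state
    -- column of `i`, and otherwise through a neighbour `l ≠ i` reached from `a`. The parameter
    -- count excludes this.
    by_cases ht0 : t = 0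
    · subst ht0
      have hj : j ∉ (supp u).image σ := by
        intro hmem
        obtain ⟨s, _, hs⟩ := Finset.mem_image.1 hmem
        exact matched_ne h s hs
      have hk' : ∀ s ∈ supp u, Kills M z μ u (σ s) := fun s _ => hku _ (matched_ne h s)
      by_cases hji : j = Sum.inl i
      · exact not_kills_of_notMem_image h hz hμ hk' hj (hreach i hai) (Or.inl hji) ht
      · have hl : ∃ l ∈ (bipPencil M).colNbrs j \ {i}, (bipPencilMinor M j).Reach σ a l := by
          by_contra hl
          push Not at hl
          exact hcon ⟨hji, hl⟩
        obtain ⟨l, ⟨hlj, hli⟩, hal⟩ := hl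
        exact not_kills_of_notMem_image h hz hμ hk' hj (hreach l hal)
          ((mem_bipPencil_edges.1 hlj).imp_right fun h' =>
            ⟨h', fun h'' => hli (Prod.ext_iff.1 h'').1⟩) ht
    · exact hur (congrFun (hgood t ht0 μ hμ u hut) r)

end NonzeroEigenvalue

end Structured

/-! ### The criterion for a single `×` entry -/

namespace Structured

section KeepOnly

variable {n : ℕ} {M : Matrix (Fin n) (Fin n ⊕ Fin 1) Entry} {π : Fin n × (Fin n ⊕ Fin 1)}
  {z : Fin n × (Fin n ⊕ Fin 1) → ℂ} {i : Fin n} {j : Fin n ⊕ Fin 1}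

theorem keepOnly_eq_zero_iff {r : Fin n} {c : Fin n ⊕ Fin 1} :
    keepOnly M π r c = Entry.zero ↔ M r c = Entry.zero := by
  simp only [keepOnly, Matrix.of_apply]
  split_ifs with h
  · simp [h.2]
  · rfl

/-- `realize` sees only the zero pattern, which `keepOnly` preserves, so the distinction between `*`
and `×` plays no role once a single entry is moved. -/
theorem realizesControllable_keepOnly :
    RealizesControllable (keepOnly M π) z ↔ RealizesControllable M z := by
  have : realize (keepOnly M π) z = realize M z := by
    ext r c
    simp only [realize, Matrix.of_apply, keepOnly_eq_zero_iff]
  rw [RealizesControllable, RealizesControllable, this]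

/-- The conditions of the criterion for a single `×` entry. -/
theorem forall_realizesControllable_update_iff (hz : AlgebraicIndependent ℚ z)
    (hc : RealizesControllable M z) (hM : M i j ≠ Entry.zero) :
    (∀ t, t ≠ 0 → RealizesControllable M (Function.update z (i, j) t)) ↔
      (CondB1 M j ∨ CondB2 M i j ∨ CondB3 M i j) ∧ (CondC1 M i j ∨ CondC2 M i j) := by
  rw [condB_iff hz hc hM, condC_iff hz hc hM]
  simp_rw [realizesControllable_iff]
  constructor
  · intro h
    exact ⟨fun t ht => h t ht 0, fun t ht μ _ => h t ht μ⟩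
  · rintro ⟨hB, hC⟩ t ht μ
    by_cases hμ : μ = 0
    · subst hμ
      exact hB t ht
    · exact hC t ht μ hμ

theorem forall_realizesControllable_update_iff_keepOnly (hz : AlgebraicIndependent ℚ z)
    (hc : RealizesControllable M z) (hM : M i j ≠ Entry.zero) :
    (∀ t, t ≠ 0 → RealizesControllable M (Function.update z (i, j) t)) ↔
      (CondB1 (keepOnly M (i, j)) j ∨ CondB2 (keepOnly M (i, j)) i j ∨
        CondB3 (keepOnly M (i, j)) i j) ∧
      (CondC1 (keepOnly M (i, j)) i j ∨ CondC2 (keepOnly M (i, j)) i j) := by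
  rw [← forall_realizesControllable_update_iff hz (realizesControllable_keepOnly.2 hc)
    (mt keepOnly_eq_zero_iff.1 hM)]
  simp_rw [realizesControllable_keepOnly]

end KeepOnly

end Structured

/-- Criterion for partial strong structural controllability of single-input systems: structural
controllability together with, for each `×` entry `(i, j)` of `[A', b']`, one of b1)-b3) and one
of c1)-c2) for the system in which only that `×` entry is kept. -/
theorem theorem2 (n : ℕ) (A' : Matrix (Fin n) (Fin n) Entry) (b' : Matrix (Fin n) (Fin 1) Entry) :
    Structured.PSSC A' b' ↔
      Structured.StructurallyControllable A' b' ∧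
        ∀ (i : Fin n) (j : Fin n ⊕ Fin 1), Matrix.fromCols A' b' i j = Entry.cross →
          (Structured.CondB1 (Structured.keepOnly (Matrix.fromCols A' b') (i, j)) j ∨
            Structured.CondB2 (Structured.keepOnly (Matrix.fromCols A' b') (i, j)) i j ∨
            Structured.CondB3 (Structured.keepOnly (Matrix.fromCols A' b') (i, j)) i j) ∧
          (Structured.CondC1 (Structured.keepOnly (Matrix.fromCols A' b') (i, j)) i j ∨
            Structured.CondC2 (Structured.keepOnly (Matrix.fromCols A' b') (i, j)) i j) := by
  constructor
  · intro h
    obtain ⟨z, hz, hc, hx⟩ := h.exists_generic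
    refine ⟨(Structured.structurallyControllable_iff hz).2 hc, fun i j hij => ?_⟩
    exact (Structured.forall_realizesControllable_update_iff_keepOnly hz hc (by
      rw [hij]
      decide)).1
      (hx (i, j) hij)
  · rintro ⟨hs, h⟩
    obtain ⟨z, hz⟩ := (ae_algebraicIndependent (Fin n × (Fin n ⊕ Fin 1))).exists
    have hc := (Structured.structurallyControllable_iff hz).1 hs
    refine Structured.pssc_of_generic hz hc fun x hx => ?_
    exact (Structured.forall_realizesControllable_update_iff_keepOnly hz hc (by
      rw [hx]
      decide)).2
      (h x.1 x.2 hx)
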